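/- Fix a security parameter $\kappa$. All parties and algorithms below are poly-size families of circuits: honest players and algorithms are classical, adversaries, simulators, input samplers and distinguishers are quantum. Messages are classical. An adversary's input consists of a quantum part and a classical part $Z$, prepared by a poly-size quantum input sampler; honest players have no input. **Coin-flip protocols.** A coin-flip protocol for $\lambda$-bit strings is a classical two-party protocol with poly-size honest players Alice and Bob and outcome in $\{0,1\}^\lambda\cup\{\bot\}$ such that, when both are honest, for every $c\in\{0,1\}^\lambda$ both output $c$ with probability exactly $2^{-\lambda}$. With a dishonest party, the outcome is the output of the honest party. The protocol is * *enforceable against Alice* if for every poly-size dishonest Alice there is a poly-size ideal-world adversary such that for every poly-size input sampler the joint outputs (adversary's final register, $Z$, Bob's output) of the real and the ideal run are indistinguishable by poly-size quantum circuits. In the ideal run the functionality gives a uniform $h\in\{0,1\}^\lambda$ to the ideal-world adversary, who then answers $\top$ or $\bot$, and Bob's output is $h$ or $\bot$ accordingly; * *uncontrollable against Bob* if for every poly-size dishonest Bob, every poly-size input sampler and all sets $Q_\kappa\subseteq\{0,1\}^\lambda$ with $|Q_\kappa|2^{-\lambda}$ negligible, the probability that the outcome lies in $Q_\kappa$ is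 negligible; * *random against Bob* if for every poly-size dishonest Bob and every poly-size input sampler there is an event $E$ with $\Pr[E]$ negligible such that $\Pr[c=x\mid\bar E]\le 2^{-\lambda}$ for all $x\in\{0,1\}^\lambda$, where $c$ is the outcome; *statistically random against Bob* if instead $\Pr[c=x\wedge\bar E]\le 2^{-\lambda}$ for all $x$. Events may depend on additional randomness. **Mixed commitments.** A mixed commitment scheme for $\ell$-bit messages with $\kappa$-bit keys consists of poly-size algorithms $\mathcal G_H$ (output $pk$), $\mathcal G_B$ (output $(pk,sk)$), $\mathsf{commit}_{pk}(m,r)$ and $\mathsf{xtr}_{sk}(C)$ such that: for $pk$ from $\mathcal G_H$ and uniform independent randomizers, $(pk,\mathsf{commit}_{pk}(m_1,r_1))$ and $(pk,\mathsf{commit}_{pk}(m_2,r_2))$ are statistically close for all $m_1,m_2$; $\mathsf{xtr}_{sk}(\mathsf{commit}_{pk}(m,r))=m$ for all $(pk,sk)$ from $\mathcal G_B$ and all $m,r$; keys $pk$ from $\mathcal G_B$ and from $\mathcal G_H$ are indistinguishable by poly-size quantum circuits; keys from $\mathcal G_H$ are statistically close to uniform in $\{0,1\}^\kappa$. **Theorem.**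 Let $\ell=\ell(\kappa)$ be polynomially bounded, let $\mathsf{commit}$ be a mixed commitment scheme for $\ell$-bit messages, and let $\pi$ be a coin-flip protocol for $\kappa$-bit strings that is enforceable against Alice and uncontrollable against Bob. Let $\pi^{(\mathrm{force},\mathrm{random})}$ be the following protocol. (1) Alice and Bob run $\pi$ to obtain $pk\in\{0,1\}^\kappa$. (2) Alice samples uniform $a\in\{0,1\}^\ell$ and a uniform randomizer $r$ and sends $A=\mathsf{commit}_{pk}(a,r)$. (3) Bob sends a uniform $b\in\{0,1\}^\ell$. (4) Alice sends $(a,r)$ and Bob checks $A=\mathsf{commit}_{pk}(a,r)$. (5) The outcome is $c=a\oplus b$; a player outputs $\bot$ if $\pi$ gave it $\bot$, Alice outputs $\bot$ if Bob refuses to send $b$, and Bob outputs $\bot$ if the check fails. Then $\pi^{(\mathrm{force},\mathrm{random})}$ is a coin-flip protocol for $\ell$-bit strings that is 1. enforceable against Alice; 2. statistically random against Bob; 3. random against Bob, if all but a negligible fraction of the keys $pk\in\{0,1\}^\kappa$ are perfectly hiding, that is, the distribution of $\mathsf{commit}_{pk}(m,r)$ for uniform $r$ is the same for all $m$. -/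

import Mathlib

open scoped Matrix

noncomputable section

namespace CoinFlip

/-! ### Bit strings, asymptotics, finite probability -/

/-- Bit strings of length `n`. -/
abbrev Bits (n : ℕ) : Type := Fin n → Bool

/-- Bitwise exclusive or. -/
def bxor {n : ℕ} (a b : Bits n) : Bits n := fun i => xor (a i) (b i)

/-- First part of a string of length `m + n`. -/
def left {m n : ℕ} (v : Bits (m + n)) : Bits m := fun i => v (Fin.castAdd n i)

/-- Second part of a string of length `m + n`. -/
def right {m n : ℕ} (v : Bits (m + n)) : Bits n := fun i => v (Fin.natAdd m i)

/-- A string or `⊥`, written with `n + 1` bits: a validity bit, then the string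
(all zero for `⊥`). -/
def encOpt {n : ℕ} : Option (Bits n) → Bits (n + 1)
  | none => fun _ => false
  | some c => Fin.cons true c

/-- Reading of such an encoding. -/
def decOpt {n : ℕ} (v : Bits (n + 1)) : Option (Bits n) :=
  if v 0 then some (Fin.tail v) else none

/-- Negligible functions: they decay faster than every inverse polynomial. -/
def Negligible (f : ℕ → ℝ) : Prop :=
  Asymptotics.SuperpolynomialDecay Filter.atTop (fun κ : ℕ => (κ : ℝ)) f

/-- Bounded by a polynomial in the security parameter. -/
def PolyBounded (f : ℕ → ℕ) : Prop :=
  ∃ p : Polynomial ℕ, ∀ κ, f κ ≤ p.eval κ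

open Classical in
/-- The distribution of `f t` for uniformly random `t`. -/
def law {T α : Type} [Fintype T] (f : T → α) (a : α) : ℝ :=
  ((Finset.univ.filter fun t => f t = a).card : ℝ) / (Fintype.card T : ℝ)

/-- Statistical distance. -/
def statDist {α : Type} [Fintype α] (p q : α → ℝ) : ℝ := (1 / 2) * ∑ a, |p a - q a|

/-- A family of subsets of `{0,1}^lam` whose density is negligible. -/
def NegligibleSubset {lam : ℕ → ℕ} (Q : ∀ κ, Finset (Bits (lam κ))) : Prop :=
  Negligible fun κ => ((Q κ).card : ℝ) * ((2 : ℝ) ^ lam κ)⁻¹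

/-! ### Classical circuits -/

/-- Classical gates, all of them reversible; with wires initialised to zero they are
complete for Boolean circuits. -/
inductive CGate (W : Type) : Type
  | not (i : W) : CGate W
  | cnot (i j : W) (hij : i ≠ j) : CGate W
  | toffoli (i j k : W) (hij : i ≠ j) (hik : i ≠ k) (hjk : j ≠ k) : CGate W

/-- Action of a classical gate on bit assignments; the last wire is the target. -/
def CGate.act {W : Type} [DecidableEq W] : CGate W → (W → Bool) → (W → Bool)
  | .not i, x => Function.update x i (!x i)
  | .cnot i j _, x => Function.update x j (xor (x j) (x i))
  | .toffoli i j k _ _ _, x => Function.update x k (xor (x k) (x i && x j))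

/-- Action of a list of classical gates, first gate first. -/
def runClassical {W : Type} [DecidableEq W] (gs : List (CGate W)) (x : W → Bool) : W → Bool :=
  gs.foldl (fun y g => g.act y) x

/-- `f` is computed by a classical circuit of size at most `s`, where the size is the number of
wires (inputs and outputs included) plus the number of gates. -/
def Computes {I O : Type} (s : ℕ) (f : (I → Bool) → (O → Bool)) : Prop :=
  ∃ (n : ℕ) (inp : I ↪ Fin n) (out : O ↪ Fin n) (gs : List (CGate (Fin n))),
    n + gs.length ≤ s ∧
    ∀ x o, runClassical gs (Function.extend inp x fun _ => false) (out o) = f x o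

/-! ### Quantum circuits on density matrices -/

/-- (Unnormalised) density matrices of the qubits in `W`, in the computational basis. -/
abbrev State (W : Type) : Type := Matrix (W → Bool) (W → Bool) ℂ

/-- The gate set: classical reversible gates, Hadamard, the `π/8` gate, measurement of a qubit in
the computational basis (outcome left on the wire), and resetting a qubit to zero. -/
inductive QGate (W : Type) : Type
  | classical (g : CGate W) : QGate W
  | hadamard (i : W) : QGate W
  | tgate (i : W) : QGate W
  | measure (i : W) : QGate W
  | reset (i : W) : QGate W

section Quantum

variable {W : Type} [Fintype W] [DecidableEq W]

/-- `ρ ↦ K ρ K†`. -/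
def conj (K : State W) (ρ : State W) : State W := K * ρ * Kᴴ

/-- The matrix mapping the basis vector `y` to the basis vector `f y`. -/
def basisMap (f : (W → Bool) → (W → Bool)) : State W :=
  Matrix.of fun x y => if x = f y then 1 else 0

/-- Hadamard on wire `i`. -/
def hadamardMatrix (i : W) : State W :=
  Matrix.of fun x y =>
    if ∀ j, j ≠ i → x j = y j then
      (if x i && y i then -1 else 1) * ((Real.sqrt 2 : ℝ) : ℂ)⁻¹
    else 0

/-- The `π/8` gate on wire `i`. -/
def tMatrix (i : W) : State W :=
  Matrix.diagonal fun x => if x i then Complex.exp (Complex.I * Real.pi / 4) else 1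

/-- Post-measurement state, with weight the probability of the outcome, when the wires
`port` are measured in the computational basis with outcome `v`. -/
def project {m : ℕ} (port : Fin m ↪ W) (v : Bits m) (ρ : State W) : State W :=
  conj (Matrix.diagonal fun x => if x ∘ port = v then 1 else 0) ρ

/-- Discarding the content of the wires `port` and writing the classical string `v` on them. -/
def write {m : ℕ} (port : Fin m ↪ W) (v : Bits m) (ρ : State W) : State W :=
  ∑ u : Bits m,
    conj (Matrix.of fun x y => if y ∘ port = u ∧ x = Function.extend port v y then 1 else 0) ρ

/-- Action of a gate on density matrices. -/
def QGate.apply : QGate W → State W → State W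
  | .classical g, ρ => conj (basisMap g.act) ρ
  | .hadamard i, ρ => conj (hadamardMatrix i) ρ
  | .tgate i, ρ => conj (tMatrix i) ρ
  | .measure i, ρ => ∑ b : Bool, conj (Matrix.diagonal fun x => if x i = b then 1 else 0) ρ
  | .reset i, ρ => ∑ b : Bool,
      conj (Matrix.of fun x y => if y i = b ∧ x = Function.update y i false then 1 else 0) ρ

/-- Action of a circuit, first gate first. -/
def applyAll (gs : List (QGate W)) (ρ : State W) : State W :=
  gs.foldl (fun σ g => g.apply σ) ρ

/-- `ρ ⊗ |v⟩⟨v|`. -/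
def adjoin {E : Type} [Fintype E] [DecidableEq E] (ρ : State W) (v : E → Bool) : State (W ⊕ E) :=
  Matrix.of fun x y => if x ∘ Sum.inr = v ∧ y ∘ Sum.inr = v then ρ (x ∘ Sum.inl) (y ∘ Sum.inl) else 0

/-- State of the wires `W`, weighted with the probability of the outcome, when the other wires
are measured with outcome `v` and removed. -/
def condition {E : Type} (ρ : State (W ⊕ E)) (v : E → Bool) : State W :=
  Matrix.of fun x y => ρ (Sum.elim x v) (Sum.elim y v)

end Quantum

/-! ### Quantum-computational indistinguishability -/

/-- A distinguisher for states of `E`: a circuit with `anc` additional qubits initialised to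
zero, and the wire on which its output bit is measured. -/
structure Distinguisher (E : Type) where
  anc : ℕ
  gates : List (QGate (E ⊕ Fin anc))
  out : E ⊕ Fin anc

/-- The probability that the distinguisher outputs 1 on `ρ`. -/
def Distinguisher.accept {E : Type} [Fintype E] [DecidableEq E] (D : Distinguisher E)
    (ρ : State E) : ℝ :=
  ∑ x : E ⊕ Fin D.anc → Bool,
    if x D.out then (applyAll D.gates (adjoin ρ fun _ => false) x x).re else 0

/-- Two families of states cannot be told apart by poly-size families of quantum circuits. -/
def QIndist {E : ℕ → Type} [∀ κ, Fintype (E κ)] [∀ κ, DecidableEq (E κ)]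
    (ρ σ : ∀ κ, State (E κ)) : Prop :=
  ∀ D : ∀ κ, Distinguisher (E κ), PolyBounded (fun κ => (D κ).anc + (D κ).gates.length) →
    Negligible fun κ => |(D κ).accept (ρ κ) - (D κ).accept (σ κ)|

/-- A classical random string as a (diagonal) state. -/
def classicalState {E : Type} (p : (E → Bool) → ℝ) [DecidableEq E] [Fintype E] : State E :=
  Matrix.diagonal fun x => (p x : ℂ)

/-! ### Mixed commitments -/

/-- The four algorithms of a commitment scheme with two key generators, keys of length `κ` and
messages of length `ℓ κ`. Randomised algorithms take their coins as an argument. -/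
structure CommitmentScheme (ℓ : ℕ → ℕ) where
  coinsH : ℕ → ℕ
  coinsB : ℕ → ℕ
  skLen : ℕ → ℕ
  rLen : ℕ → ℕ
  comLen : ℕ → ℕ
  /-- the hiding key generator -/
  genH : ∀ κ, Bits (coinsH κ) → Bits κ
  /-- the binding key generator, with output `(pk, sk)` -/
  genB : ∀ κ, Bits (coinsB κ) → Bits κ × Bits (skLen κ)
  /-- `commit κ pk m r` -/
  commit : ∀ κ, Bits κ → Bits (ℓ κ) → Bits (rLen κ) → Bits (comLen κ)
  /-- `xtr κ C sk` -/
  xtr : ∀ κ, Bits (comLen κ) → Bits (skLen κ) → Bits (ℓ κ)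

/-- The four algorithms have poly-size circuits. -/
def CommitmentScheme.Efficient {ℓ : ℕ → ℕ} (C : CommitmentScheme ℓ) : Prop :=
  ∃ p : Polynomial ℕ, ∀ κ,
    Computes (p.eval κ) (C.genH κ) ∧
    Computes (p.eval κ) (fun t => Sum.elim (C.genB κ t).1 (C.genB κ t).2) ∧
    Computes (p.eval κ) (fun v : Fin κ ⊕ (Fin (ℓ κ) ⊕ Fin (C.rLen κ)) → Bool =>
      C.commit κ (v ∘ Sum.inl) (v ∘ Sum.inr ∘ Sum.inl) (v ∘ Sum.inr ∘ Sum.inr)) ∧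
    Computes (p.eval κ) (fun v : Fin (C.comLen κ) ⊕ Fin (C.skLen κ) → Bool =>
      C.xtr κ (v ∘ Sum.inl) (v ∘ Sum.inr))

/-- Mixed commitment schemes. -/
structure CommitmentScheme.IsMixed {ℓ : ℕ → ℕ} (C : CommitmentScheme ℓ) : Prop where
  efficient : C.Efficient
  /-- `(pk, commit_pk(m₁, r₁))` and `(pk, commit_pk(m₂, r₂))` are statistically close for a key
  `pk` from the hiding generator, for all messages -/
  statHiding : ∃ ε : ℕ → ℝ, Negligible ε ∧ ∀ κ (m₁ m₂ : Bits (ℓ κ)),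
    statDist
      (law fun t : Bits (C.coinsH κ) × Bits (C.rLen κ) =>
        (C.genH κ t.1, C.commit κ (C.genH κ t.1) m₁ t.2))
      (law fun t : Bits (C.coinsH κ) × Bits (C.rLen κ) =>
        (C.genH κ t.1, C.commit κ (C.genH κ t.1) m₂ t.2)) ≤ ε κ
  extractable : ∀ κ (t : Bits (C.coinsB κ)) (m : Bits (ℓ κ)) (r : Bits (C.rLen κ)),
    C.xtr κ (C.commit κ (C.genB κ t).1 m r) (C.genB κ t).2 = m
  keyIndist : QIndist
    (fun κ => classicalState (law fun t => (C.genB κ t).1))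
    (fun κ => classicalState (law (C.genH κ)))
  almostUniform : Negligible fun κ =>
    statDist (law (C.genH κ)) (fun _ => ((2 : ℝ) ^ κ)⁻¹)

open Classical in
/-- All keys but a negligible fraction are perfectly hiding: the distribution of a commitment,
for a uniformly random randomizer, does not depend on the message. -/
def CommitmentScheme.PerfectlyHiding {ℓ : ℕ → ℕ} (C : CommitmentScheme ℓ) : Prop :=
  NegligibleSubset (lam := fun κ => κ) fun κ =>
    Finset.univ.filter fun pk : Bits κ =>
      ¬ ∀ m₁ m₂ : Bits (ℓ κ), law (C.commit κ pk m₁) = law (C.commit κ pk m₂)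

/-! ### Honest strategies and protocols

A protocol has a list of rounds; in a round of format `(m, n)` Alice sends `m` bits to Bob, who
answers with `n` bits. A strategy is deterministic; its coins are an argument. -/

/-- Strategies for Alice with output in `O`. -/
def AliceStrat (O : Type) : List (ℕ × ℕ) → Type
  | [] => O
  | (m, n) :: rs => Bits m × (Bits n → AliceStrat O rs)

/-- Strategies for Bob with output in `O`. -/
def BobStrat (O : Type) : List (ℕ × ℕ) → Type
  | [] => O
  | (m, n) :: rs => Bits m → Bits n × BobStrat O rs

/-- Continue Alice's strategy in further rounds, depending on its output. -/
def AliceStrat.bind {O P : Type} {rs' : List (ℕ × ℕ)} :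
    (rs : List (ℕ × ℕ)) → AliceStrat O rs → (O → AliceStrat P rs') → AliceStrat P (rs ++ rs')
  | [], o, k => k o
  | (_, _) :: rs, a, k => (a.1, fun v => AliceStrat.bind rs (a.2 v) k)

/-- Continue Bob's strategy in further rounds, depending on its output. -/
def BobStrat.bind {O P : Type} {rs' : List (ℕ × ℕ)} :
    (rs : List (ℕ × ℕ)) → BobStrat O rs → (O → BobStrat P rs') → BobStrat P (rs ++ rs')
  | [], o, k => k o
  | (_, _) :: rs, b, k => fun v => ((b v).1, BobStrat.bind rs (b v).2 k)

/-- Outputs of Alice and Bob when both are honest. -/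
def honestRun {O P : Type} :
    (rs : List (ℕ × ℕ)) → AliceStrat O rs → BobStrat P rs → O × P
  | [], a, b => (a, b)
  | (_, _) :: rs, a, b => honestRun rs (a.2 (b a.1).1) (b a.1).2

/-- Every message and the output of Alice is computed by a circuit of size at most `s` from the
inputs `I` (her coins) and the messages received so far. -/
def AliceStrat.SizeLE (L s : ℕ) : (rs : List (ℕ × ℕ)) → (I : Type) →
    ((I → Bool) → AliceStrat (Option (Bits L)) rs) → Prop
  | [], _, f => Computes s (fun x => encOpt (f x))
  | (_, n) :: rs, I, f =>
      Computes s (fun x => (f x).1) ∧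
      AliceStrat.SizeLE L s rs (I ⊕ Fin n) fun x => (f (x ∘ Sum.inl)).2 (x ∘ Sum.inr)

/-- Every message and the output of Bob is computed by a circuit of size at most `s` from the
inputs `I` (his coins) and the messages received so far. -/
def BobStrat.SizeLE (L s : ℕ) : (rs : List (ℕ × ℕ)) → (I : Type) →
    ((I → Bool) → BobStrat (Option (Bits L)) rs) → Prop
  | [], _, f => Computes s (fun x => encOpt (f x))
  | (m, _) :: rs, I, f =>
      Computes s (fun x : I ⊕ Fin m → Bool => (f (x ∘ Sum.inl) (x ∘ Sum.inr)).1) ∧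
      BobStrat.SizeLE L s rs (I ⊕ Fin m) fun x => (f (x ∘ Sum.inl) (x ∘ Sum.inr)).2

/-- A family of coin-flip protocols for `lam κ`-bit strings; `none` is the output `⊥`. -/
structure Protocol (lam : ℕ → ℕ) where
  rounds : ℕ → List (ℕ × ℕ)
  coinsA : ℕ → ℕ
  coinsB : ℕ → ℕ
  alice : ∀ κ, Bits (coinsA κ) → AliceStrat (Option (Bits (lam κ))) (rounds κ)
  bob : ∀ κ, Bits (coinsB κ) → BobStrat (Option (Bits (lam κ))) (rounds κ)

/-- The honest players are poly-size. -/
def Protocol.Efficient {lam : ℕ → ℕ} (π : Protocol lam) : Prop :=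
  ∃ p : Polynomial ℕ, ∀ κ,
    (π.rounds κ).length ≤ p.eval κ ∧
    AliceStrat.SizeLE (lam κ) (p.eval κ) (π.rounds κ) (Fin (π.coinsA κ)) (π.alice κ) ∧
    BobStrat.SizeLE (lam κ) (p.eval κ) (π.rounds κ) (Fin (π.coinsB κ)) (π.bob κ)

/-- Honest players agree on each `c` with probability exactly `2^(-lam)`. -/
def Protocol.Unbiased {lam : ℕ → ℕ} (π : Protocol lam) : Prop :=
  ∀ κ (c : Bits (lam κ)),
    law (fun t : Bits (π.coinsA κ) × Bits (π.coinsB κ) =>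
      honestRun (π.rounds κ) (π.alice κ t.1) (π.bob κ t.2)) (some c, some c)
      = ((2 : ℝ) ^ lam κ)⁻¹

/-! ### Adversaries -/

/-- One move of an adversary: a circuit, the wires from which the outgoing message of `m` bits is
measured, and the wires to which the incoming message of `n` bits is written. -/
structure QMove (W : Type) (m n : ℕ) where
  gates : List (QGate W)
  out : Fin m ↪ W
  inp : Fin n ↪ W

/-- Quantum strategies in the place of Alice, with a final circuit. -/
def QAlice (W : Type) : List (ℕ × ℕ) → Type
  | [] => List (QGate W)
  | (m, n) :: rs => QMove W m n × QAlice W rs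

/-- Quantum strategies in the place of Bob, with a final circuit. -/
def QBob (W : Type) : List (ℕ × ℕ) → Type
  | [] => List (QGate W)
  | (m, n) :: rs => QMove W n m × QBob W rs

/-- Total number of gates. -/
def QAlice.gateCount {W : Type} : (rs : List (ℕ × ℕ)) → QAlice W rs → ℕ
  | [], gs => List.length gs
  | (_, _) :: rs, s => s.1.gates.length + QAlice.gateCount rs s.2

/-- Total number of gates. -/
def QBob.gateCount {W : Type} : (rs : List (ℕ × ℕ)) → QBob W rs → ℕ
  | [], gs => List.length gs
  | (_, _) :: rs, s => s.1.gates.length + QBob.gateCount rs s.2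

/-- Run of a dishonest Alice with register `W` in state `ρ` against an honest strategy of Bob:
for each output of Bob, the final state of her register, weighted with the probability. -/
def QAlice.run {W O : Type} [Fintype W] [DecidableEq W] [DecidableEq O] :
    (rs : List (ℕ × ℕ)) → QAlice W rs → BobStrat O rs → State W → O → State W
  | [], gs, (o : O), ρ, y => if y = o then applyAll gs ρ else 0
  | (m, _) :: rs, s, b, ρ, y =>
      ∑ v : Bits m, QAlice.run rs s.2 (b v).2
        (write s.1.inp (b v).1 (project s.1.out v (applyAll s.1.gates ρ))) y

/-- Run of a dishonest Bob against an honest strategy of Alice. -/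
def QBob.run {W O : Type} [Fintype W] [DecidableEq W] [DecidableEq O] :
    (rs : List (ℕ × ℕ)) → QBob W rs → AliceStrat O rs → State W → O → State W
  | [], gs, (o : O), ρ, y => if y = o then applyAll gs ρ else 0
  | (_, n) :: rs, s, a, ρ, y =>
      ∑ v : Bits n, QBob.run rs s.2 (a.2 v)
        (project s.1.out v (applyAll s.1.gates (write s.1.inp a.1 ρ))) y

/-- The register of an adversary: `u` qubits of quantum input, `z` bits of classical input, and
`a` qubits initialised to zero. -/
abbrev Reg (u z a : ℕ) : Type := (Fin u ⊕ Fin z) ⊕ Fin a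

/-- Input samplers: circuits that prepare the quantum input and the classical input of the
adversary (together with `anc` further qubits, which are discarded) from the all-zero state. The
honest player has no input. -/
structure Sampler (uLen zLen : ℕ → ℕ) where
  anc : ℕ → ℕ
  gates : ∀ κ, List (QGate (Fin (uLen κ) ⊕ (Fin (zLen κ) ⊕ Fin (anc κ))))

/-- Poly-size input samplers. -/
def Sampler.Poly {uLen zLen : ℕ → ℕ} (S : Sampler uLen zLen) : Prop :=
  PolyBounded fun κ => uLen κ + zLen κ + S.anc κ + (S.gates κ).length

/-- The quantum input for the value `z` of the classical input, weighted with the probability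
of `z`. -/
def Sampler.state {uLen zLen : ℕ → ℕ} (S : Sampler uLen zLen) (κ : ℕ) (z : Bits (zLen κ)) :
    State (Fin (uLen κ)) :=
  ∑ e : Bits (S.anc κ),
    condition (applyAll (S.gates κ) (Matrix.single (fun _ => false) (fun _ => false) 1))
      (Sum.elim z e)

/-- Initial state of the adversary with `a` additional qubits, for the value `z` of the classical
input, of which it obtains a copy. -/
def Sampler.init {uLen zLen : ℕ → ℕ} (S : Sampler uLen zLen) (κ a : ℕ) (z : Bits (zLen κ)) :
    State (Reg (uLen κ) (zLen κ) a) :=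
  adjoin (adjoin (S.state κ z) z) fun _ => false

/-- Dishonest Alice in protocols with the given rounds. -/
structure AliceAdversary (rounds : ℕ → List (ℕ × ℕ)) where
  uLen : ℕ → ℕ
  zLen : ℕ → ℕ
  anc : ℕ → ℕ
  strat : ∀ κ, QAlice (Reg (uLen κ) (zLen κ) (anc κ)) (rounds κ)

/-- Dishonest Bob in protocols with the given rounds. -/
structure BobAdversary (rounds : ℕ → List (ℕ × ℕ)) where
  uLen : ℕ → ℕ
  zLen : ℕ → ℕ
  anc : ℕ → ℕ
  strat : ∀ κ, QBob (Reg (uLen κ) (zLen κ) (anc κ)) (rounds κ)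

/-- Poly-size adversaries. -/
def AliceAdversary.Poly {rounds : ℕ → List (ℕ × ℕ)} (A : AliceAdversary rounds) : Prop :=
  PolyBounded fun κ => A.uLen κ + A.zLen κ + A.anc κ + QAlice.gateCount (rounds κ) (A.strat κ)

/-- Poly-size adversaries. -/
def BobAdversary.Poly {rounds : ℕ → List (ℕ × ℕ)} (B : BobAdversary rounds) : Prop :=
  PolyBounded fun κ => B.uLen κ + B.zLen κ + B.anc κ + QBob.gateCount (rounds κ) (B.strat κ)

/-- Wires of the joint output of a run with dishonest Alice: her register, the classical input `Z`,
and Bob's output. -/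
abbrev OutWires (u z a L : ℕ) : Type := Reg u z a ⊕ (Fin z ⊕ Fin (L + 1))

/-- The joint output of a real run with dishonest Alice. -/
def realOutput {lam : ℕ → ℕ} (π : Protocol lam) (A : AliceAdversary π.rounds)
    (S : Sampler A.uLen A.zLen) (κ : ℕ) :
    State (OutWires (A.uLen κ) (A.zLen κ) (A.anc κ) (lam κ)) :=
  ((2 : ℂ) ^ π.coinsB κ)⁻¹ • ∑ t : Bits (π.coinsB κ), ∑ z : Bits (A.zLen κ),
    ∑ y : Option (Bits (lam κ)),
      adjoin (QAlice.run (π.rounds κ) (A.strat κ) (π.bob κ t) (S.init κ (A.anc κ) z) y)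
        (Sum.elim z (encOpt y))

/-- Ideal-world adversaries in the place of Alice, with the input and output wires of a real-world
adversary with register `Reg u z a`. The circuit acts on these wires, on `L` wires that hold the
string obtained from the functionality, and on `anc` qubits initialised to zero. The wire `decision`
holds the second input for the functionality (1 for `⊤`, 0 for `⊥`). -/
structure IdealAlice (u z a L : ℕ) where
  anc : ℕ
  gates : List (QGate (Reg u z a ⊕ (Fin L ⊕ Fin anc)))
  decision : Fin L ⊕ Fin anc

/-- The joint output in the ideal world with dishonest Alice: the functionality draws a uniform `h`
and gives it to her; Bob obtains `h` or `⊥`, as she decides. -/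
def idealOutput {uLen zLen aLen lam : ℕ → ℕ}
    (I : ∀ κ, IdealAlice (uLen κ) (zLen κ) (aLen κ) (lam κ)) (S : Sampler uLen zLen) (κ : ℕ) :
    State (OutWires (uLen κ) (zLen κ) (aLen κ) (lam κ)) :=
  ((2 : ℂ) ^ lam κ)⁻¹ • ∑ h : Bits (lam κ), ∑ z : Bits (zLen κ),
    ∑ e : Fin (lam κ) ⊕ Fin (I κ).anc → Bool,
      adjoin
        (condition
          (applyAll (I κ).gates (adjoin (S.init κ (aLen κ) z) (Sum.elim h fun _ => false))) e)
        (Sum.elim z (encOpt (if e (I κ).decision then some h else none)))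

/-! ### Security notions for coin-flipping -/

/-- Enforceability against dishonest Alice: the protocol implements the ideal coin-flip
functionality against her. -/
def Protocol.EnforceableAgainstAlice {lam : ℕ → ℕ} (π : Protocol lam) : Prop :=
  π.Efficient ∧ π.Unbiased ∧
  ∀ A : AliceAdversary π.rounds, A.Poly →
    ∃ I : ∀ κ, IdealAlice (A.uLen κ) (A.zLen κ) (A.anc κ) (lam κ),
      PolyBounded (fun κ => (I κ).anc + (I κ).gates.length) ∧
      ∀ S : Sampler A.uLen A.zLen, S.Poly →
        QIndist (fun κ => realOutput π A S κ) (fun κ => idealOutput I S κ)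

/-- The probability that the outcome of a run with dishonest Bob, i.e. the output of honest Alice,
is `y`. -/
def outcomeProb {lam : ℕ → ℕ} (π : Protocol lam) (B : BobAdversary π.rounds)
    (S : Sampler B.uLen B.zLen) (κ : ℕ) (y : Option (Bits (lam κ))) : ℝ :=
  ((2 : ℝ) ^ π.coinsA κ)⁻¹ * ∑ t : Bits (π.coinsA κ), ∑ z : Bits (B.zLen κ),
    (QBob.run (π.rounds κ) (B.strat κ) (π.alice κ t) (S.init κ (B.anc κ) z) y).trace.re

/-- Uncontrollability against dishonest Bob. -/
def Protocol.UncontrollableAgainstBob {lam : ℕ → ℕ} (π : Protocol lam) : Prop :=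
  π.Efficient ∧ π.Unbiased ∧
  ∀ (B : BobAdversary π.rounds) (S : Sampler B.uLen B.zLen), B.Poly → S.Poly →
    ∀ Q : ∀ κ, Finset (Bits (lam κ)), NegligibleSubset Q →
      Negligible fun κ => ∑ x ∈ Q κ, outcomeProb π B S κ (some x)

/-- An event in (an extension of) the probability space on which an outcome with distribution `p`
is defined, given by the joint distribution of the outcome and the indicator of the event. -/
structure Event {α : Type} (p : α → ℝ) where
  joint : α → Bool → ℝ
  nonneg : ∀ y e, 0 ≤ joint y e
  marginal : ∀ y, joint y true + joint y false = p y

/-- Probability of the event. -/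
def Event.prob {α : Type} [Fintype α] {p : α → ℝ} (E : Event p) : ℝ := ∑ y, E.joint y true

/-- Probability of the complement. -/
def Event.probCompl {α : Type} [Fintype α] {p : α → ℝ} (E : Event p) : ℝ := ∑ y, E.joint y false

/-- Randomness against dishonest Bob: there is an event `E` of negligible probability such that
`P[c = x | not E] ≤ 2^(-lam)` for all strings `x`. -/
def Protocol.RandomAgainstBob {lam : ℕ → ℕ} (π : Protocol lam) : Prop :=
  π.Efficient ∧ π.Unbiased ∧
  ∀ (B : BobAdversary π.rounds) (S : Sampler B.uLen B.zLen), B.Poly → S.Poly →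
    ∃ E : ∀ κ, Event (outcomeProb π B S κ), Negligible (fun κ => (E κ).prob) ∧
      ∀ κ (x : Bits (lam κ)),
        (E κ).joint (some x) false ≤ ((2 : ℝ) ^ lam κ)⁻¹ * (E κ).probCompl

/-- Randomness against dishonest Bob up to a negligible error: there is an event `E` of negligible
probability such that `P[c = x and not E] ≤ 2^(-lam)` for all strings `x`. -/
def Protocol.StatisticallyRandomAgainstBob {lam : ℕ → ℕ} (π : Protocol lam) : Prop :=
  π.Efficient ∧ π.Unbiased ∧
  ∀ (B : BobAdversary π.rounds) (S : Sampler B.uLen B.zLen), B.Poly → S.Poly →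
    ∃ E : ∀ κ, Event (outcomeProb π B S κ), Negligible (fun κ => (E κ).prob) ∧
      ∀ κ (x : Bits (lam κ)), (E κ).joint (some x) false ≤ ((2 : ℝ) ^ lam κ)⁻¹

/-! ### The amplified protocol -/

section Amplify

variable {ℓ : ℕ → ℕ} (C : CommitmentScheme ℓ) (κ : ℕ)

/-- Formats of the two rounds after the key generation: a commitment, answered by a string or the
message `⊥`; an opening, with empty answer. -/
abbrev commitRounds : List (ℕ × ℕ) :=
  [(C.comLen κ, ℓ κ + 1), (ℓ κ + C.rLen κ, 0)]

/-- Alice after the key generation with output `pk`, with random string `a` and randomizer `r`: she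
sends the commitment to `a`, receives `b`, opens the commitment, and outputs `a ⊕ b`. After a failure
she sends zeros and outputs `⊥`. -/
def commitAlice (pk : Option (Bits κ)) (a : Bits (ℓ κ)) (r : Bits (C.rLen κ)) :
    AliceStrat (Option (Bits (ℓ κ))) (commitRounds C κ) :=
  match pk with
  | none => (fun _ => false, fun _ => (fun _ => false, fun _ => none))
  | some k =>
      (C.commit κ k a r, fun v =>
        match decOpt v with
        | none => (fun _ => false, fun _ => none)
        | some b => (Fin.append a r, fun _ => some (bxor a b)))

/-- Bob after the key generation with output `pk`, with random string `b`: he receives the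
commitment, sends `b`, receives and checks the opening, and outputs `a ⊕ b`, or `⊥` if the check
fails. If `pk` is `⊥` he sends `⊥` and outputs `⊥`. -/
def commitBob (pk : Option (Bits κ)) (b : Bits (ℓ κ)) :
    BobStrat (Option (Bits (ℓ κ))) (commitRounds C κ) :=
  fun A => (encOpt (pk.map fun _ => b), fun op => (Fin.elim0,
    match pk with
    | none => none
    | some k => if C.commit κ k (left op) (right op) = A then some (bxor (left op) b) else none))

end Amplify

/-- The protocol that flips a key with `π`, and then commits to `a`, sends `b`, and opens. -/
def forceRandom {ℓ : ℕ → ℕ} (C : CommitmentScheme ℓ) (π : Protocol fun κ => κ) : Protocol ℓ where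
  rounds κ := π.rounds κ ++ commitRounds C κ
  coinsA κ := π.coinsA κ + (ℓ κ + C.rLen κ)
  coinsB κ := π.coinsB κ + ℓ κ
  alice κ t := AliceStrat.bind (π.rounds κ) (π.alice κ (left t)) fun pk =>
    commitAlice C κ pk (left (right t)) (right (right t))
  bob κ t := BobStrat.bind (π.rounds κ) (π.bob κ (left t)) fun pk =>
    commitBob C κ pk (right t)

end CoinFlip

end

open CoinFlip

/-!
The theorem combines a simulation argument for Alice with a counting argument for Bob.

**Enforceability against Alice.** The part of a dishonest Alice that takes part in `π` has an
ideal-world adversary `k`, which is given the key. The simulator for the whole protocol generates a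
binding key itself, runs `k` on it, extracts the message `a` from the commitment of Alice, and
answers `b = h ⊕ a`, where `h` is the string of the functionality. If Alice can open her commitment
at all, she can open it to `a` only, so that Bob's output is `h` or `⊥` (`commitBob_extract`). Since
`h` is uniform, so is `b`, and the simulation of the commitment phase is perfect
(`sum_adjoin_simulator`). It remains to compare the distributions of the key: from the real run of
`π` to the ideal one, whose key is uniform, by the enforceability of `π`; to a hiding key, by
statistical closeness; and to a binding key, by computational indistinguishability. Both
computational steps require reductions. A distinguisher for the whole protocol gives one for `π`
which runs the commitment phase itself (`commitPhase`), and one for keys which moreover prepares the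
input of the adversary and runs `k` (`exists_key_distinguisher`).

**Efficiency of the reductions.** Quantum algorithms with classical input and output are treated as
`Kernel`s, that is, as families of linear maps on states, and `Implements s k` says that `k` is
realized by a circuit of size at most `s`. Kernels can be composed with a bound on the size
(`Implements.bind`), and the elementary steps, such as gates, measurements, messages, random bits
and classical computations, are kernels of small circuits. This relies on locality
(`block_applyAll`): a circuit on a part of the wires acts on the blocks of the state that belong to
fixed values of the other wires. Samplers, ideal-world adversaries and distinguishers are translated
into kernels and back (`Sampler.exists_kernel`, `Implements.exists_idealAlice`,
`Implements.exists_distinguisher`).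

**Randomness against Bob.** Fix the key. If the commitment were independent of the message `a`, then
so would be the answer `b`, and `a ⊕ b` would take each value with probability at most `2^(-ℓ)`. In
general, the excess for the outcome `x` is at most `hidingDefect`, and the sum of these excesses
over all `x` is at most twice the average statistical distance `hidingDistance` between commitments
to random messages and commitments to zero (`commitOutcome_le`, `sum_hidingDefect_le`). By Markov's
inequality, `hidingDistance` is negligible for all but a negligible fraction of the keys
(`CommitmentScheme.IsMixed.exists_hidingDistance_le`), and the uncontrollability of `π` means that
the exceptional keys occur with negligible probability only. The event for statistical randomness is
the excess of the distribution of the outcome over `2^(-ℓ)`. The event for randomness is that the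
key is not perfectly hiding; it is determined by the key, and the defects vanish outside of it, so
that the bound also holds conditionally.

**Honest players.** An unbiased `π` makes honest players agree on a key with certainty
(`Protocol.Unbiased.exists_honestRun_eq`), and then `a ⊕ b` is uniform and the check succeeds.
-/

open scoped ComplexOrder

set_option linter.unusedSectionVars false

noncomputable section

namespace CoinFlip

/-! ### Relabelling wires -/

section Relabel

variable {V W : Type}

/-- The same classical gate on other wires. -/
def CGate.map (j : V ↪ W) : CGate V → CGate W
  | .not i => .not (j i)
  | .cnot i k h => .cnot (j i) (j k) (j.injective.ne h)
  | .toffoli i k l h h' h'' =>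
      .toffoli (j i) (j k) (j l) (j.injective.ne h) (j.injective.ne h') (j.injective.ne h'')

/-- The same quantum gate on other wires. -/
def QGate.map (j : V ↪ W) : QGate V → QGate W
  | .classical g => .classical (g.map j)
  | .hadamard i => .hadamard (j i)
  | .tgate i => .tgate (j i)
  | .measure i => .measure (j i)
  | .reset i => .reset (j i)

theorem extend_comp_emb (j : V ↪ W) (a : V → Bool) (c : W → Bool) :
    Function.extend j a c ∘ j = a :=
  Function.extend_comp j.injective a c

@[simp]
theorem extend_emb_apply (j : V ↪ W) (a : V → Bool) (c : W → Bool) (v : V) :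
    Function.extend j a c (j v) = a v :=
  j.injective.extend_apply a c v

theorem extend_off (j : V ↪ W) (a : V → Bool) (c : W → Bool) {w : W}
    (h : w ∉ Set.range j) : Function.extend j a c w = c w :=
  Function.extend_apply' a c w h

/-- An assignment is determined by its restriction to the range of `j` and to the complement. -/
theorem eq_extend_iff (j : V ↪ W) (x : W → Bool) (a : V → Bool) (c : W → Bool) :
    x = Function.extend j a c ↔ x ∘ j = a ∧ ∀ w, w ∉ Set.range j → x w = c w := by
  constructor
  · rintro rfl
    exact ⟨extend_comp_emb j a c, fun w h => extend_off j a c h⟩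
  · rintro ⟨rfl, h⟩
    funext w
    by_cases hw : w ∈ Set.range j
    · obtain ⟨v, rfl⟩ := hw
      simp
    · rw [h w hw, extend_off j _ _ hw]

theorem extend_comp_self (j : V ↪ W) (x : W → Bool) : Function.extend j (x ∘ j) x = x :=
  ((eq_extend_iff j x (x ∘ j) x).2 ⟨rfl, fun _ _ => rfl⟩).symm

/-- Equality in the form in which `IsLift` and the gate matrices compare assignments. -/
theorem agree_iff_comp (j : V ↪ W) (x y : W → Bool) :
    x = y ↔ (∀ w, w ∉ Set.range j → x w = y w) ∧ x ∘ j = y ∘ j := by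
  constructor
  · rintro rfl; simp
  · rintro ⟨h, h'⟩
    rw [← extend_comp_self j y]
    exact (eq_extend_iff j x _ _).2 ⟨h', h⟩

theorem update_extend [DecidableEq V] [DecidableEq W] (j : V ↪ W) (a : V → Bool) (c : W → Bool)
    (i : V) (b : Bool) :
    Function.update (Function.extend j a c) (j i) b
      = Function.extend j (Function.update a i b) c := by
  rw [eq_extend_iff]
  constructor
  · funext v
    by_cases h : v = i
    · subst h; simp
    · simp [Function.update_of_ne h, Function.update_of_ne (j.injective.ne h)]
  · intro w hw
    rw [Function.update_of_ne, extend_off j a c hw]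
    rintro rfl
    exact hw ⟨i, rfl⟩

theorem CGate.act_map [DecidableEq V] [DecidableEq W] (j : V ↪ W) (g : CGate V) (a : V → Bool)
    (c : W → Bool) :
    (g.map j).act (Function.extend j a c) = Function.extend j (g.act a) c := by
  cases g <;> simp [CGate.map, CGate.act, update_extend]

theorem runClassical_map [DecidableEq V] [DecidableEq W] (j : V ↪ W) (gs : List (CGate V))
    (a : V → Bool) (c : W → Bool) :
    runClassical (gs.map (CGate.map j)) (Function.extend j a c)
      = Function.extend j (runClassical gs a) c := by
  induction gs generalizing a with
  | nil => rfl
  | cons g gs ih =>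
    change runClassical (gs.map (CGate.map j)) ((g.map j).act _) = _
    rw [CGate.act_map, ih]
    rfl

theorem CGate.act_act [DecidableEq W] (g : CGate W) (x : W → Bool) : g.act (g.act x) = x := by
  cases g with
  | not i => simp [CGate.act]
  | cnot i k h => simp [CGate.act, Function.update_of_ne h]
  | toffoli i k l h h' h'' =>
    simp [CGate.act, Function.update_of_ne h', Function.update_of_ne h'']

theorem CGate.act_injective [DecidableEq W] (g : CGate W) : Function.Injective g.act :=
  Function.LeftInverse.injective g.act_act

theorem runClassical_append [DecidableEq W] (gs hs : List (CGate W)) (x : W → Bool) :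
    runClassical (gs ++ hs) x = runClassical hs (runClassical gs x) := by
  simp [runClassical]

end Relabel

/-! ### Gates as linear maps -/

section Gates

variable {V W : Type} [Fintype V] [DecidableEq V] [Fintype W] [DecidableEq W]

/-- Kraus operators of a gate. -/
def QGate.kraus : QGate W → Bool → State W
  | .classical g, b => if b then 0 else basisMap g.act
  | .hadamard i, b => if b then 0 else hadamardMatrix i
  | .tgate i, b => if b then 0 else tMatrix i
  | .measure i, b => Matrix.diagonal fun x => if x i = b then 1 else 0
  | .reset i, b =>
      Matrix.of fun x y => if y i = b ∧ x = Function.update y i false then 1 else 0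

theorem QGate.apply_eq_kraus (g : QGate W) (ρ : State W) :
    g.apply ρ = ∑ b : Bool, conj (g.kraus b) ρ := by
  cases g <;> simp [QGate.apply, QGate.kraus, conj]

/-- `ρ ↦ K ρ K†` as a linear map. -/
def conjHom (K : State W) : State W →ₗ[ℂ] State W where
  toFun := conj K
  map_add' ρ σ := by simp [conj, mul_add, add_mul]
  map_smul' c ρ := by simp [conj]

/-- The action of a circuit as a linear map. -/
def applyHom (gs : List (QGate W)) : State W →ₗ[ℂ] State W :=
  gs.foldl (fun L g => (∑ b : Bool, conjHom (g.kraus b)) ∘ₗ L) LinearMap.id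

theorem applyHom_apply (gs : List (QGate W)) (ρ : State W) : applyHom gs ρ = applyAll gs ρ := by
  have key : ∀ (gs : List (QGate W)) (L : State W →ₗ[ℂ] State W),
      gs.foldl (fun L g => (∑ b : Bool, conjHom (g.kraus b)) ∘ₗ L) L ρ = applyAll gs (L ρ) := by
    intro gs
    induction gs with
    | nil => intro L; rfl
    | cons g gs ih =>
      intro L
      rw [List.foldl_cons, ih]
      rw [applyAll, applyAll, List.foldl_cons]
      simp only [QGate.apply_eq_kraus, LinearMap.comp_apply, LinearMap.sum_apply]
      rfl
  exact key gs LinearMap.id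

theorem applyAll_append (gs hs : List (QGate W)) (ρ : State W) :
    applyAll (gs ++ hs) ρ = applyAll hs (applyAll gs ρ) := by
  simp [applyAll]

theorem applyAll_cons (g : QGate W) (gs : List (QGate W)) (ρ : State W) :
    applyAll (g :: gs) ρ = applyAll gs (g.apply ρ) := rfl

theorem applyAll_zero (gs : List (QGate W)) : applyAll gs (0 : State W) = 0 := by
  simp only [← applyHom_apply, map_zero]

theorem conj_apply (K ρ : State W) (x y : W → Bool) :
    conj K ρ x y = ∑ b, ∑ a, K x a * ρ a b * star (K y b) := by
  simp [conj, Matrix.mul_apply, Finset.sum_mul]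

/-! ### Circuits on a part of the wires -/

/-- The state of the wires in the range of `j`, when the row and the column index take fixed values
elsewhere. -/
def block (j : V ↪ W) (c d : W → Bool) (ρ : State W) : State V :=
  Matrix.of fun a b => ρ (Function.extend j a c) (Function.extend j b d)

/-- `K'` acts as `K` on the range of `j` and as the identity elsewhere. -/
def IsLift (j : V ↪ W) (K' : State W) (K : State V) : Prop :=
  ∀ x y, K' x y = if ∀ w, w ∉ Set.range j → x w = y w then K (x ∘ j) (y ∘ j) else 0

open Classical in
/-- A sum over the assignments that agree with a fixed one outside the range of `j`. -/
theorem sum_agree {M : Type*} [AddCommMonoid M] (j : V ↪ W) (a : V → Bool) (c : W → Bool)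
    (f : (W → Bool) → M) :
    (∑ y, if ∀ w, w ∉ Set.range j → Function.extend j a c w = y w then f y else 0)
      = ∑ b, f (Function.extend j b c) := by
  rw [← Finset.sum_filter]
  refine Finset.sum_nbij' (fun y => y ∘ j) (fun b => Function.extend j b c) ?_ ?_ ?_ ?_ ?_
  · simp
  · intro b _
    simp only [Finset.mem_filter, Finset.mem_univ, true_and]
    intro w hw
    rw [extend_off j _ _ hw, extend_off j _ _ hw]
  · intro y hy
    simp only [Finset.mem_filter, Finset.mem_univ, true_and] at hy
    refine ((eq_extend_iff j y _ c).2 ⟨rfl, fun w hw => ?_⟩).symm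
    rw [← hy w hw, extend_off j _ _ hw]
  · intro b _
    exact extend_comp_emb j b c
  · intro y hy
    simp only [Finset.mem_filter, Finset.mem_univ, true_and] at hy
    congr 1
    refine (eq_extend_iff j y _ c).2 ⟨rfl, fun w hw => ?_⟩
    rw [← hy w hw, extend_off j _ _ hw]

theorem block_conj {j : V ↪ W} {K' : State W} {K : State V} (h : IsLift j K' K)
    (c d : W → Bool) (ρ : State W) :
    block j c d (conj K' ρ) = conj K (block j c d ρ) := by
  classical
  ext a b
  simp only [block, Matrix.of_apply, conj_apply]
  have h1 : ∀ (a : V → Bool) (c x : W → Bool), K' (Function.extend j a c) x =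
      if ∀ w, w ∉ Set.range j → Function.extend j a c w = x w then K a (x ∘ j) else 0 := by
    intro a c x
    rw [h, extend_comp_emb]
  simp only [h1]
  have h2 : ∀ (p q : Prop) [Decidable p] [Decidable q] (u v w : ℂ),
      (if p then u else 0) * v * star (if q then w else 0)
        = if q then (if p then u * v * star w else 0) else 0 := by
    intro p q _ _ u v w
    split_ifs <;> simp
  simp only [h2]
  have h3 : ∀ (q : Prop) [Decidable q] (f : (W → Bool) → ℂ),
      (∑ x, if q then f x else 0) = if q then ∑ x, f x else 0 := by
    intro q _ f
    split_ifs <;> simp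
  simp only [h3, sum_agree, extend_comp_emb]

theorem isLift_kraus (j : V ↪ W) (g : QGate V) (b : Bool) :
    IsLift j ((g.map j).kraus b) (g.kraus b) := by
  classical
  intro x y
  cases g with
  | classical g =>
    cases b with
    | true => simp [QGate.map, QGate.kraus]
    | false =>
      have hy : (g.map j).act y = Function.extend j (g.act (y ∘ j)) y := by
        conv_lhs => rw [← extend_comp_self j y]
        rw [CGate.act_map]
      simp only [QGate.map, QGate.kraus, basisMap, Bool.false_eq_true, if_false, Matrix.of_apply]
      rw [hy, if_congr (eq_extend_iff _ _ _ _) rfl rfl]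
      rw [← ite_and]
      simp only [and_comm]
  | hadamard i =>
    cases b with
    | true => simp [QGate.map, QGate.kraus]
    | false =>
      simp only [QGate.map, QGate.kraus, hadamardMatrix, Bool.false_eq_true, if_false,
        Matrix.of_apply]
      rw [← ite_and]
      refine if_congr ⟨fun h => ⟨fun w hw => h w ?_, fun v hv => h _ (j.injective.ne hv)⟩,
        fun h w hw => ?_⟩ rfl rfl
      · rintro rfl; exact hw ⟨i, rfl⟩
      · by_cases hr : w ∈ Set.range j
        · obtain ⟨v, rfl⟩ := hr
          exact h.2 v (fun e => hw (e ▸ rfl))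
        · exact h.1 w hr
  | tgate i =>
    cases b with
    | true => simp [QGate.map, QGate.kraus]
    | false =>
      simp only [QGate.map, QGate.kraus, tMatrix, Bool.false_eq_true, if_false,
        Matrix.diagonal_apply]
      rw [← ite_and]
      exact if_congr (agree_iff_comp j x y) rfl rfl
  | measure i =>
    simp only [QGate.map, QGate.kraus, Matrix.diagonal_apply]
    rw [if_congr (agree_iff_comp j x y) rfl rfl, ite_and]
    rfl
  | reset i =>
    simp only [QGate.map, QGate.kraus, Matrix.of_apply]
    rw [← ite_and]
    have hy : Function.update y (j i) false
        = Function.extend j (Function.update (y ∘ j) i false) y := by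
      conv_lhs => rw [← extend_comp_self j y]
      rw [update_extend]
    refine if_congr ?_ rfl rfl
    rw [hy, eq_extend_iff]
    simp only [Function.comp_apply]
    tauto

/-- Locality: a circuit on the wires in the range of `j` does not see the other wires. -/
theorem block_applyAll (j : V ↪ W) (gs : List (QGate V)) (c d : W → Bool) (ρ : State W) :
    block j c d (applyAll (gs.map (QGate.map j)) ρ) = applyAll gs (block j c d ρ) := by
  induction gs generalizing ρ with
  | nil => rfl
  | cons g gs ih =>
    rw [List.map_cons, applyAll_cons, applyAll_cons, ih]
    congr 1
    rw [QGate.apply_eq_kraus, QGate.apply_eq_kraus]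
    have hs : ∀ f : Bool → State W, block j c d (∑ b, f b) = ∑ b, block j c d (f b) := by
      intro f
      ext a b
      simp [block, Matrix.sum_apply]
    rw [hs]
    exact Finset.sum_congr rfl fun b _ => block_conj (isLift_kraus j g b) c d ρ

/-! ### Gates preserve positivity and the trace -/

theorem conj_posSemidef (K : State W) {ρ : State W} (h : ρ.PosSemidef) : (conj K ρ).PosSemidef :=
  h.mul_mul_conjTranspose_same K

theorem sum_posSemidef {ι : Type*} (s : Finset ι) {f : ι → State W}
    (h : ∀ i ∈ s, (f i).PosSemidef) : (∑ i ∈ s, f i).PosSemidef :=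
  Matrix.posSemidef_sum s h

theorem applyAll_posSemidef (gs : List (QGate W)) {ρ : State W} (h : ρ.PosSemidef) :
    (applyAll gs ρ).PosSemidef := by
  induction gs generalizing ρ with
  | nil => exact h
  | cons g gs ih =>
    rw [applyAll_cons, QGate.apply_eq_kraus]
    exact ih (sum_posSemidef _ fun b _ => conj_posSemidef _ h)

theorem trace_sum_conj {ι : Type*} (s : Finset ι) (K : ι → State W)
    (h : ∑ i ∈ s, (K i)ᴴ * K i = 1) (ρ : State W) :
    (∑ i ∈ s, conj (K i) ρ).trace = ρ.trace := by
  have h1 : ∀ i, (conj (K i) ρ).trace = ((K i)ᴴ * K i * ρ).trace := by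
    intro i
    rw [conj, Matrix.trace_mul_comm, Matrix.mul_assoc]
  rw [Matrix.trace_sum, Finset.sum_congr rfl fun i _ => h1 i, ← Matrix.trace_sum,
    ← Finset.sum_mul, h, one_mul]

/-- The Kraus operators of a gate are trace preserving. -/
theorem kraus_complete (g : QGate W) : ∑ b : Bool, (g.kraus b)ᴴ * g.kraus b = 1 := by
  cases g with
  | classical g =>
    ext x y
    simp [QGate.kraus, basisMap, Matrix.mul_apply, Matrix.one_apply, g.act_injective.eq_iff,
      eq_comm]
  | hadamard i =>
    classical
    ext x y
    let j : Unit ↪ W := ⟨fun _ => i, fun _ _ _ => rfl⟩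
    have hj : ∀ w, w ∉ Set.range j ↔ w ≠ i := by
      intro w
      simp only [Set.mem_range, not_exists]
      exact ⟨fun h e => h () e.symm, fun h _ e => h e.symm⟩
    have hx := extend_comp_self j x
    simp only [QGate.kraus, Fintype.sum_bool, if_true, Bool.false_eq_true, if_false, mul_zero,
      zero_add, Matrix.mul_apply, Matrix.conjTranspose_apply, hadamardMatrix, Matrix.of_apply]
    have h1 : ∀ z : W → Bool,
        star (if ∀ k, k ≠ i → z k = x k then
            (if z i && x i then -1 else 1) * ((Real.sqrt 2 : ℝ) : ℂ)⁻¹ else 0)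
          * (if ∀ k, k ≠ i → z k = y k then
            (if z i && y i then -1 else 1) * ((Real.sqrt 2 : ℝ) : ℂ)⁻¹ else 0)
        = if ∀ w, w ∉ Set.range j → Function.extend j (x ∘ j) x w = z w then
            (if ∀ k, k ≠ i → x k = y k then
              (if z i && x i then -1 else 1) * (if z i && y i then -1 else 1) * (1 / 2 : ℂ) else 0)
          else 0 := by
      intro z
      have h2 : ((Real.sqrt 2 : ℝ) : ℂ)⁻¹ * ((Real.sqrt 2 : ℝ) : ℂ)⁻¹ = 1 / 2 := by
        rw [← mul_inv, ← Complex.ofReal_mul, Real.mul_self_sqrt (by norm_num)]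
        norm_num
      simp only [hj, hx]
      by_cases hz : ∀ k, k ≠ i → z k = x k
      · have hz' : ∀ k, k ≠ i → x k = z k := fun k hk => (hz k hk).symm
        rw [if_pos hz, if_pos hz']
        have he : (∀ k, k ≠ i → z k = y k) ↔ ∀ k, k ≠ i → x k = y k :=
          forall₂_congr fun k hk => by rw [hz k hk]
        rw [if_congr he rfl rfl]
        split_ifs <;> simp [h2]
      · have hz' : ¬ ∀ k, k ≠ i → x k = z k := fun h => hz fun k hk => (h k hk).symm
        rw [if_neg hz, if_neg hz']
        simp
    rw [Finset.sum_congr rfl fun z _ => h1 z, sum_agree]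
    have h3 : ∀ f : (Unit → Bool) → ℂ, ∑ b, f b = f (fun _ => true) + f (fun _ => false) := by
      intro f
      rw [← (Equiv.funUnique Unit Bool).symm.sum_comp, Fintype.sum_bool]
      rfl
    have h4 : ∀ b : Bool, Function.extend j (fun _ => b) x i = b :=
      fun b => extend_emb_apply j (fun _ => b) x ()
    rw [h3, h4, h4, Matrix.one_apply]
    by_cases hxy : ∀ k, k ≠ i → x k = y k
    · have he : x = y ↔ x i = y i := by
        refine ⟨fun h => by rw [h], fun h => funext fun k => ?_⟩
        by_cases hk : k = i
        · rw [hk, h]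
        · exact hxy k hk
      rw [if_pos hxy, if_pos hxy, if_congr he rfl rfl]
      cases x i <;> cases y i <;> norm_num
    · have : x ≠ y := fun h => hxy fun k _ => by rw [h]
      simp [hxy, this]
  | tgate i =>
    simp only [QGate.kraus, Fintype.sum_bool]
    simp only [tMatrix, Matrix.diagonal_conjTranspose, Matrix.diagonal_mul_diagonal,
      if_true, Bool.false_eq_true, if_false, mul_zero, zero_add]
    rw [← Matrix.diagonal_one]
    congr 1
    funext x
    simp only [Pi.star_apply]
    split_ifs
    · simp only [RCLike.star_def, ← Complex.exp_conj, ← Complex.exp_add]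
      have : (starRingEnd ℂ) 4 = 4 := Complex.conj_ofNat 4
      simp [this, neg_div]
    · simp
  | measure i =>
    simp only [QGate.kraus, Matrix.diagonal_conjTranspose, Matrix.diagonal_mul_diagonal,
      Fintype.sum_bool, Matrix.diagonal_add]
    rw [← Matrix.diagonal_one]
    congr 1
    funext x
    cases hx : x i <;> simp [hx]
  | reset i =>
    ext x y
    have h1 : ∀ (b : Bool) (z : W → Bool),
        star (if x i = b ∧ z = Function.update x i false then (1 : ℂ) else 0)
          * (if y i = b ∧ z = Function.update y i false then 1 else 0)
        = if z = Function.update x i false then (if b = x i ∧ x = y then 1 else 0) else 0 := by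
      intro b z
      have he : x = y ↔ x i = y i ∧ Function.update x i false = Function.update y i false := by
        refine ⟨by rintro rfl; simp, fun ⟨h, h'⟩ => funext fun k => ?_⟩
        by_cases hk : k = i
        · rw [hk, h]
        · simpa [hk] using congrFun h' k
      have hm : ∀ (p q : Prop) [Decidable p] [Decidable q],
          star (if p then (1 : ℂ) else 0) * (if q then 1 else 0) = if p ∧ q then 1 else 0 := by
        intro p q _ _
        by_cases p <;> by_cases q <;> simp [*]
      rw [hm, ← ite_and]
      refine if_congr ?_ rfl rfl
      rw [he]
      constructor
      · rintro ⟨⟨h, h'⟩, h'', h'''⟩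
        exact ⟨h', h.symm, h.trans h''.symm, h'.symm.trans h'''⟩
      · rintro ⟨h, h', h'', h'''⟩
        exact ⟨⟨h'.symm, h⟩, h''.symm.trans h'.symm, h.trans h'''⟩
    simp only [QGate.kraus, Matrix.sum_apply, Matrix.mul_apply, Matrix.conjTranspose_apply,
      Matrix.of_apply, h1, Finset.sum_ite_eq', Finset.mem_univ, if_true,
      Matrix.one_apply]
    simp only [ite_and, Finset.sum_ite_eq', Finset.mem_univ, if_true]

theorem applyAll_trace (gs : List (QGate W)) (ρ : State W) :
    (applyAll gs ρ).trace = ρ.trace := by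
  induction gs generalizing ρ with
  | nil => rfl
  | cons g gs ih =>
    rw [applyAll_cons, ih, QGate.apply_eq_kraus, trace_sum_conj _ _ (kraus_complete g)]

end Gates

/-! ### Copying wires -/

section Copy

variable {P V W : Type} [Fintype P] [DecidableEq P] [Fintype W] [DecidableEq W]

/-- Controlled-not gates from the wires `a` to the wires `b`. -/
def copyGates (a : P → W) (b : P ↪ W) (h : ∀ p q, a p ≠ b q) : List (CGate W) :=
  Finset.univ.toList.map fun p => .cnot (a p) (b p) (h p p)

theorem copyGates_length (a : P → W) (b : P ↪ W) (h : ∀ p q, a p ≠ b q) :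
    (copyGates a b h).length = Fintype.card P := by
  simp [copyGates]

/-- The effect of `copyGates` on bit assignments. -/
def copyFun (a : P → W) (b : P ↪ W) (x : W → Bool) : W → Bool :=
  Function.extend b (fun p => xor (x (b p)) (x (a p))) x

theorem copyFun_target (a : P → W) (b : P ↪ W) (x : W → Bool) (p : P) :
    copyFun a b x (b p) = xor (x (b p)) (x (a p)) :=
  extend_emb_apply b _ x p

theorem copyFun_other (a : P → W) (b : P ↪ W) (x : W → Bool) {w : W} (h : ∀ p, w ≠ b p) :
    copyFun a b x w = x w :=
  extend_off b _ x fun ⟨p, e⟩ => h p e.symm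

theorem runClassical_cnots (a : P → W) (b : P ↪ W) (h : ∀ p q, a p ≠ b q) (l : List P)
    (hl : l.Nodup) (x : W → Bool) :
    (∀ p, runClassical (l.map fun p => .cnot (a p) (b p) (h p p)) x (b p)
        = if p ∈ l then xor (x (b p)) (x (a p)) else x (b p)) ∧
    ∀ w, (∀ p, w ≠ b p) →
      runClassical (l.map fun p => .cnot (a p) (b p) (h p p)) x w = x w := by
  induction l generalizing x with
  | nil => simp [runClassical]
  | cons q l ih =>
    obtain ⟨hq, hl⟩ := List.nodup_cons.1 hl
    obtain ⟨h1, h2⟩ := ih hl ((CGate.cnot (a q) (b q) (h q q)).act x)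
    have e : runClassical ((q :: l).map fun p => .cnot (a p) (b p) (h p p)) x
        = runClassical (l.map fun p => .cnot (a p) (b p) (h p p))
          ((CGate.cnot (a q) (b q) (h q q)).act x) := rfl
    rw [e]
    constructor
    · intro p
      rw [h1]
      simp only [CGate.act, Function.update_of_ne (h p q)]
      by_cases hp : p = q
      · subst hp
        simp [hq]
      · simp [hp]
    · intro w hw
      rw [h2 w hw]
      simp [CGate.act, Function.update_of_ne (hw q)]

theorem runClassical_copyGates (a : P → W) (b : P ↪ W) (h : ∀ p q, a p ≠ b q) (x : W → Bool) :
    runClassical (copyGates a b h) x = copyFun a b x := by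
  obtain ⟨h1, h2⟩ := runClassical_cnots a b h _ (Finset.nodup_toList Finset.univ) x
  refine (eq_extend_iff b _ _ _).2 ⟨funext fun p => ?_, fun w hw => h2 w fun p e => hw ⟨p, e.symm⟩⟩
  refine (h1 p).trans ?_
  simp

theorem copyFun_copyFun (a : P → W) (b : P ↪ W) (h : ∀ p q, a p ≠ b q) (x : W → Bool) :
    copyFun a b (copyFun a b x) = x := by
  symm
  refine (eq_extend_iff b _ _ _).2 ⟨funext fun p => ?_, fun w hw => ?_⟩
  · simp only [Function.comp_apply]
    rw [copyFun_target, copyFun_other a b x (h p)]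
    simp
  · rw [copyFun_other a b x fun p e => hw ⟨p, e.symm⟩]

theorem applyAll_classical_apply (gs : List (CGate W)) (ρ : State W) (x y : W → Bool) :
    applyAll (gs.map .classical) ρ (runClassical gs x) (runClassical gs y) = ρ x y := by
  induction gs generalizing ρ x y with
  | nil => rfl
  | cons g gs ih =>
    have e : ∀ x, runClassical (g :: gs) x = runClassical gs (g.act x) := fun _ => rfl
    rw [List.map_cons, applyAll_cons, e, e, ih]
    simp [QGate.apply, conj_apply, basisMap, g.act_injective.eq_iff]

/-- Copying permutes the computational basis by an involution, so that it permutes the entries of a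
state. -/
theorem applyAll_copyGates (a : P → W) (b : P ↪ W) (h : ∀ p q, a p ≠ b q) (ρ : State W)
    (x y : W → Bool) :
    applyAll ((copyGates a b h).map .classical) ρ x y = ρ (copyFun a b x) (copyFun a b y) := by
  have := applyAll_classical_apply (copyGates a b h) ρ (copyFun a b x) (copyFun a b y)
  rwa [runClassical_copyGates, runClassical_copyGates, copyFun_copyFun a b h,
    copyFun_copyFun a b h] at this

end Copy

/-! ### Circuits with classical input and output -/

theorem sum_sumElim {A B M : Type*} [Fintype A] [DecidableEq A] [Fintype B] [DecidableEq B]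
    [AddCommMonoid M] (f : (A ⊕ B → Bool) → M) :
    ∑ w, f w = ∑ a, ∑ b, f (Sum.elim a b) := by
  rw [← (Equiv.sumArrowEquivProdArrow A B Bool).symm.sum_comp, Fintype.sum_prod_type]
  rfl

section Adjoin

variable {W E : Type} [Fintype W] [DecidableEq W] [Fintype E] [DecidableEq E]

theorem adjoin_elim (ρ : State W) (v : E → Bool) (a b : W → Bool) (c d : E → Bool) :
    adjoin ρ v (Sum.elim a c) (Sum.elim b d) = if c = v ∧ d = v then ρ a b else 0 := rfl

/-- `ρ ↦ ρ ⊗ |v⟩⟨v|` as a linear map. -/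
def adjoinHom (v : E → Bool) : State W →ₗ[ℂ] State (W ⊕ E) where
  toFun ρ := adjoin ρ v
  map_add' ρ σ := by ext x y; simp [adjoin]; split_ifs <;> simp
  map_smul' c ρ := by ext x y; simp [adjoin]

/-- `condition` as a linear map. -/
def conditionHom (v : E → Bool) : State (W ⊕ E) →ₗ[ℂ] State W where
  toFun ρ := condition ρ v
  map_add' _ _ := rfl
  map_smul' _ _ := rfl

theorem condition_adjoin (ρ : State W) (v w : E → Bool) :
    condition (adjoin ρ v) w = if w = v then ρ else 0 := by
  ext x y
  simp only [condition, Matrix.of_apply, adjoin_elim, and_self]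
  split_ifs <;> rfl

end Adjoin

/-- A linear map on states of the register `W` with classical input in `E` and classical output in
`E'`: `k v ρ v'` is the final state on input `v`, weighted with the probability of the output
`v'`. -/
abbrev Kernel (W E E' : Type) : Type := (E → Bool) → State W → (E' → Bool) → State W

/-- The circuit with input wires `inp`, output wires `out` and the gates `gs` implements `k`: the
classical input is written on work wires that are zero otherwise, and at the end all work wires are
measured. -/
def ImplementedBy {W E E' A : Type} [Fintype W] [DecidableEq W] [Fintype E'] [Fintype A]
    [DecidableEq A] (k : Kernel W E E') (inp : E ↪ A) (out : E' ↪ A)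
    (gs : List (QGate (W ⊕ A))) : Prop :=
  ∀ v ρ v', k v ρ v' = ∑ w : A → Bool, if w ∘ out = v' then
    condition (applyAll gs (adjoin ρ (Function.extend inp v fun _ => false))) w else 0

/-- `k` is implemented by a circuit of size at most `s`, where the size is the number of work wires
(input and output included) plus the number of gates. -/
def Implements {W E E' : Type} [Fintype W] [DecidableEq W] [Fintype E'] (s : ℕ)
    (k : Kernel W E E') : Prop :=
  ∃ (A : Type) (_ : Fintype A) (_ : DecidableEq A) (inp : E ↪ A) (out : E' ↪ A)
    (gs : List (QGate (W ⊕ A))), Fintype.card A + gs.length ≤ s ∧ ImplementedBy k inp out gs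

section Kernels

variable {W E E' E₁ E₂ E₃ : Type} [Fintype W] [DecidableEq W] [Fintype E] [DecidableEq E]
  [Fintype E'] [DecidableEq E'] [Fintype E₁] [DecidableEq E₁] [Fintype E₂] [DecidableEq E₂]
  [Fintype E₃] [DecidableEq E₃]

theorem Implements.card_input_le {s : ℕ} {k : Kernel W E E'} (h : Implements s k) :
    Fintype.card E ≤ s := by
  obtain ⟨A, _, _, inp, out, gs, hs, -⟩ := h
  have := Fintype.card_le_of_embedding inp
  omega

theorem Implements.mono {s t : ℕ} {k : Kernel W E E'} (h : Implements s k) (hst : s ≤ t) :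
    Implements t k := by
  obtain ⟨A, i1, i2, inp, out, gs, hs, h⟩ := h
  exact ⟨A, i1, i2, inp, out, gs, hs.trans hst, h⟩

/-- Implemented kernels are linear in the state. -/
theorem Implements.exists_linear {s : ℕ} {k : Kernel W E E'} (h : Implements s k)
    (v : E → Bool) (v' : E' → Bool) : ∃ L : State W →ₗ[ℂ] State W, ∀ ρ, k v ρ v' = L ρ := by
  obtain ⟨A, _, _, inp, out, gs, -, h⟩ := h
  refine ⟨∑ w : A → Bool, if w ∘ out = v' then conditionHom w ∘ₗ applyHom gs ∘ₗ
    adjoinHom (Function.extend inp v fun _ => false) else 0, fun ρ => ?_⟩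
  rw [h, LinearMap.sum_apply]
  refine Finset.sum_congr rfl fun w _ => ?_
  split_ifs
  · simp only [LinearMap.comp_apply, applyHom_apply]
    rfl
  · rfl

theorem Implements.map_zero {s : ℕ} {k : Kernel W E E'} (h : Implements s k)
    (v : E → Bool) (v' : E' → Bool) : k v 0 v' = 0 := by
  obtain ⟨L, hL⟩ := h.exists_linear v v'
  rw [hL, _root_.map_zero]

theorem Implements.map_smul {s : ℕ} {k : Kernel W E E'} (h : Implements s k)
    (v : E → Bool) (v' : E' → Bool) (c : ℂ) (ρ : State W) : k v (c • ρ) v' = c • k v ρ v' := by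
  obtain ⟨L, hL⟩ := h.exists_linear v v'
  rw [hL, hL, _root_.map_smul]

theorem Implements.map_sum {s : ℕ} {k : Kernel W E E'} (h : Implements s k)
    (v : E → Bool) (v' : E' → Bool) {ι : Type*} (t : Finset ι) (f : ι → State W) :
    k v (∑ i ∈ t, f i) v' = ∑ i ∈ t, k v (f i) v' := by
  obtain ⟨L, hL⟩ := h.exists_linear v v'
  simp only [hL, _root_.map_sum]

theorem condition_posSemidef {ρ : State (W ⊕ E)} (h : ρ.PosSemidef) (v : E → Bool) :
    (condition ρ v).PosSemidef :=
  h.submatrix fun x => Sum.elim x v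

theorem adjoin_eq_conj (ρ : State W) (v : E → Bool) :
    adjoin ρ v = (Matrix.of fun (x : W ⊕ E → Bool) (y : W → Bool) =>
      if x ∘ Sum.inr = v ∧ x ∘ Sum.inl = y then (1 : ℂ) else 0) * ρ *
      (Matrix.of fun (x : W ⊕ E → Bool) (y : W → Bool) =>
        if x ∘ Sum.inr = v ∧ x ∘ Sum.inl = y then (1 : ℂ) else 0)ᴴ := by
  ext x y
  simp only [Matrix.mul_apply, Matrix.conjTranspose_apply, Matrix.of_apply, adjoin, ite_and]
  split_ifs <;> simp

theorem adjoin_posSemidef {ρ : State W} (h : ρ.PosSemidef) (v : E → Bool) :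
    (adjoin ρ v).PosSemidef := by
  rw [adjoin_eq_conj]
  exact h.mul_mul_conjTranspose_same _

theorem trace_eq_sum_condition (ρ : State (W ⊕ E)) :
    ρ.trace = ∑ v, (condition ρ v).trace := by
  simp only [Matrix.trace, Matrix.diag_apply, condition, Matrix.of_apply]
  rw [sum_sumElim, Finset.sum_comm]

theorem adjoin_trace (ρ : State W) (v : E → Bool) : (adjoin ρ v).trace = ρ.trace := by
  rw [trace_eq_sum_condition]
  simp only [condition_adjoin]
  rw [Finset.sum_eq_single v]
  · simp
  · intro w _ h; simp [h]
  · simp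

theorem Implements.posSemidef {s : ℕ} {k : Kernel W E E'} (h : Implements s k) (v : E → Bool)
    {ρ : State W} (hρ : ρ.PosSemidef) (v' : E' → Bool) : (k v ρ v').PosSemidef := by
  obtain ⟨A, _, _, inp, out, gs, -, h⟩ := h
  rw [h]
  refine sum_posSemidef _ fun w _ => ?_
  split_ifs
  · exact condition_posSemidef (applyAll_posSemidef _ (adjoin_posSemidef hρ _)) _
  · exact Matrix.PosSemidef.zero

/-- The total probability is preserved. -/
theorem Implements.sum_trace {s : ℕ} {k : Kernel W E E'} (h : Implements s k) (v : E → Bool)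
    (ρ : State W) : ∑ v', (k v ρ v').trace = ρ.trace := by
  obtain ⟨A, _, _, inp, out, gs, -, h⟩ := h
  rw [← adjoin_trace ρ (Function.extend inp v fun _ => false), ← applyAll_trace gs,
    trace_eq_sum_condition]
  simp only [h _ ρ, Matrix.trace_sum]
  rw [Finset.sum_comm]
  refine Finset.sum_congr rfl fun w _ => ?_
  rw [Finset.sum_eq_single (w ∘ out)]
  · simp
  · intro u _ hu; simp [hu.symm]
  · simp

theorem applyAll_classical_adjoin {A : Type} [Fintype A] [DecidableEq A] (gs : List (CGate A))
    (ρ : State W) (v : A → Bool) :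
    applyAll ((gs.map (CGate.map .inr)).map .classical) (adjoin ρ v)
      = adjoin ρ (runClassical gs v) := by
  induction gs generalizing v with
  | nil => rfl
  | cons g gs ih =>
    rw [List.map_cons, List.map_cons, applyAll_cons]
    change _ = adjoin ρ (runClassical gs (g.act v))
    rw [← ih]
    congr 1
    ext x y
    have hact : ∀ z : W ⊕ A → Bool,
        (g.map .inr).act z = Sum.elim (z ∘ Sum.inl) (g.act (z ∘ Sum.inr)) := by
      intro z
      have h1 := CGate.act_map (.inr : A ↪ W ⊕ A) g (z ∘ Sum.inr) z
      have h3 : Function.extend (.inr : A ↪ W ⊕ A) (z ∘ Sum.inr) z = z := extend_comp_self _ z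
      rw [h3] at h1
      rw [h1]
      symm
      refine (eq_extend_iff _ _ _ _).2 ⟨rfl, ?_⟩
      rintro (k | k) hk
      · rfl
      · exact absurd ⟨k, rfl⟩ hk
    have h4 := applyAll_classical_apply [g.map .inr] (adjoin ρ v) ((g.map .inr).act x)
      ((g.map .inr).act y)
    have h5 : ∀ z : W ⊕ A → Bool, runClassical [g.map .inr] ((g.map .inr).act z) = z := fun z =>
      CGate.act_act _ z
    rw [h5, h5] at h4
    have h6 : applyAll (List.map QGate.classical [g.map .inr]) (adjoin ρ v) x y
      = (QGate.classical (g.map .inr)).apply (adjoin ρ v) x y := rfl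
    rw [← h6, h4, hact, hact, adjoin_elim]
    have h7 : ∀ z, g.act z = v ↔ z = g.act v := fun z =>
      ⟨fun h => by rw [← h, g.act_act], fun h => by rw [h, g.act_act]⟩
    simp only [adjoin, Matrix.of_apply, h7]

/-- Classical computations. -/
def pureKernel (f : (E → Bool) → (E' → Bool)) : Kernel W E E' :=
  fun v ρ v' => if v' = f v then ρ else 0

theorem implements_pure {s : ℕ} {f : (E → Bool) → (E' → Bool)} (hf : Computes s f) :
    Implements s (pureKernel f : Kernel W E E') := by
  obtain ⟨n, inp, out, gs, hs, h⟩ := hf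
  refine ⟨Fin n, inferInstance, inferInstance, inp, out,
    (gs.map (CGate.map .inr)).map .classical, by simpa using hs, fun v ρ v' => ?_⟩
  rw [applyAll_classical_adjoin]
  have ho : runClassical gs (Function.extend inp v fun _ => false) ∘ out = f v :=
    funext fun o => h v o
  simp only [condition_adjoin]
  rw [Finset.sum_eq_single (runClassical gs (Function.extend inp v fun _ => false))]
  · rw [ho, if_pos rfl, pureKernel]
    exact if_congr eq_comm rfl rfl
  · intro w _ hw; simp [hw]
  · simp

end Kernels

/-! ### Composition of implementations -/

section Bind

variable {W E E' E₁ E₂ E₃ : Type} [Fintype W] [DecidableEq W] [Fintype E] [DecidableEq E]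
  [Fintype E'] [DecidableEq E'] [Fintype E₁] [DecidableEq E₁] [Fintype E₂] [DecidableEq E₂]
  [Fintype E₃] [DecidableEq E₃]

theorem applyAll_ite_zero {p : Prop} [Decidable p] (gs : List (QGate W)) (ρ : State W) :
    applyAll gs (if p then ρ else 0) = if p then applyAll gs ρ else 0 := by
  split_ifs
  · rfl
  · exact applyAll_zero gs

theorem condition_ite_zero {p : Prop} [Decidable p] (ρ : State (W ⊕ E)) (v : E → Bool) :
    condition (if p then ρ else 0) v = if p then condition ρ v else 0 := by
  split_ifs <;> rfl

theorem extend_inl_sumMap {A B : Type} (f : A ↪ B) (c : W ⊕ B → Bool) (a : W → Bool)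
    (u : A → Bool) :
    Function.extend (Function.Embedding.sumMap (.refl W) f) (Sum.elim a u) c
      = Sum.elim a (Function.extend f u (c ∘ Sum.inr)) := by
  symm
  refine (eq_extend_iff _ _ _ _).2 ⟨?_, ?_⟩
  · funext k
    rcases k with k | k
    · rfl
    · exact extend_emb_apply f u _ k
  · rintro (k | k) hk
    · exact absurd ⟨Sum.inl k, rfl⟩ hk
    · exact extend_off f u _ fun ⟨p, e⟩ => hk ⟨Sum.inr p, by simp [e]⟩

/-- Conditioning on all work wires after a circuit that acts on part of them. -/
theorem condition_applyAll_map {A B : Type} [Fintype A] [DecidableEq A] [Fintype B]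
    [DecidableEq B] (f : A ↪ B) (gs : List (QGate (W ⊕ A))) (τ : State (W ⊕ B)) (z : B → Bool) :
    condition (applyAll (gs.map (QGate.map (Function.Embedding.sumMap (.refl W) f))) τ) z
      = condition (applyAll gs (block (Function.Embedding.sumMap (.refl W) f)
        (Sum.elim (fun _ => false) z) (Sum.elim (fun _ => false) z) τ)) (z ∘ f) := by
  rw [← block_applyAll]
  ext a b
  simp only [condition, block, Matrix.of_apply]
  rw [extend_inl_sumMap, extend_inl_sumMap]
  have h : Function.extend f (z ∘ f)
      ((Sum.elim (fun _ => false) z : W ⊕ B → Bool) ∘ Sum.inr) = z := extend_comp_self f z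
  rw [h]

/-- Run the circuit of `k`, and then the circuit of `G` on a selection of the classical input and
output of `k`. Copying these bits has the effect of measuring them: in the state that remains when
the other wires are discarded, only the entries that agree on them survive. The work wires are those
for the common input, for the circuit of `k`, and for the circuit of `G`. -/
theorem Implements.bind {s₁ s₂ : ℕ} {k : Kernel W E E₁} {G : Kernel W E₃ E₂}
    (hk : Implements s₁ k) (hG : Implements s₂ G) (sel : E₃ → E ⊕ E₁) :
    Implements (3 * (s₁ + s₂))
      (fun v ρ w => ∑ d, G (Sum.elim v d ∘ sel) (k v ρ d) w : Kernel W E E₂) := by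
  have hE := hk.card_input_le
  have hE₃ := hG.card_input_le
  have hG' := hG
  obtain ⟨A₁, _, _, inp₁, out₁, gs₁, hs₁, h₁⟩ := hk
  obtain ⟨A₂, _, _, inp₂, out₂, gs₂, hs₂, h₂⟩ := hG
  let f₁ : A₁ ↪ E ⊕ (A₁ ⊕ A₂) := Function.Embedding.trans .inl .inr
  let f₂ : A₂ ↪ E ⊕ (A₁ ⊕ A₂) := Function.Embedding.trans .inr .inr
  let src : E₃ → E ⊕ (A₁ ⊕ A₂) := fun p =>
    Sum.elim Sum.inl (fun d => Sum.inr (Sum.inl (out₁ d))) (sel p)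
  have hsrc : ∀ p q, src p ≠ (inp₂.trans f₂) q := by
    intro p q
    simp only [src]
    rcases sel p with e | d <;> simp [f₂]
  have hsrc' : ∀ p q, (Sum.inr (src p) : W ⊕ (E ⊕ (A₁ ⊕ A₂)))
      ≠ ((inp₂.trans f₂).trans Function.Embedding.inr) q :=
    fun p q e => hsrc p q (Sum.inr_injective e)
  let c₁ : List (CGate (E ⊕ (A₁ ⊕ A₂))) :=
    copyGates (fun p : E => Sum.inl p) (inp₁.trans f₁) (by intro p q; simp [f₁])
  let c₂ : List (CGate (W ⊕ (E ⊕ (A₁ ⊕ A₂)))) :=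
    copyGates (fun p : E₃ => Sum.inr (src p)) ((inp₂.trans f₂).trans .inr) hsrc'
  refine ⟨E ⊕ (A₁ ⊕ A₂), inferInstance, inferInstance, .inl, out₂.trans f₂,
    (c₁.map (CGate.map .inr)).map .classical
      ++ (gs₁.map (QGate.map (Function.Embedding.sumMap (.refl W) f₁))
      ++ (c₂.map .classical
      ++ gs₂.map (QGate.map (Function.Embedding.sumMap (.refl W) f₂)))), ?_, ?_⟩
  · simp only [List.length_append, List.length_map, Fintype.card_sum, c₁, c₂, copyGates_length]
    omega
  intro v ρ v'
  have hz₁ : runClassical c₁ (Function.extend (.inl : E ↪ E ⊕ (A₁ ⊕ A₂)) v fun _ => false)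
      = Sum.elim v (Sum.elim (Function.extend inp₁ v fun _ => false) fun _ => false) := by
    rw [runClassical_copyGates]
    symm
    refine (eq_extend_iff _ _ _ _).2 ⟨funext fun p => ?_, ?_⟩
    · have hv : Function.extend (.inl : E ↪ E ⊕ (A₁ ⊕ A₂)) v (fun _ => false) (Sum.inl p) = v p :=
        extend_emb_apply (.inl : E ↪ E ⊕ (A₁ ⊕ A₂)) v _ p
      have ho : Function.extend (.inl : E ↪ E ⊕ (A₁ ⊕ A₂)) v (fun _ => false)
          ((inp₁.trans f₁) p) = false := extend_off _ v _ (by simp [f₁])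
      rw [hv, ho]
      simp [f₁]
    · rintro (p | p | p) hp
      · exact (extend_emb_apply (.inl : E ↪ E ⊕ (A₁ ⊕ A₂)) v _ p).symm
      · refine (extend_off inp₁ v (fun _ => false) ?_).trans
          (extend_off (.inl : E ↪ E ⊕ (A₁ ⊕ A₂)) v (fun _ => false) ?_).symm
        · rintro ⟨q, rfl⟩; exact hp ⟨q, rfl⟩
        · simp
      · exact (extend_off (.inl : E ↪ E ⊕ (A₁ ⊕ A₂)) v _ (by simp)).symm
  simp only [applyAll_append]
  rw [applyAll_classical_adjoin, hz₁]
  set σ₁ := applyAll gs₁ (adjoin ρ (Function.extend inp₁ v fun _ => false)) with hσ₁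
  set τ := applyAll (gs₁.map (QGate.map (Function.Embedding.sumMap (.refl W) f₁)))
    (adjoin ρ (Sum.elim v (Sum.elim (Function.extend inp₁ v fun _ => false) fun _ => false)))
  -- after the first circuit, with the wires of the second circuit still zero
  have hτ : ∀ a b e w u u', τ (Sum.elim a (Sum.elim e (Sum.elim w u)))
      (Sum.elim b (Sum.elim e (Sum.elim w u')))
      = if e = v ∧ (u = fun _ => false) ∧ (u' = fun _ => false) then
          condition σ₁ w a b else 0 := by
    intro a b e w u u'
    have hx : ∀ (a : W → Bool) (w w' : A₁ → Bool) (u : A₂ → Bool),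
        Function.extend (Function.Embedding.sumMap (.refl W) f₁) (Sum.elim a w')
          (Sum.elim a (Sum.elim e (Sum.elim w u)))
        = Sum.elim a (Sum.elim e (Sum.elim w' u)) := by
      intro a w w' u
      rw [extend_inl_sumMap]
      congr 1
      symm
      refine (eq_extend_iff _ _ _ _).2 ⟨rfl, ?_⟩
      rintro (p | p | p) hp
      · rfl
      · exact absurd ⟨p, rfl⟩ hp
      · rfl
    have hb := block_applyAll (Function.Embedding.sumMap (.refl W) f₁) gs₁
      (Sum.elim (fun _ => false) (Sum.elim e (Sum.elim w u)))
      (Sum.elim (fun _ => false) (Sum.elim e (Sum.elim w u')))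
      (adjoin ρ (Sum.elim v (Sum.elim (Function.extend inp₁ v fun _ => false) fun _ => false)))
    have hx' : ∀ (a : W → Bool) (w' : A₁ → Bool) (u : A₂ → Bool),
        Function.extend (Function.Embedding.sumMap (.refl W) f₁) (Sum.elim a w')
          (Sum.elim (fun _ => false) (Sum.elim e (Sum.elim w u)))
        = Sum.elim a (Sum.elim e (Sum.elim w' u)) := by
      intro a w' u
      rw [← hx a w w' u, extend_inl_sumMap, extend_inl_sumMap]
      rfl
    have hbl : block (Function.Embedding.sumMap (.refl W) f₁)
        (Sum.elim (fun _ => false) (Sum.elim e (Sum.elim w u)))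
        (Sum.elim (fun _ => false) (Sum.elim e (Sum.elim w u')))
        (adjoin ρ (Sum.elim v (Sum.elim (Function.extend inp₁ v fun _ => false) fun _ => false)))
        = if e = v ∧ (u = fun _ => false) ∧ (u' = fun _ => false) then
          adjoin ρ (Function.extend inp₁ v fun _ => false) else 0 := by
      ext x y
      rw [← Sum.elim_comp_inl_inr x, ← Sum.elim_comp_inl_inr y]
      simp only [block, Matrix.of_apply, hx', adjoin_elim]
      have he : ∀ (e e' : E → Bool) (w w' : A₁ → Bool) (u u' : A₂ → Bool),
          Sum.elim e (Sum.elim w u) = Sum.elim e' (Sum.elim w' u') ↔ e = e' ∧ w = w' ∧ u = u' := by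
        intro e e' w w' u u'
        constructor
        · intro h
          exact ⟨funext fun p => congrFun h (Sum.inl p),
            funext fun p => congrFun h (Sum.inr (Sum.inl p)),
            funext fun p => congrFun h (Sum.inr (Sum.inr p))⟩
        · rintro ⟨rfl, rfl, rfl⟩; rfl
      simp only [he]
      by_cases hc : e = v ∧ (u = fun _ => false) ∧ (u' = fun _ => false)
      · rw [if_pos hc, adjoin_elim]
        simp [hc]
      · rw [if_neg hc, if_neg (by tauto)]
        rfl
    rw [hbl, applyAll_ite_zero] at hb
    have hbe := congrFun (congrFun hb (Sum.elim a w)) (Sum.elim b w)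
    simp only [block, Matrix.of_apply, hx'] at hbe
    refine hbe.trans ?_
    split_ifs <;> rfl
  have hcopy : ∀ (a : W → Bool) (e : E → Bool) (w : A₁ → Bool) (u : A₂ → Bool),
      copyFun (fun p : E₃ => (Sum.inr (src p) : W ⊕ (E ⊕ (A₁ ⊕ A₂))))
        ((inp₂.trans f₂).trans .inr) (Sum.elim a (Sum.elim e (Sum.elim w u)))
      = Sum.elim a (Sum.elim e (Sum.elim w (Function.extend inp₂
          (fun p => xor (u (inp₂ p)) (Sum.elim e (w ∘ out₁) (sel p))) u))) := by
    intro a e w u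
    symm
    refine (eq_extend_iff _ _ _ _).2 ⟨funext fun p => ?_, ?_⟩
    · change Function.extend inp₂ (fun p => xor (u (inp₂ p)) (Sum.elim e (w ∘ out₁) (sel p))) u
        (inp₂ p) = xor (u (inp₂ p)) (Sum.elim a (Sum.elim e (Sum.elim w u)) (Sum.inr (src p)))
      rw [extend_emb_apply]
      congr 1
      simp only [src]
      rcases sel p with q | q <;> rfl
    · rintro (p | p | p | p) hp
      · rfl
      · rfl
      · rfl
      · exact extend_off inp₂ (fun p => xor (u (inp₂ p)) (Sum.elim e (w ∘ out₁) (sel p))) u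
          (w := p) fun ⟨q, h⟩ => hp ⟨q, by simp [f₂, h]⟩
  -- the target wires were zero before the copying exactly if they now carry the copied bits
  have hzero : ∀ (e : E → Bool) (w : A₁ → Bool) (u : A₂ → Bool),
      (Function.extend inp₂ (fun p => xor (u (inp₂ p)) (Sum.elim e (w ∘ out₁) (sel p))) u
        = fun _ => false)
      ↔ u = Function.extend inp₂ (Sum.elim e (w ∘ out₁) ∘ sel) fun _ => false := by
    intro e w u
    rw [eq_comm, eq_extend_iff, eq_extend_iff]
    refine and_congr ⟨fun h => funext fun p => ?_, fun h => funext fun p => ?_⟩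
      (forall₂_congr fun p hp => eq_comm)
    · have := congrFun h p
      simp only [Function.comp_apply] at this ⊢
      revert this
      cases u (inp₂ p) <;> cases Sum.elim e (w ∘ out₁) (sel p) <;> simp
    · have := congrFun h p
      simp only [Function.comp_apply] at this ⊢
      rw [this]
      simp
  -- given the contents of the first two groups of wires, the second circuit starts in the
  -- post-measurement state, with the selected bits as its input
  have hblock : ∀ (e : E → Bool) (w : A₁ → Bool) (u : A₂ → Bool),
      block (Function.Embedding.sumMap (.refl W) f₂)
        (Sum.elim (fun _ => false) (Sum.elim e (Sum.elim w u)))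
        (Sum.elim (fun _ => false) (Sum.elim e (Sum.elim w u))) (applyAll (c₂.map .classical) τ)
      = if e = v then adjoin (condition σ₁ w)
          (Function.extend inp₂ (Sum.elim v (w ∘ out₁) ∘ sel) fun _ => false) else 0 := by
    intro e w u
    ext x y
    rw [← Sum.elim_comp_inl_inr x, ← Sum.elim_comp_inl_inr y]
    have hx : ∀ (a : W → Bool) (u' : A₂ → Bool),
        Function.extend (Function.Embedding.sumMap (.refl W) f₂) (Sum.elim a u')
          (Sum.elim (fun _ => false) (Sum.elim e (Sum.elim w u)))
        = Sum.elim a (Sum.elim e (Sum.elim w u')) := by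
      intro a u'
      rw [extend_inl_sumMap]
      congr 1
      symm
      refine (eq_extend_iff _ _ _ _).2 ⟨rfl, ?_⟩
      rintro (p | p | p) hp
      · rfl
      · rfl
      · exact absurd ⟨p, rfl⟩ hp
    simp only [block, Matrix.of_apply, hx, c₂]
    rw [applyAll_copyGates, hcopy, hcopy, hτ]
    simp only [hzero]
    by_cases he : e = v
    · subst he
      simp only [true_and, if_true, adjoin_elim]
    · simp [he]
  rw [sum_sumElim]
  have hsum : ∀ e : E → Bool, (∑ z : A₁ ⊕ A₂ → Bool,
      if Sum.elim e z ∘ (out₂.trans f₂) = v' then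
        condition (applyAll (gs₂.map (QGate.map (Function.Embedding.sumMap (.refl W) f₂)))
          (applyAll (c₂.map .classical) τ)) (Sum.elim e z) else 0)
      = if e = v then ∑ w, G (Sum.elim v (w ∘ out₁) ∘ sel) (condition σ₁ w) v' else 0 := by
    intro e
    rw [sum_sumElim]
    have : ∀ (w : A₁ → Bool) (u : A₂ → Bool),
        (if Sum.elim e (Sum.elim w u) ∘ (out₂.trans f₂) = v' then
          condition (applyAll (gs₂.map (QGate.map (Function.Embedding.sumMap (.refl W) f₂)))
            (applyAll (c₂.map .classical) τ)) (Sum.elim e (Sum.elim w u)) else 0)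
        = if e = v then (if u ∘ out₂ = v' then condition (applyAll gs₂ (adjoin (condition σ₁ w)
          (Function.extend inp₂ (Sum.elim v (w ∘ out₁) ∘ sel) fun _ => false))) u else 0)
          else 0 := by
      intro w u
      rw [condition_applyAll_map, hblock, applyAll_ite_zero, condition_ite_zero]
      have e1 : Sum.elim e (Sum.elim w u) ∘ (out₂.trans f₂) = u ∘ out₂ := rfl
      have e2 : Sum.elim e (Sum.elim w u) ∘ f₂ = u := rfl
      rw [e1, e2]
      split_ifs <;> rfl
    simp only [this]
    split_ifs with he
    · exact Finset.sum_congr rfl fun w _ => (h₂ _ _ _).symm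
    · simp
  simp only [hsum, Finset.sum_ite_eq', Finset.mem_univ, if_true]
  simp only [h₁ v ρ, ← hσ₁]
  simp only [hG'.map_sum]
  rw [Finset.sum_comm]
  refine Finset.sum_congr rfl fun w _ => ?_
  rw [Finset.sum_eq_single (w ∘ out₁)]
  · simp
  · intro d _ hd
    rw [if_neg (Ne.symm hd)]
    exact hG'.map_zero _ _
  · simp

end Bind

/-! ### Elementary kernels -/

section Elementary

variable {W E E' : Type} [Fintype W] [DecidableEq W] [Fintype E] [DecidableEq E]
  [Fintype E'] [DecidableEq E']

theorem condition_applyAll_inl (gs : List (QGate W)) (τ : State (W ⊕ E)) (w : E → Bool) :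
    condition (applyAll (gs.map (QGate.map (.inl : W ↪ W ⊕ E))) τ) w
      = applyAll gs (condition τ w) := by
  have hx : ∀ a : W → Bool, Function.extend (.inl : W ↪ W ⊕ E) a
      (Sum.elim (fun _ => false) w) = Sum.elim a w := by
    intro a
    symm
    refine (eq_extend_iff _ _ _ _).2 ⟨rfl, ?_⟩
    rintro (p | p) hp
    · exact absurd ⟨p, rfl⟩ hp
    · rfl
  have hb : ∀ τ : State (W ⊕ E), condition τ w = block (.inl : W ↪ W ⊕ E)
      (Sum.elim (fun _ => false) w) (Sum.elim (fun _ => false) w) τ := by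
    intro τ
    ext a b
    simp only [condition, block, Matrix.of_apply, hx]
  rw [hb, hb, block_applyAll]

theorem extend_inl_false {A B : Type} (v : A → Bool) :
    Function.extend (.inl : A ↪ A ⊕ B) v (fun _ => false) = Sum.elim v fun _ => false := by
  symm
  refine (eq_extend_iff _ _ _ _).2 ⟨rfl, ?_⟩
  rintro (p | p) hp
  · exact absurd ⟨p, rfl⟩ hp
  · rfl

theorem sumElim_inj {A B : Type} {a a' : A → Bool} {b b' : B → Bool} :
    Sum.elim a b = Sum.elim a' b' ↔ a = a' ∧ b = b' := by
  constructor
  · intro h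
    exact ⟨funext fun p => congrFun h (Sum.inl p), funext fun p => congrFun h (Sum.inr p)⟩
  · rintro ⟨rfl, rfl⟩; rfl

theorem implements_applyAll (gs : List (QGate W)) :
    Implements (Fintype.card E + gs.length)
      (fun _ ρ _ => applyAll gs ρ : Kernel W E (Fin 0)) := by
  refine ⟨E, inferInstance, inferInstance, .refl E, Function.Embedding.ofIsEmpty,
    gs.map (QGate.map .inl), by simp, fun v ρ v' => ?_⟩
  have hv : Function.extend (Function.Embedding.refl E) v (fun _ => false) = v :=
    funext fun p => extend_emb_apply (Function.Embedding.refl E) v _ p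
  have h0 : ∀ w : E → Bool, w ∘ (Function.Embedding.ofIsEmpty : Fin 0 ↪ E) = v' :=
    fun w => Subsingleton.elim _ _
  simp only [condition_applyAll_inl, h0, if_true, hv, condition_adjoin, applyAll_ite_zero,
    Finset.sum_ite_eq', Finset.mem_univ]

theorem project_apply {m : ℕ} (port : Fin m ↪ W) (u : Bits m) (ρ : State W) (x y : W → Bool) :
    project port u ρ x y = if x ∘ port = u ∧ y ∘ port = u then ρ x y else 0 := by
  rw [project, conj, Matrix.diagonal_conjTranspose, Matrix.mul_diagonal, Matrix.diagonal_mul]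
  simp only [Pi.star_apply]
  split_ifs <;> simp_all

/-- A measurement is a copy to fresh wires. -/
theorem implements_project {m : ℕ} (port : Fin m ↪ W) :
    Implements (Fintype.card E + 2 * m)
      (fun _ ρ u => project port u ρ : Kernel W E (Fin m)) := by
  have hne : ∀ p q, (Sum.inl (port p) : W ⊕ (E ⊕ Fin m)) ≠
      ((.inr : Fin m ↪ E ⊕ Fin m).trans .inr) q := by
    intro p q; simp
  refine ⟨E ⊕ Fin m, inferInstance, inferInstance, .inl, .inr,
    (copyGates (fun p => Sum.inl (port p)) ((.inr : Fin m ↪ E ⊕ Fin m).trans .inr) hne).map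
      .classical, ?_, fun v ρ u => ?_⟩
  · simp [copyGates_length]; omega
  have hcopy : ∀ (a : W → Bool) (e : E → Bool) (f : Fin m → Bool),
      copyFun (fun p => (Sum.inl (port p) : W ⊕ (E ⊕ Fin m)))
        ((.inr : Fin m ↪ E ⊕ Fin m).trans .inr) (Sum.elim a (Sum.elim e f))
      = Sum.elim a (Sum.elim e fun p => xor (f p) (a (port p))) := by
    intro a e f
    symm
    refine (eq_extend_iff _ _ _ _).2 ⟨rfl, ?_⟩
    rintro (p | p | p) hp
    · rfl
    · rfl
    · exact absurd ⟨p, rfl⟩ hp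
  have hxor : ∀ (a : W → Bool) (f : Fin m → Bool),
      ((fun p => xor (f p) (a (port p))) = fun _ => false) ↔ a ∘ port = f := by
    intro a f
    rw [funext_iff, funext_iff]
    refine forall_congr' fun p => ?_
    simp only [Function.comp_apply]
    cases f p <;> cases a (port p) <;> simp
  ext x y
  change project port u ρ x y = _
  rw [sum_sumElim, project_apply]
  have hc : ∀ (e : E → Bool) (f : Fin m → Bool),
      condition (applyAll ((copyGates (fun p => Sum.inl (port p))
        ((.inr : Fin m ↪ E ⊕ Fin m).trans .inr) hne).map .classical)
        (adjoin ρ (Function.extend (.inl : E ↪ E ⊕ Fin m) v fun _ => false))) (Sum.elim e f) x y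
      = if e = v then (if x ∘ port = f ∧ y ∘ port = f then ρ x y else 0) else 0 := by
    intro e f
    simp only [condition, Matrix.of_apply]
    rw [applyAll_copyGates, hcopy, hcopy, extend_inl_false, adjoin_elim]
    simp only [sumElim_inj, hxor]
    split_ifs <;> first | rfl | (exfalso; tauto)
  have ho : ∀ (e : E → Bool) (f : Fin m → Bool),
      Sum.elim e f ∘ (.inr : Fin m ↪ E ⊕ Fin m) = f := fun _ _ => rfl
  simp only [Matrix.sum_apply, ho, hc, Finset.sum_ite_eq', Finset.mem_univ, if_true]

theorem write_apply {m : ℕ} (port : Fin m ↪ W) (v : Bits m) (ρ : State W) (x y : W → Bool) :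
    write port v ρ x y = if x ∘ port = v ∧ y ∘ port = v then
      ∑ u : Bits m, ρ (Function.extend port u x) (Function.extend port u y) else 0 := by
  have hiff : ∀ (u : Bits m) (x a : W → Bool), (a ∘ port = u ∧ x = Function.extend port v a) ↔
      a = Function.extend port u x ∧ x ∘ port = v := by
    intro u x a
    rw [eq_extend_iff, eq_extend_iff]
    constructor
    · rintro ⟨h, h', h''⟩
      exact ⟨⟨h, fun w hw => (h'' w hw).symm⟩, h'⟩
    · rintro ⟨⟨h, h''⟩, h'⟩
      exact ⟨h, h', fun w hw => (h'' w hw).symm⟩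
  simp only [write, Matrix.sum_apply, conj_apply, Matrix.of_apply, hiff]
  by_cases hx : x ∘ port = v
  · by_cases hy : y ∘ port = v
    · simp [hx, hy]
    · simp [hy]
  · simp [hx]

theorem implements_write {m : ℕ} (port : Fin m ↪ W) (sel : Fin m → E) :
    Implements (Fintype.card E + 5 * m)
      (fun v ρ _ => write port (v ∘ sel) ρ : Kernel W E (Fin 0)) := by
  let F : Fin m ↪ W ⊕ (E ⊕ Fin m) := (.inr : Fin m ↪ E ⊕ Fin m).trans .inr
  let P : Fin m ↪ W ⊕ (E ⊕ Fin m) := port.trans .inl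
  have h1 : ∀ p q, (Sum.inr (Sum.inl (sel p)) : W ⊕ (E ⊕ Fin m)) ≠ F q := by
    intro p q; simp [F]
  have h2 : ∀ p q, F p ≠ P q := by intro p q; simp [F, P]
  have h3 : ∀ p q, P p ≠ F q := by intro p q; simp [F, P]
  -- write the string on fresh wires, and exchange these with the wires `port`
  refine ⟨E ⊕ Fin m, inferInstance, inferInstance, .inl, Function.Embedding.ofIsEmpty,
    (copyGates (fun p => Sum.inr (Sum.inl (sel p))) F h1).map .classical ++
      ((copyGates F P h2).map .classical ++
      ((copyGates P F h3).map .classical ++ (copyGates F P h2).map .classical)), ?_,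
    fun v ρ u => ?_⟩
  · simp [copyGates_length]; omega
  have c1 : ∀ (a : W → Bool) (e : E → Bool) (f : Fin m → Bool),
      copyFun (fun p => (Sum.inr (Sum.inl (sel p)) : W ⊕ (E ⊕ Fin m))) F
        (Sum.elim a (Sum.elim e f)) = Sum.elim a (Sum.elim e fun p => xor (f p) (e (sel p))) := by
    intro a e f
    symm
    refine (eq_extend_iff _ _ _ _).2 ⟨rfl, ?_⟩
    rintro (p | p | p) hp
    · rfl
    · rfl
    · exact absurd ⟨p, rfl⟩ hp
  have c3 : ∀ (a : W → Bool) (e : E → Bool) (f : Fin m → Bool),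
      copyFun P F (Sum.elim a (Sum.elim e f))
        = Sum.elim a (Sum.elim e fun p => xor (f p) (a (port p))) := by
    intro a e f
    symm
    refine (eq_extend_iff _ _ _ _).2 ⟨rfl, ?_⟩
    rintro (p | p | p) hp
    · rfl
    · rfl
    · exact absurd ⟨p, rfl⟩ hp
  have c2 : ∀ (a : W → Bool) (e : E → Bool) (f : Fin m → Bool),
      copyFun F P (Sum.elim a (Sum.elim e f))
        = Sum.elim (Function.extend port (fun p => xor (a (port p)) (f p)) a) (Sum.elim e f) := by
    intro a e f
    symm
    refine (eq_extend_iff _ _ _ _).2 ⟨funext fun p =>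
      extend_emb_apply port (fun p => xor (a (port p)) (f p)) a p, ?_⟩
    rintro (p | p | p) hp
    · exact extend_off port (fun p => xor (a (port p)) (f p)) a (w := p)
        fun ⟨q, h⟩ => hp ⟨q, by simp [P, h]⟩
    · rfl
    · rfl
  have hxor'' : ∀ a b : Bool, xor a (xor b a) = b := by decide
  have hall : ∀ (a : W → Bool) (e : E → Bool) (f : Fin m → Bool),
      copyFun (fun p => (Sum.inr (Sum.inl (sel p)) : W ⊕ (E ⊕ Fin m))) F
        (copyFun F P (copyFun P F (copyFun F P (Sum.elim a (Sum.elim e f)))))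
      = Sum.elim (Function.extend port f a)
        (Sum.elim e fun p => xor (a (port p)) (e (sel p))) := by
    intro a e f
    rw [c2, c3, c2, c1]
    simp only [extend_emb_apply, hxor'']
    congr 1
    refine (eq_extend_iff _ _ _ _).2 ⟨funext fun p => ?_, fun w hw => ?_⟩
    · simp only [Function.comp_apply, extend_emb_apply]
      exact (by decide : ∀ a b : Bool, xor (xor a b) a = b) _ _
    · rw [extend_off _ _ _ hw, extend_off _ _ _ hw]
  have hzero : ∀ (a : W → Bool) (e : E → Bool),
      ((fun p => xor (a (port p)) (e (sel p))) = fun _ => false) ↔ a ∘ port = e ∘ sel := by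
    intro a e
    rw [funext_iff, funext_iff]
    refine forall_congr' fun p => ?_
    simp only [Function.comp_apply]
    cases e (sel p) <;> cases a (port p) <;> simp
  have h0 : ∀ w : E ⊕ Fin m → Bool,
      w ∘ (Function.Embedding.ofIsEmpty : Fin 0 ↪ E ⊕ Fin m) = u := fun w => Subsingleton.elim _ _
  ext x y
  change write port (v ∘ sel) ρ x y = _
  rw [sum_sumElim, write_apply]
  simp only [h0, if_true, Matrix.sum_apply, condition, Matrix.of_apply, applyAll_append]
  have hc : ∀ (e : E → Bool) (f : Fin m → Bool),
      applyAll ((copyGates F P h2).map .classical) (applyAll ((copyGates P F h3).map .classical)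
        (applyAll ((copyGates F P h2).map .classical)
        (applyAll ((copyGates (fun p => Sum.inr (Sum.inl (sel p))) F h1).map .classical)
        (adjoin ρ (Function.extend (.inl : E ↪ E ⊕ Fin m) v fun _ => false)))))
        (Sum.elim x (Sum.elim e f)) (Sum.elim y (Sum.elim e f))
      = if e = v then (if x ∘ port = v ∘ sel ∧ y ∘ port = v ∘ sel then
          ρ (Function.extend port f x) (Function.extend port f y) else 0) else 0 := by
    intro e f
    rw [applyAll_copyGates, applyAll_copyGates, applyAll_copyGates, applyAll_copyGates, hall, hall,
      extend_inl_false, adjoin_elim]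
    simp only [sumElim_inj, hzero]
    by_cases he : e = v
    · subst he
      simp
    · simp [he]
  simp only [hc]
  rw [Finset.sum_eq_single v]
  · simp only [if_true]
    split_ifs <;> simp
  · intro e _ he
    simp [he]
  · simp

/-- A Hadamard gate on a wire that is zero. All signs are trivial, and every entry is `1 / 2`. -/
theorem hadamard_apply_of_zero (i : W) (σ : State W)
    (h : ∀ a b : W → Bool, a i = true ∨ b i = true → σ a b = 0) (x y : W → Bool) :
    (QGate.hadamard i).apply σ x y
      = (1 / 2) * σ (Function.update x i false) (Function.update y i false) := by
  have h2 : ((Real.sqrt 2 : ℝ) : ℂ)⁻¹ * ((Real.sqrt 2 : ℝ) : ℂ)⁻¹ = 1 / 2 := by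
    rw [← mul_inv, ← Complex.ofReal_mul, Real.mul_self_sqrt (by norm_num)]
    norm_num
  have hH : ∀ x : W → Bool, hadamardMatrix i x (Function.update x i false)
      = ((Real.sqrt 2 : ℝ) : ℂ)⁻¹ := by
    intro x
    simp only [hadamardMatrix, Matrix.of_apply]
    rw [if_pos fun j hj => (Function.update_of_ne hj _ _).symm]
    simp
  have hH0 : ∀ x a : W → Bool, a i = false → a ≠ Function.update x i false →
      hadamardMatrix i x a = 0 := by
    intro x a ha hne
    simp only [hadamardMatrix, Matrix.of_apply]
    rw [if_neg]
    intro hj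
    refine hne (funext fun k => ?_)
    by_cases hk : k = i
    · subst hk; simp [ha]
    · rw [Function.update_of_ne hk, hj k hk]
  rw [QGate.apply, conj_apply, Finset.sum_eq_single (Function.update y i false),
    Finset.sum_eq_single (Function.update x i false), hH, hH]
  · have hs : star (((Real.sqrt 2 : ℝ) : ℂ)⁻¹) = ((Real.sqrt 2 : ℝ) : ℂ)⁻¹ := by
      rw [← Complex.ofReal_inv]
      exact Complex.conj_ofReal _
    rw [hs, ← h2]
    ring
  · intro a _ hne
    by_cases ha : a i = true
    · rw [h _ _ (Or.inl ha)]; simp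
    · rw [hH0 x a (by simpa using ha) hne]; simp
  · simp
  · intro b _ hne
    refine Finset.sum_eq_zero fun a _ => ?_
    by_cases hb : b i = true
    · rw [h _ _ (Or.inr hb)]; simp
    · rw [hH0 y b (by simpa using hb) hne]; simp
  · simp

open Classical in
/-- Hadamard gates on the wires in the list `l`, when all wires in the range of `b` are zero. -/
theorem hadamards_apply {P : Type} [DecidableEq P] (b : P ↪ W) (σ : State W)
    (h : ∀ x y : W → Bool, (∃ p, x (b p) = true ∨ y (b p) = true) → σ x y = 0) (l : List P)
    (hl : l.Nodup) (x y : W → Bool) :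
    applyAll (l.map fun p => QGate.hadamard (b p)) σ x y
      = if ∀ p, p ∉ l → x (b p) = false ∧ y (b p) = false then
          (1 / 2) ^ l.length * σ (Function.extend b (fun _ => false) x)
            (Function.extend b (fun _ => false) y) else 0 := by
  induction l using List.reverseRecOn generalizing x y with
  | nil =>
    simp only [List.map_nil, List.not_mem_nil, not_false_eq_true, forall_true_left,
      List.length_nil, pow_zero, one_mul]
    have e : applyAll [] σ x y = σ x y := rfl
    rw [e]
    split_ifs with hc
    · have hx : x = Function.extend b (fun _ => false) x :=
        (eq_extend_iff b _ _ _).2 ⟨funext fun p => (hc p).1, fun _ _ => rfl⟩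
      have hy : y = Function.extend b (fun _ => false) y :=
        (eq_extend_iff b _ _ _).2 ⟨funext fun p => (hc p).2, fun _ _ => rfl⟩
      rw [← hx, ← hy]
    · refine h x y ?_
      push Not at hc
      obtain ⟨p, hp⟩ := hc
      refine ⟨p, ?_⟩
      by_cases hx : x (b p) = true
      · exact Or.inl hx
      · exact Or.inr (by simpa using hp (by simpa using hx))
  | append_singleton l q ih =>
    have hl' := List.nodup_append.1 hl
    have hq : q ∉ l := fun hq => hl'.2.2 q hq q (by simp) rfl
    rw [List.map_append, applyAll_append]
    change (QGate.hadamard (b q)).apply _ x y = _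
    rw [hadamard_apply_of_zero]
    · rw [ih hl'.1]
      have hcond : (∀ p, p ∉ l → Function.update x (b q) false (b p) = false ∧
          Function.update y (b q) false (b p) = false) ↔
          ∀ p, p ∉ l ++ [q] → x (b p) = false ∧ y (b p) = false := by
        refine forall_congr' fun p => ?_
        by_cases hp : p = q
        · subst hp; simp
        · simp [hp]
      have hz : ∀ x : W → Bool, Function.extend b (fun _ => false) (Function.update x (b q) false)
          = Function.extend b (fun _ => false) x := by
        intro x
        refine (eq_extend_iff b _ _ _).2 ⟨extend_comp_emb b _ _, fun w hw => ?_⟩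
        rw [extend_off b _ _ hw, Function.update_of_ne]
        rintro rfl
        exact hw ⟨q, rfl⟩
      rw [if_congr hcond rfl rfl, hz, hz, List.length_append]
      split_ifs
      · simp only [List.length_singleton, pow_succ]; ring
      · simp
    · intro a c hac
      rw [ih hl'.1, if_neg]
      intro hc
      have := hc q hq
      rcases hac with ha | ha <;> simp_all

/-- Random bits are the measurement results of Hadamard gates on fresh wires. -/
theorem implements_random (n : ℕ) :
    Implements (Fintype.card E + 2 * n)
      (fun _ ρ _ => ((2 : ℂ) ^ n)⁻¹ • ρ : Kernel W E (Fin n)) := by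
  classical
  let F : Fin n ↪ W ⊕ (E ⊕ Fin n) := (.inr : Fin n ↪ E ⊕ Fin n).trans .inr
  refine ⟨E ⊕ Fin n, inferInstance, inferInstance, .inl, .inr,
    Finset.univ.toList.map fun p => QGate.hadamard (F p), ?_, fun v ρ u => ?_⟩
  · simp; omega
  have h0 : ∀ x y : W ⊕ (E ⊕ Fin n) → Bool, (∃ p, x (F p) = true ∨ y (F p) = true) →
      adjoin ρ (Sum.elim v fun _ => false : E ⊕ Fin n → Bool) x y = 0 := by
    rintro x y ⟨p, hp⟩
    simp only [adjoin, Matrix.of_apply]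
    rw [if_neg]
    rintro ⟨hx, hy⟩
    have h1 := congrFun hx (Sum.inr p)
    have h2 := congrFun hy (Sum.inr p)
    simp only [Function.comp_apply, Sum.elim_inr] at h1 h2
    have : x (F p) = false ∧ y (F p) = false := ⟨h1, h2⟩
    simp [this] at hp
  ext x y
  rw [sum_sumElim]
  have hz : ∀ (a : W → Bool) (e : E → Bool) (f : Fin n → Bool),
      Function.extend F (fun _ => false) (Sum.elim a (Sum.elim e f))
        = Sum.elim a (Sum.elim e fun _ => false) := by
    intro a e f
    symm
    refine (eq_extend_iff _ _ _ _).2 ⟨rfl, ?_⟩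
    rintro (p | p | p) hp
    · rfl
    · rfl
    · exact absurd ⟨p, rfl⟩ hp
  have hc : ∀ (e : E → Bool) (f : Fin n → Bool),
      condition (applyAll (Finset.univ.toList.map fun p => QGate.hadamard (F p))
        (adjoin ρ (Function.extend (.inl : E ↪ E ⊕ Fin n) v fun _ => false))) (Sum.elim e f) x y
      = if e = v then ((2 : ℂ) ^ n)⁻¹ * ρ x y else 0 := by
    intro e f
    simp only [condition, Matrix.of_apply]
    rw [extend_inl_false, hadamards_apply F _ h0 _ (Finset.nodup_toList _), if_pos (by simp), hz,
      hz, adjoin_elim]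
    simp [sumElim_inj]
  have ho : ∀ (e : E → Bool) (f : Fin n → Bool),
      Sum.elim e f ∘ (.inr : Fin n ↪ E ⊕ Fin n) = f := fun _ _ => rfl
  simp only [Matrix.sum_apply, ho, hc, Finset.sum_ite_eq', Finset.mem_univ, if_true]
  simp

end Elementary

/-! ### Kernels of samplers, ideal-world adversaries and distinguishers -/

section Normalize

variable {W E E' : Type} [Fintype W] [DecidableEq W] [Fintype E] [DecidableEq E]
  [Fintype E'] [DecidableEq E']

/-- The names of the work wires do not matter. -/
theorem ImplementedBy.relabel {A B : Type} [Fintype A] [DecidableEq A] [Fintype B] [DecidableEq B]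
    {k : Kernel W E E'} {inp : E ↪ A} {out : E' ↪ A} {gs : List (QGate (W ⊕ A))}
    (h : ImplementedBy k inp out gs) (φ : A ≃ B) :
    ImplementedBy k (inp.trans φ.toEmbedding) (out.trans φ.toEmbedding)
      (gs.map (QGate.map (Function.Embedding.sumMap (.refl W) φ.toEmbedding))) := by
  intro v ρ v'
  rw [h, ← (Equiv.arrowCongr φ (Equiv.refl Bool)).sum_comp]
  refine Finset.sum_congr rfl fun w _ => ?_
  have hw : (Equiv.arrowCongr φ (Equiv.refl Bool)) w ∘ φ.toEmbedding = w := by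
    funext p; simp
  have ho : (Equiv.arrowCongr φ (Equiv.refl Bool)) w ∘ (out.trans φ.toEmbedding) = w ∘ out := by
    funext p; simp
  rw [ho, condition_applyAll_map, hw]
  have hb : block (Function.Embedding.sumMap (.refl W) φ.toEmbedding)
      (Sum.elim (fun _ => false) ((Equiv.arrowCongr φ (Equiv.refl Bool)) w))
      (Sum.elim (fun _ => false) ((Equiv.arrowCongr φ (Equiv.refl Bool)) w))
      (adjoin ρ (Function.extend (inp.trans φ.toEmbedding) v fun _ => false))
      = adjoin ρ (Function.extend inp v fun _ => false) := by
    ext x y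
    rw [← Sum.elim_comp_inl_inr x, ← Sum.elim_comp_inl_inr y]
    have hx : ∀ (u : A → Bool) (c : B → Bool), Function.extend φ.toEmbedding u c
        = u ∘ φ.symm := by
      intro u c
      symm
      refine (eq_extend_iff _ _ _ _).2 ⟨?_, fun w hw => absurd ⟨φ.symm w, by simp⟩ hw⟩
      funext p; simp
    simp only [block, Matrix.of_apply, extend_inl_sumMap, hx, adjoin_elim]
    have hu : ∀ u : A → Bool, u ∘ φ.symm = (Function.extend (inp.trans φ.toEmbedding) v
        fun _ => false) ↔ u = Function.extend inp v fun _ => false := by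
      intro u
      rw [eq_extend_iff, eq_extend_iff]
      refine and_congr ?_ ?_
      · have : (u ∘ φ.symm) ∘ (inp.trans φ.toEmbedding) = u ∘ inp := by funext p; simp
        rw [this]
      · rw [φ.symm.forall_congr_left]
        refine forall_congr' fun a => ?_
        simp
    simp only [hu]
  rw [hb]

/-- Implementations can be brought into the form of `IdealAlice` and `Distinguisher`. -/
theorem Implements.normalize {s : ℕ} {k : Kernel W E E'} (h : Implements s k) :
    ∃ (m : ℕ) (out : E' ↪ E ⊕ Fin m) (gs : List (QGate (W ⊕ (E ⊕ Fin m)))),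
      m + gs.length ≤ s ∧ ImplementedBy k .inl out gs := by
  classical
  obtain ⟨A, _, _, inp, out, gs, hs, h⟩ := h
  let R := {a : A // a ∉ Set.range inp}
  let φ : A ≃ E ⊕ Fin (Fintype.card R) :=
    (Equiv.Set.sumCompl (Set.range inp)).symm.trans
      (Equiv.sumCongr (Equiv.ofInjective inp inp.injective).symm (Fintype.equivFin R))
  have hφ : ∀ e, φ (inp e) = Sum.inl e := by
    intro e
    simp only [φ, Equiv.trans_apply]
    rw [Equiv.Set.sumCompl_symm_apply_of_mem (Set.mem_range_self e)]
    simp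
  have he : inp.trans φ.toEmbedding = .inl := by
    ext e
    simp [hφ]
  refine ⟨Fintype.card R, out.trans φ.toEmbedding, _, ?_, he ▸ h.relabel φ⟩
  rw [List.length_map]
  have : Fintype.card R ≤ Fintype.card A := Fintype.card_subtype_le _
  omega

end Normalize

section Conversions

/-- The kernel of an ideal-world adversary: the input is the string obtained from the
functionality, the output is the decision. -/
def IdealAlice.kernel {u z a L : ℕ} (I : IdealAlice u z a L) :
    Kernel (Reg u z a) (Fin L) (Fin 1) :=
  fun h ρ d => ∑ e : Fin L ⊕ Fin I.anc → Bool, if e I.decision = d 0 then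
    condition (applyAll I.gates (adjoin ρ (Sum.elim h fun _ => false))) e else 0

theorem IdealAlice.implements_kernel {u z a L : ℕ} (I : IdealAlice u z a L) :
    Implements (L + I.anc + I.gates.length) I.kernel := by
  refine ⟨Fin L ⊕ Fin I.anc, inferInstance, inferInstance, .inl,
    ⟨fun _ => I.decision, fun _ _ _ => Subsingleton.elim _ _⟩, I.gates, by simp, fun h ρ d => ?_⟩
  rw [IdealAlice.kernel, extend_inl_false]
  refine Finset.sum_congr rfl fun e _ => if_congr ?_ rfl rfl
  rw [funext_iff]
  exact ⟨fun h i => by rw [Subsingleton.elim i 0]; exact h, fun h => h 0⟩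

theorem Implements.exists_idealAlice {u z a L s : ℕ} {k : Kernel (Reg u z a) (Fin L) (Fin 1)}
    (h : Implements s k) :
    ∃ I : IdealAlice u z a L, I.anc + I.gates.length ≤ s ∧ I.kernel = k := by
  obtain ⟨m, out, gs, hs, h⟩ := h.normalize
  refine ⟨⟨m, gs, out 0⟩, hs, ?_⟩
  funext v ρ d
  rw [h, IdealAlice.kernel, extend_inl_false]
  refine Finset.sum_congr rfl fun e _ => if_congr ?_ rfl rfl
  rw [funext_iff]
  exact ⟨fun h i => by rw [Subsingleton.elim i 0]; exact h, fun h => h 0⟩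

theorem idealOutput_eq {uLen zLen aLen lam : ℕ → ℕ}
    (I : ∀ κ, IdealAlice (uLen κ) (zLen κ) (aLen κ) (lam κ)) (S : Sampler uLen zLen) (κ : ℕ) :
    idealOutput I S κ = ((2 : ℂ) ^ lam κ)⁻¹ • ∑ h : Bits (lam κ), ∑ z : Bits (zLen κ),
      ∑ d : Fin 1 → Bool, adjoin ((I κ).kernel h (S.init κ (aLen κ) z) d)
        (Sum.elim z (encOpt (if d 0 then some h else none))) := by
  rw [idealOutput]
  congr 1
  refine Finset.sum_congr rfl fun h _ => Finset.sum_congr rfl fun z _ => ?_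
  have hsum : ∀ {ι : Type} [Fintype ι] (f : ι → State (Reg (uLen κ) (zLen κ) (aLen κ)))
      (v : Fin (zLen κ) ⊕ Fin (lam κ + 1) → Bool),
      adjoin (∑ i, f i) v = ∑ i, adjoin (f i) v := fun f v => map_sum (adjoinHom v) f Finset.univ
  have hite : ∀ (p : Prop) [Decidable p] (σ : State (Reg (uLen κ) (zLen κ) (aLen κ)))
      (v : Fin (zLen κ) ⊕ Fin (lam κ + 1) → Bool),
      adjoin (if p then σ else 0) v = if p then adjoin σ v else 0 := by
    intro p _ σ v
    split_ifs
    · rfl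
    · exact map_zero (adjoinHom v)
  simp only [IdealAlice.kernel, hsum, hite]
  rw [Finset.sum_comm]
  refine Finset.sum_congr rfl fun e _ => ?_
  rw [Finset.sum_eq_single fun _ => e (I κ).decision]
  · simp
  · intro d _ hd
    rw [if_neg]
    intro h
    exact hd (funext fun i => by rw [Subsingleton.elim i 0, h])
  · simp

variable {W E : Type} [Fintype W] [DecidableEq W] [Fintype E] [DecidableEq E]

/-- The probability that a distinguisher accepts, as a linear functional. -/
def Distinguisher.acceptHom (D : Distinguisher E) : State E →ₗ[ℝ] ℝ where
  toFun := D.accept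
  map_add' ρ σ := by
    have h : ∀ x, applyAll D.gates (adjoin (ρ + σ) fun _ => false) x x
        = applyAll D.gates (adjoin ρ fun _ => false) x x
          + applyAll D.gates (adjoin σ fun _ => false) x x := by
      intro x
      have : adjoin (ρ + σ) (fun _ : Fin D.anc => false)
        = adjoin ρ (fun _ => false) + adjoin σ fun _ => false := map_add (adjoinHom _) ρ σ
      rw [this, ← applyHom_apply, ← applyHom_apply, ← applyHom_apply, map_add]
      rfl
    simp only [Distinguisher.accept, h, Complex.add_re, ← Finset.sum_add_distrib]
    refine Finset.sum_congr rfl fun x _ => ?_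
    split_ifs <;> simp
  map_smul' c ρ := by
    have h : ∀ x, applyAll D.gates (adjoin (c • ρ) fun _ => false) x x
        = c • applyAll D.gates (adjoin ρ fun _ => false) x x := by
      intro x
      have h1 : c • ρ = (c : ℂ) • ρ := by ext x y; simp
      have : adjoin ((c : ℂ) • ρ) (fun _ : Fin D.anc => false)
        = (c : ℂ) • adjoin ρ fun _ => false := map_smul (adjoinHom _) (c : ℂ) ρ
      rw [h1, this, ← applyHom_apply, ← applyHom_apply, map_smul]
      simp
    simp only [Distinguisher.accept, h, RingHom.id_apply, smul_eq_mul, Finset.mul_sum]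
    refine Finset.sum_congr rfl fun x _ => ?_
    split_ifs <;> simp

theorem Distinguisher.accept_sum {ι : Type*} (D : Distinguisher E) (t : Finset ι)
    (f : ι → State E) : D.accept (∑ i ∈ t, f i) = ∑ i ∈ t, D.accept (f i) :=
  map_sum D.acceptHom f t

theorem Distinguisher.accept_smul (D : Distinguisher E) (c : ℝ) (ρ : State E) :
    D.accept ((c : ℂ) • ρ) = c * D.accept ρ := by
  have h : (c : ℂ) • ρ = c • ρ := by ext x y; simp
  rw [h]
  exact map_smul D.acceptHom c ρ

/-- A distinguisher as a kernel with one output bit, which is a copy of the wire that it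
measures. -/
theorem Distinguisher.exists_kernel (D : Distinguisher (W ⊕ E)) :
    ∃ k : Kernel W E (Fin 1),
      Implements (Fintype.card E + D.anc + D.gates.length + 2) k ∧
      ∀ v ρ, (k v ρ fun _ => true).trace.re = D.accept (adjoin ρ v) := by
  let g : (W ⊕ E) ⊕ Fin D.anc ↪ W ⊕ ((E ⊕ Fin D.anc) ⊕ Fin 1) :=
    ⟨Sum.elim (Sum.elim Sum.inl fun e => Sum.inr (Sum.inl (Sum.inl e)))
      fun i => Sum.inr (Sum.inl (Sum.inr i)), by
      rintro ((a | a) | a) ((b | b) | b) h <;> simp_all⟩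
  let F : Fin 1 ↪ W ⊕ ((E ⊕ Fin D.anc) ⊕ Fin 1) :=
    (.inr : Fin 1 ↪ (E ⊕ Fin D.anc) ⊕ Fin 1).trans .inr
  have hne : ∀ p q, (fun _ => g D.out : Fin 1 → W ⊕ ((E ⊕ Fin D.anc) ⊕ Fin 1)) p ≠ F q := by
    intro p q h
    have h' : ∀ o, g o ≠ Sum.inr (Sum.inr q) := by
      rintro ((a | a) | a) h
      · exact Sum.inl_ne_inr h
      · exact Sum.inl_ne_inr (Sum.inr_injective h)
      · exact Sum.inl_ne_inr (Sum.inr_injective h)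
    exact h' _ h
  let gs : List (QGate (W ⊕ ((E ⊕ Fin D.anc) ⊕ Fin 1))) :=
    D.gates.map (QGate.map g) ++ (copyGates (fun _ : Fin 1 => g D.out) F hne).map .classical
  let inp : E ↪ (E ⊕ Fin D.anc) ⊕ Fin 1 := (.inl : E ↪ E ⊕ Fin D.anc).trans .inl
  have hinp : ∀ v : E → Bool, Function.extend inp v (fun _ => false)
      = Sum.elim (Sum.elim v fun _ => false) fun _ => false := by
    intro v
    symm
    refine (eq_extend_iff _ _ _ _).2 ⟨rfl, ?_⟩
    rintro ((p | p) | p) hp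
    · exact absurd ⟨p, rfl⟩ hp
    · rfl
    · rfl
  refine ⟨fun v ρ v' => ∑ w, if w ∘ (.inr : Fin 1 ↪ (E ⊕ Fin D.anc) ⊕ Fin 1) = v' then
    condition (applyAll gs (adjoin ρ (Function.extend inp v fun _ => false))) w else 0,
    ⟨_, inferInstance, inferInstance, inp, .inr, gs, ?_, fun _ _ _ => rfl⟩, fun v ρ => ?_⟩
  · simp only [gs, List.length_append, List.length_map, copyGates_length, Fintype.card_sum,
      Fintype.card_fin]
    omega
  set τ := adjoin ρ (Sum.elim (Sum.elim v fun _ => false) fun _ => false :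
    (E ⊕ Fin D.anc) ⊕ Fin 1 → Bool)
  have hx : ∀ (x : W ⊕ ((E ⊕ Fin D.anc) ⊕ Fin 1) → Bool) (b : Fin 1 → Bool),
      x ∘ Sum.inr ∘ Sum.inr = b → x = Function.extend g (x ∘ g)
        (Sum.elim (fun _ => false) (Sum.elim (fun _ => false) b)) := by
    rintro x b rfl
    refine (eq_extend_iff _ _ _ _).2 ⟨rfl, ?_⟩
    rintro (p | (p | p) | p) hp
    · exact absurd ⟨Sum.inl (Sum.inl p), rfl⟩ hp
    · exact absurd ⟨Sum.inl (Sum.inr p), rfl⟩ hp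
    · exact absurd ⟨Sum.inr p, rfl⟩ hp
    · rfl
  have hblock : ∀ b c : Fin 1 → Bool,
      block g (Sum.elim (fun _ => false) (Sum.elim (fun _ => false) b))
        (Sum.elim (fun _ => false) (Sum.elim (fun _ => false) c)) τ
      = if (b = fun _ => false) ∧ (c = fun _ => false) then
          adjoin (adjoin ρ v) (fun _ : Fin D.anc => false) else 0 := by
    intro b c
    ext x y
    have hg : ∀ (x : (W ⊕ E) ⊕ Fin D.anc → Bool) (b : Fin 1 → Bool),
        Function.extend g x (Sum.elim (fun _ => false) (Sum.elim (fun _ => false) b))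
        = Sum.elim (x ∘ Sum.inl ∘ Sum.inl)
          (Sum.elim (Sum.elim (x ∘ Sum.inl ∘ Sum.inr) (x ∘ Sum.inr)) b) := by
      intro x b
      symm
      refine (eq_extend_iff _ _ _ _).2 ⟨?_, ?_⟩
      · funext p
        rcases p with (p | p) | p <;> rfl
      · rintro (p | (p | p) | p) hp
        · exact absurd ⟨Sum.inl (Sum.inl p), rfl⟩ hp
        · exact absurd ⟨Sum.inl (Sum.inr p), rfl⟩ hp
        · exact absurd ⟨Sum.inr p, rfl⟩ hp
        · rfl
    simp only [block, Matrix.of_apply, hg, τ, adjoin_elim, sumElim_inj]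
    by_cases hbc : (b = fun _ => false) ∧ (c = fun _ => false)
    · rw [if_pos hbc]
      simp only [adjoin, Matrix.of_apply, hbc.1, hbc.2, and_true]
      have ha : ∀ x : (W ⊕ E) ⊕ Fin D.anc → Bool, (x ∘ Sum.inl) ∘ Sum.inr = x ∘ Sum.inl ∘ Sum.inr :=
        fun _ => rfl
      have hb : ∀ x : (W ⊕ E) ⊕ Fin D.anc → Bool, (x ∘ Sum.inl) ∘ Sum.inl = x ∘ Sum.inl ∘ Sum.inl :=
        fun _ => rfl
      simp only [ha, hb]
      rw [← ite_and]
      exact if_congr (by tauto) rfl rfl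
    · rw [if_neg hbc, if_neg (by tauto)]
      rfl
  have hτ : ∀ (x : W ⊕ ((E ⊕ Fin D.anc) ⊕ Fin 1) → Bool),
      applyAll (D.gates.map (QGate.map g)) τ x x
      = if (x ∘ Sum.inr ∘ Sum.inr = fun _ => false) then
          applyAll D.gates (adjoin (adjoin ρ v) fun _ => false) (x ∘ g) (x ∘ g) else 0 := by
    intro x
    have h1 := block_applyAll g D.gates
      (Sum.elim (fun _ => false) (Sum.elim (fun _ => false) (x ∘ Sum.inr ∘ Sum.inr)))
      (Sum.elim (fun _ => false) (Sum.elim (fun _ => false) (x ∘ Sum.inr ∘ Sum.inr))) τ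
    rw [hblock, applyAll_ite_zero] at h1
    simp only [and_self] at h1
    have h2 := congrFun (congrFun h1 (x ∘ g)) (x ∘ g)
    simp only [block, Matrix.of_apply, ← hx x _ rfl] at h2
    refine h2.trans ?_
    split_ifs <;> rfl
  have hcopy : ∀ (a : W → Bool) (e : E → Bool) (f : Fin D.anc → Bool) (b : Fin 1 → Bool),
      copyFun (fun _ : Fin 1 => g D.out) F (Sum.elim a (Sum.elim (Sum.elim e f) b))
      = Sum.elim a (Sum.elim (Sum.elim e f)
          fun i => xor (b i) (Sum.elim (Sum.elim a e) f D.out)) := by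
    intro a e f b
    symm
    refine (eq_extend_iff _ _ _ _).2 ⟨funext fun p => ?_, ?_⟩
    · change xor (b p) _ = xor (b p) _
      congr 1
      have h' : ∀ o, Sum.elim (Sum.elim a e) f o
          = Sum.elim a (Sum.elim (Sum.elim e f) b) (g o) := by
        rintro ((p | p) | p) <;> rfl
      exact h' _
    · rintro (p | (p | p) | p) hp
      · rfl
      · rfl
      · rfl
      · exact absurd ⟨p, rfl⟩ hp
  have hterm : ∀ (a : W → Bool) (e : E → Bool) (f : Fin D.anc → Bool),
      applyAll (D.gates.map (QGate.map g)) τ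
        (copyFun (fun _ : Fin 1 => g D.out) F
          (Sum.elim a (Sum.elim (Sum.elim e f) fun _ => true)))
        (copyFun (fun _ : Fin 1 => g D.out) F
          (Sum.elim a (Sum.elim (Sum.elim e f) fun _ => true)))
      = if Sum.elim (Sum.elim a e) f D.out then
          applyAll D.gates (adjoin (adjoin ρ v) fun _ => false)
            (Sum.elim (Sum.elim a e) f) (Sum.elim (Sum.elim a e) f) else 0 := by
    intro a e f
    rw [hcopy, hτ]
    have hg : (Sum.elim a (Sum.elim (Sum.elim e f)
        fun _ => xor true (Sum.elim (Sum.elim a e) f D.out))) ∘ g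
        = Sum.elim (Sum.elim a e) f := by
      funext p
      rcases p with (p | p) | p <;> rfl
    rw [hg]
    refine if_congr ⟨fun h => ?_, fun h => funext fun i => ?_⟩ rfl rfl
    · have := congrFun h 0
      simpa using this
    · simp [h]
  have hout : ∀ (w : E ⊕ Fin D.anc → Bool) (b : Fin 1 → Bool),
      Sum.elim w b ∘ (.inr : Fin 1 ↪ (E ⊕ Fin D.anc) ⊕ Fin 1) = b := fun _ _ => rfl
  have hpick : ∀ w : E ⊕ Fin D.anc → Bool, (∑ b : Fin 1 → Bool,
      if Sum.elim w b ∘ (.inr : Fin 1 ↪ (E ⊕ Fin D.anc) ⊕ Fin 1) = (fun _ => true) then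
        condition (applyAll gs (adjoin ρ (Function.extend inp v fun _ => false)))
          (Sum.elim w b) else 0)
      = condition (applyAll gs (adjoin ρ (Function.extend inp v fun _ => false)))
          (Sum.elim w fun _ => true) := by
    intro w
    simp only [hout]
    rw [Finset.sum_ite_eq' Finset.univ fun _ => true]
    simp
  have hcond : ∀ (e : E → Bool) (f : Fin D.anc → Bool),
      (condition (applyAll gs (adjoin ρ (Function.extend inp v fun _ => false)))
        (Sum.elim (Sum.elim e f) fun _ => true)).trace
      = ∑ a, if Sum.elim (Sum.elim a e) f D.out then
          applyAll D.gates (adjoin (adjoin ρ v) fun _ => false)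
            (Sum.elim (Sum.elim a e) f) (Sum.elim (Sum.elim a e) f) else 0 := by
    intro e f
    simp only [Matrix.trace, Matrix.diag_apply, condition, Matrix.of_apply, gs, applyAll_append,
      hinp]
    refine Finset.sum_congr rfl fun a _ => ?_
    rw [applyAll_copyGates]
    exact hterm a e f
  rw [Distinguisher.accept, sum_sumElim, sum_sumElim]
  simp only [sum_sumElim (A := E ⊕ Fin D.anc), hpick]
  rw [sum_sumElim]
  simp only [Matrix.trace_sum, hcond, Complex.re_sum]
  symm
  rw [Finset.sum_comm]
  refine Finset.sum_congr rfl fun e _ => ?_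
  rw [Finset.sum_comm]
  refine Finset.sum_congr rfl fun f _ => Finset.sum_congr rfl fun a _ => ?_
  split_ifs <;> rfl

/-- A kernel with one output bit as a distinguisher: general form of the initial state. -/
theorem Distinguisher.accept_of_implementedBy {F : Type} [Fintype F] [DecidableEq F] {m M : ℕ}
    {k : Kernel W E (Fin 1)} {out : Fin 1 ↪ E ⊕ Fin m} {gs : List (QGate (W ⊕ (E ⊕ Fin m)))}
    (h : ImplementedBy k .inl out gs) (ψ : W ⊕ (E ⊕ Fin m) ≃ F ⊕ Fin M) (v : E → Bool)
    (ρ : State W) (σ : State F)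
    (hσ : ∀ x y, adjoin σ (fun _ : Fin M => false) (x ∘ ψ.symm) (y ∘ ψ.symm)
      = adjoin ρ (Sum.elim v fun _ => false) x y) :
    (⟨M, gs.map (QGate.map ψ.toEmbedding), ψ (Sum.inr (out 0))⟩ : Distinguisher F).accept σ
      = (k v ρ fun _ => true).trace.re := by
  have hext : ∀ (x : W ⊕ (E ⊕ Fin m) → Bool) (c : F ⊕ Fin M → Bool),
      Function.extend ψ.toEmbedding x c = x ∘ ψ.symm := by
    intro x c
    symm
    refine (eq_extend_iff _ _ _ _).2 ⟨?_, fun w hw => absurd ⟨ψ.symm w, by simp⟩ hw⟩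
    funext p; simp
  have hb : block ψ.toEmbedding (fun _ => false) (fun _ => false)
      (adjoin σ fun _ : Fin M => false) = adjoin ρ (Sum.elim v fun _ => false) := by
    ext x y
    simp only [block, Matrix.of_apply, hext]
    exact hσ x y
  have hg : ∀ x : W ⊕ (E ⊕ Fin m) → Bool,
      applyAll (gs.map (QGate.map ψ.toEmbedding)) (adjoin σ fun _ : Fin M => false)
        (x ∘ ψ.symm) (x ∘ ψ.symm) = applyAll gs (adjoin ρ (Sum.elim v fun _ => false)) x x := by
    intro x
    rw [← hb, ← block_applyAll]
    simp only [block, Matrix.of_apply, hext]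
  rw [Distinguisher.accept, ← (Equiv.arrowCongr ψ (Equiv.refl Bool)).sum_comp]
  have ht : ∀ x : W ⊕ (E ⊕ Fin m) → Bool,
      (if (Equiv.arrowCongr ψ (Equiv.refl Bool)) x (ψ (Sum.inr (out 0))) then
        (applyAll (gs.map (QGate.map ψ.toEmbedding)) (adjoin σ fun _ : Fin M => false)
          ((Equiv.arrowCongr ψ (Equiv.refl Bool)) x)
          ((Equiv.arrowCongr ψ (Equiv.refl Bool)) x)).re else 0)
      = if x (Sum.inr (out 0)) then
          (applyAll gs (adjoin ρ (Sum.elim v fun _ => false)) x x).re else 0 := by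
    intro x
    rw [← hg]
    refine if_congr ?_ rfl rfl
    simp
  refine (Finset.sum_congr rfl fun x _ => ht x).trans ?_
  rw [h, extend_inl_false, sum_sumElim, Finset.sum_comm, Matrix.trace_sum, Complex.re_sum]
  refine Finset.sum_congr rfl fun w _ => ?_
  have hw : (w ∘ out = fun _ => true) ↔ w (out 0) = true := by
    rw [funext_iff]
    exact ⟨fun h => h 0, fun h i => by rw [Subsingleton.elim i 0]; exact h⟩
  simp only [hw, Sum.elim_inr]
  by_cases hc : w (out 0) = true
  · simp [hc, Matrix.trace, condition, Complex.re_sum]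
  · simp [hc]

theorem Implements.exists_distinguisher {s : ℕ} {k : Kernel W E (Fin 1)} (h : Implements s k) :
    ∃ D : Distinguisher (W ⊕ E), D.anc + D.gates.length ≤ s ∧
      ∀ v ρ, D.accept (adjoin ρ v) = (k v ρ fun _ => true).trace.re := by
  obtain ⟨m, out, gs, hs, h⟩ := h.normalize
  refine ⟨⟨m, _, _⟩, ?_, fun v ρ => Distinguisher.accept_of_implementedBy h
    (Equiv.sumAssoc W E (Fin m)).symm v ρ (adjoin ρ v) fun x y => ?_⟩
  · simpa using hs
  · have hv : ∀ x : W ⊕ (E ⊕ Fin m) → Bool, x ∘ Sum.inr = (Sum.elim v fun _ => false) ↔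
        (x ∘ Sum.inr ∘ Sum.inl = v ∧ x ∘ Sum.inr ∘ Sum.inr = fun _ => false) := by
      intro x
      rw [← sumElim_inj]
      exact Eq.congr_left (Sum.elim_comp_inl_inr (x ∘ Sum.inr)).symm
    simp only [adjoin, Matrix.of_apply, hv]
    rw [← ite_and]
    have e1 : ∀ x : W ⊕ (E ⊕ Fin m) → Bool, (x ∘ (Equiv.sumAssoc W E (Fin m)).symm.symm) ∘ Sum.inr
      = x ∘ Sum.inr ∘ Sum.inr := fun _ => rfl
    have e2 : ∀ x : W ⊕ (E ⊕ Fin m) → Bool,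
      ((x ∘ (Equiv.sumAssoc W E (Fin m)).symm.symm) ∘ Sum.inl) ∘ Sum.inr
      = x ∘ Sum.inr ∘ Sum.inl := fun _ => rfl
    have e3 : ∀ x : W ⊕ (E ⊕ Fin m) → Bool,
      ((x ∘ (Equiv.sumAssoc W E (Fin m)).symm.symm) ∘ Sum.inl) ∘ Sum.inl
      = x ∘ Sum.inl := fun _ => rfl
    simp only [e1, e2, e3]
    exact if_congr (by tauto) rfl rfl

/-- A kernel with one output bit as a distinguisher for its classical input, with the register
initialised to zero. -/
theorem Implements.exists_classical_distinguisher {s : ℕ} {k : Kernel W E (Fin 1)}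
    (h : Implements s k) :
    ∃ D : Distinguisher E, D.anc + D.gates.length ≤ Fintype.card W + s ∧
      ∀ p : (E → Bool) → ℝ, D.accept (classicalState p) = ∑ v, p v *
        (k v (Matrix.single (fun _ => false) (fun _ => false) 1) fun _ => true).trace.re := by
  obtain ⟨m, out, gs, hs, h⟩ := h.normalize
  let ν : W ⊕ Fin m ≃ Fin (Fintype.card W + m) :=
    (Equiv.sumCongr (Fintype.equivFin W) (Equiv.refl _)).trans finSumFinEquiv
  let ψ : W ⊕ (E ⊕ Fin m) ≃ E ⊕ Fin (Fintype.card W + m) :=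
    ((Equiv.sumAssoc W E (Fin m)).symm.trans
      (Equiv.sumCongr (Equiv.sumComm W E) (Equiv.refl _))).trans
      ((Equiv.sumAssoc E W (Fin m)).trans (Equiv.sumCongr (Equiv.refl _) ν))
  refine ⟨⟨Fintype.card W + m, gs.map (QGate.map ψ.toEmbedding), ψ (Sum.inr (out 0))⟩, ?_,
    fun p => ?_⟩
  · simp only [List.length_map]; omega
  have hp : classicalState p = ∑ v : E → Bool, ((p v : ℝ) : ℂ) • Matrix.single v v (1 : ℂ) := by
    ext x y
    simp only [classicalState, Matrix.diagonal_apply, Matrix.sum_apply, Matrix.smul_apply,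
      Matrix.single_apply, smul_eq_mul, mul_ite, mul_one, mul_zero]
    split_ifs with hxy
    · subst hxy; simp
    · symm
      refine Finset.sum_eq_zero fun v _ => if_neg ?_
      rintro ⟨rfl, rfl⟩
      exact hxy rfl
  rw [hp, Distinguisher.accept_sum]
  refine Finset.sum_congr rfl fun v _ => ?_
  rw [Distinguisher.accept_smul]
  congr 1
  refine Distinguisher.accept_of_implementedBy h ψ v _ _ fun x y => ?_
  have e1 : ∀ x : W ⊕ (E ⊕ Fin m) → Bool, (x ∘ ψ.symm) ∘ Sum.inl = x ∘ Sum.inr ∘ Sum.inl :=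
    fun _ => rfl
  have e2 : ∀ x : W ⊕ (E ⊕ Fin m) → Bool, ((x ∘ ψ.symm) ∘ Sum.inr = fun _ => false) ↔
      (x ∘ Sum.inl = fun _ => false) ∧ (x ∘ Sum.inr ∘ Sum.inr = fun _ => false) := by
    intro x
    have e3 : ∀ i, ((x ∘ ψ.symm) ∘ Sum.inr) (ν i)
        = Sum.elim (x ∘ Sum.inl) (x ∘ Sum.inr ∘ Sum.inr) i := by
      intro i
      have : ψ.symm (Sum.inr (ν i)) = Sum.elim Sum.inl (fun j => Sum.inr (Sum.inr j)) i := by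
        rw [Equiv.symm_apply_eq]
        rcases i with i | i <;> rfl
      simp only [Function.comp_apply, this]
      rcases i with i | i <;> rfl
    rw [← sumElim_inj]
    constructor
    · intro hx
      funext i
      rw [← e3, hx]
      rcases i with i | i <;> rfl
    · intro hx
      funext i
      obtain ⟨j, rfl⟩ := ν.surjective i
      rw [e3, hx]
      rcases j with j | j <;> rfl
  have hv : ∀ x : W ⊕ (E ⊕ Fin m) → Bool, x ∘ Sum.inr = (Sum.elim v fun _ => false) ↔
      (x ∘ Sum.inr ∘ Sum.inl = v ∧ x ∘ Sum.inr ∘ Sum.inr = fun _ => false) := by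
    intro x
    rw [← sumElim_inj]
    exact Eq.congr_left (Sum.elim_comp_inl_inr (x ∘ Sum.inr)).symm
  simp only [adjoin, Matrix.of_apply, e1, e2, hv, Matrix.single_apply]
  rw [← ite_and, ← ite_and]
  refine if_congr ?_ rfl rfl
  simp only [eq_comm (a := v), eq_comm (a := fun _ : W => false)]
  tauto

/-- The preparation of the input of an adversary: on the all-zero register, the output `z` has the
final state `Sampler.init`. The classical part of the input is measured by copying it to the output
wires, and the ancillas of the sampler remain among the work wires. -/
theorem Sampler.exists_kernel {uLen zLen : ℕ → ℕ} (S : Sampler uLen zLen) (κ a : ℕ) :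
    ∃ k : Kernel (Reg (uLen κ) (zLen κ) a) E (Fin (zLen κ)),
      Implements (Fintype.card E + S.anc κ + 2 * zLen κ + (S.gates κ).length) k ∧
      ∀ v z, k v (Matrix.single (fun _ => false) (fun _ => false) 1) z = S.init κ a z := by
  -- the wires: register, classical input, ancillas of the sampler, classical output
  let g : Fin (uLen κ) ⊕ (Fin (zLen κ) ⊕ Fin (S.anc κ)) ↪
      Reg (uLen κ) (zLen κ) a ⊕ (E ⊕ (Fin (S.anc κ) ⊕ Fin (zLen κ))) :=
    ⟨Sum.elim (fun i => Sum.inl (Sum.inl (Sum.inl i)))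
      (Sum.elim (fun i => Sum.inl (Sum.inl (Sum.inr i))) fun i => Sum.inr (Sum.inr (Sum.inl i))), by
      rintro (p | p | p) (q | q | q) h <;> simp at h <;> rw [h]⟩
  let src : Fin (zLen κ) → Reg (uLen κ) (zLen κ) a ⊕ (E ⊕ (Fin (S.anc κ) ⊕ Fin (zLen κ))) :=
    fun i => Sum.inl (Sum.inl (Sum.inr i))
  let out : Fin (zLen κ) ↪ E ⊕ (Fin (S.anc κ) ⊕ Fin (zLen κ)) :=
    (.inr : Fin (zLen κ) ↪ Fin (S.anc κ) ⊕ Fin (zLen κ)).trans .inr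
  let F : Fin (zLen κ) ↪ Reg (uLen κ) (zLen κ) a ⊕ (E ⊕ (Fin (S.anc κ) ⊕ Fin (zLen κ))) :=
    out.trans .inr
  have hne : ∀ p q, src p ≠ F q := fun p q => Sum.inl_ne_inr
  let gs : List (QGate (Reg (uLen κ) (zLen κ) a ⊕ (E ⊕ (Fin (S.anc κ) ⊕ Fin (zLen κ))))) :=
    (S.gates κ).map (QGate.map g) ++ (copyGates src F hne).map .classical
  refine ⟨fun v ρ v' => ∑ w, if w ∘ out = v' then condition (applyAll gs (adjoin ρ
    (Function.extend (.inl : E ↪ (E ⊕ (Fin (S.anc κ) ⊕ Fin (zLen κ)))) v fun _ => false))) w else 0,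
    ⟨_, inferInstance, inferInstance, .inl, out, gs, ?_, fun _ _ _ => rfl⟩, fun v z => ?_⟩
  · simp only [gs, List.length_append, List.length_map, copyGates_length, Fintype.card_sum,
      Fintype.card_fin]
    omega
  set T := applyAll (S.gates κ) (Matrix.single (fun _ => false) (fun _ => false) 1) with hT
  set τ := adjoin (Matrix.single (fun _ => false) (fun _ => false) 1 :
    State (Reg (uLen κ) (zLen κ) a)) (Sum.elim v fun _ => false :
      (E ⊕ (Fin (S.anc κ) ⊕ Fin (zLen κ))) → Bool) with hτd
  have hg : ∀ (p : Fin (uLen κ) ⊕ (Fin (zLen κ) ⊕ Fin (S.anc κ)) → Bool)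
      (r : Reg (uLen κ) (zLen κ) a → Bool) (e : E → Bool) (f : Fin (S.anc κ) → Bool)
      (b : Fin (zLen κ) → Bool),
      Function.extend g p (Sum.elim r (Sum.elim e (Sum.elim f b)))
      = Sum.elim (Sum.elim (Sum.elim (p ∘ Sum.inl) (p ∘ Sum.inr ∘ Sum.inl)) (r ∘ Sum.inr))
        (Sum.elim e (Sum.elim (p ∘ Sum.inr ∘ Sum.inr) b)) := by
    intro p r e f b
    symm
    refine (eq_extend_iff _ _ _ _).2 ⟨?_, ?_⟩
    · funext i
      rcases i with i | i | i <;> rfl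
    · rintro (((i | i) | i) | i | i | i) hi
      · exact absurd ⟨Sum.inl i, rfl⟩ hi
      · exact absurd ⟨Sum.inr (Sum.inl i), rfl⟩ hi
      · rfl
      · rfl
      · exact absurd ⟨Sum.inr (Sum.inr i), rfl⟩ hi
      · rfl
  have hfalse : ∀ {X Y : Type}, (fun _ => false : X ⊕ Y → Bool)
      = Sum.elim (fun _ => false) fun _ => false := by
    intro X Y
    funext i
    rcases i with i | i <;> rfl
  have hτ : ∀ (r s : Reg (uLen κ) (zLen κ) a → Bool) (e : E → Bool) (f : Fin (S.anc κ) → Bool)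
      (b : Fin (zLen κ) → Bool) (c : Fin (zLen κ) → Bool),
      applyAll ((S.gates κ).map (QGate.map g)) τ (Sum.elim r (Sum.elim e (Sum.elim f b)))
        (Sum.elim s (Sum.elim e (Sum.elim f c)))
      = if e = v ∧ (b = fun _ => false) ∧ (c = fun _ => false) ∧
          (r ∘ Sum.inr = fun _ => false) ∧ (s ∘ Sum.inr = fun _ => false) then
          T (Sum.elim (r ∘ Sum.inl ∘ Sum.inl) (Sum.elim (r ∘ Sum.inl ∘ Sum.inr) f))
            (Sum.elim (s ∘ Sum.inl ∘ Sum.inl) (Sum.elim (s ∘ Sum.inl ∘ Sum.inr) f)) else 0 := by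
    intro r s e f b c
    have hb : block g (Sum.elim r (Sum.elim e (Sum.elim f b)))
        (Sum.elim s (Sum.elim e (Sum.elim f c))) τ
        = if e = v ∧ (b = fun _ => false) ∧ (c = fun _ => false) ∧
          (r ∘ Sum.inr = fun _ => false) ∧ (s ∘ Sum.inr = fun _ => false) then
          Matrix.single (fun _ => false) (fun _ => false) 1 else 0 := by
      ext p q
      have h2 : ∀ p : Fin (uLen κ) ⊕ (Fin (zLen κ) ⊕ Fin (S.anc κ)) → Bool,
          (fun _ => false) = p ↔ p ∘ Sum.inl = (fun _ => false) ∧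
            p ∘ Sum.inr ∘ Sum.inl = (fun _ => false) ∧ p ∘ Sum.inr ∘ Sum.inr = fun _ => false := by
        intro p
        constructor
        · rintro rfl; exact ⟨rfl, rfl, rfl⟩
        · rintro ⟨h, h', h''⟩
          funext i
          rcases i with i | i | i
          · exact (congrFun h i).symm
          · exact (congrFun h' i).symm
          · exact (congrFun h'' i).symm
      have h3 : ∀ (p : Fin (uLen κ) ⊕ (Fin (zLen κ) ⊕ Fin (S.anc κ)) → Bool) (r : Fin a → Bool),
          (fun _ => false) = Sum.elim (Sum.elim (p ∘ Sum.inl) (p ∘ Sum.inr ∘ Sum.inl)) r ↔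
          (p ∘ Sum.inl = (fun _ => false) ∧ p ∘ Sum.inr ∘ Sum.inl = (fun _ => false)) ∧
            r = fun _ => false := by
        intro p r
        rw [eq_comm, hfalse, hfalse, sumElim_inj, sumElim_inj]
      have h4 : ∀ (f : Fin (S.anc κ) → Bool) (b : Fin (zLen κ) → Bool),
          Sum.elim f b = (fun _ => false) ↔ f = (fun _ => false) ∧ b = fun _ => false := by
        intro f b
        rw [hfalse, sumElim_inj]
      have h1 := hg p r e f b
      have h1' := hg q s e f c
      simp only [block, Matrix.of_apply, h1, h1', τ, adjoin_elim, sumElim_inj, Matrix.single_apply,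
        h3, h4]
      by_cases hc : e = v ∧ (b = fun _ => false) ∧ (c = fun _ => false) ∧
          (r ∘ Sum.inr = fun _ => false) ∧ (s ∘ Sum.inr = fun _ => false)
      · rw [if_pos hc, Matrix.single_apply, ← ite_and]
        simp only [h2]
        exact if_congr (by tauto) rfl rfl
      · rw [if_neg hc, ← ite_and, if_neg (by tauto)]
        rfl
    have h1 := block_applyAll g (S.gates κ) (Sum.elim r (Sum.elim e (Sum.elim f b)))
        (Sum.elim s (Sum.elim e (Sum.elim f c))) τ
    rw [hb, applyAll_ite_zero] at h1
    have h2 := congrFun (congrFun h1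
      (Sum.elim (r ∘ Sum.inl ∘ Sum.inl) (Sum.elim (r ∘ Sum.inl ∘ Sum.inr) f)))
      (Sum.elim (s ∘ Sum.inl ∘ Sum.inl) (Sum.elim (s ∘ Sum.inl ∘ Sum.inr) f))
    have h5 : ∀ (r : Reg (uLen κ) (zLen κ) a → Bool) (b : Fin (zLen κ) → Bool),
        Function.extend g (Sum.elim (r ∘ Sum.inl ∘ Sum.inl) (Sum.elim (r ∘ Sum.inl ∘ Sum.inr) f))
          (Sum.elim r (Sum.elim e (Sum.elim f b))) = Sum.elim r (Sum.elim e (Sum.elim f b)) := by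
      intro r b
      rw [hg]
      congr 1
      funext i
      rcases i with (i | i) | i <;> rfl
    simp only [block, Matrix.of_apply, h5] at h2
    refine h2.trans ?_
    split_ifs <;> rfl
  have hcopy : ∀ (r : Reg (uLen κ) (zLen κ) a → Bool) (e : E → Bool) (f : Fin (S.anc κ) → Bool)
      (b : Fin (zLen κ) → Bool),
      copyFun src F (Sum.elim r (Sum.elim e (Sum.elim f b)))
      = Sum.elim r (Sum.elim e (Sum.elim f fun i => xor (b i) (r (Sum.inl (Sum.inr i))))) := by
    intro r e f b
    symm
    refine (eq_extend_iff _ _ _ _).2 ⟨rfl, ?_⟩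
    rintro (i | i | i | i) hi
    · rfl
    · rfl
    · rfl
    · exact absurd ⟨i, rfl⟩ hi
  have hxor : ∀ (r : Reg (uLen κ) (zLen κ) a → Bool) (b : Fin (zLen κ) → Bool),
      ((fun i => xor (b i) (r (Sum.inl (Sum.inr i)))) = fun _ => false) ↔
        r ∘ Sum.inl ∘ Sum.inr = b := by
    intro r b
    rw [funext_iff, funext_iff]
    refine forall_congr' fun p => ?_
    simp only [Function.comp_apply]
    cases b p <;> cases r (Sum.inl (Sum.inr p)) <;> simp
  have hinit : adjoin (Matrix.single (fun _ => false) (fun _ => false) 1 :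
      State (Reg (uLen κ) (zLen κ) a)) (Function.extend
        (.inl : E ↪ (E ⊕ (Fin (S.anc κ) ⊕ Fin (zLen κ)))) v fun _ => false) = τ :=
    congrArg (adjoin _) (extend_inl_false v)
  ext x y
  simp only [gs, applyAll_append, hinit]
  have ho : ∀ (e : E → Bool) (f : Fin (S.anc κ) → Bool) (b : Fin (zLen κ) → Bool),
      Sum.elim e (Sum.elim f b) ∘ out = b := fun _ _ _ => rfl
  rw [sum_sumElim, Matrix.sum_apply]
  have hc : ∀ (e : E → Bool) (f : Fin (S.anc κ) → Bool),
      condition (applyAll ((copyGates src F hne).map .classical)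
        (applyAll ((S.gates κ).map (QGate.map g)) τ)) (Sum.elim e (Sum.elim f z)) x y
      = if e = v then (if ((x ∘ Sum.inr = fun _ => false) ∧ (y ∘ Sum.inr = fun _ => false)) ∧
          (x ∘ Sum.inl) ∘ Sum.inr = z ∧ (y ∘ Sum.inl) ∘ Sum.inr = z then
          T (Sum.elim (x ∘ Sum.inl ∘ Sum.inl) (Sum.elim z f))
            (Sum.elim (y ∘ Sum.inl ∘ Sum.inl) (Sum.elim z f)) else 0) else 0 := by
    intro e f
    simp only [condition, Matrix.of_apply]
    rw [applyAll_copyGates, hcopy, hcopy, hτ]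
    simp only [hxor]
    rw [← ite_and]
    by_cases hc : e = v ∧ ((x ∘ Sum.inr = fun _ => false) ∧ (y ∘ Sum.inr = fun _ => false)) ∧
          (x ∘ Sum.inl) ∘ Sum.inr = z ∧ (y ∘ Sum.inl) ∘ Sum.inr = z
    · have hx : x ∘ Sum.inl ∘ Sum.inr = z := hc.2.2.1
      have hy : y ∘ Sum.inl ∘ Sum.inr = z := hc.2.2.2
      rw [if_pos hc, if_pos ⟨hc.1, hx, hy, hc.2.1⟩, hx, hy]
    · rw [if_neg hc, if_neg]
      rintro ⟨h1, h2, h3, h4⟩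
      exact hc ⟨h1, h4, h2, h3⟩
  have hs : ∀ e : E → Bool, (∑ p : Fin (S.anc κ) ⊕ Fin (zLen κ) → Bool,
      if Sum.elim e p ∘ out = z then condition (applyAll ((copyGates src F hne).map .classical)
        (applyAll ((S.gates κ).map (QGate.map g)) τ)) (Sum.elim e p) else 0)
      = ∑ f : Fin (S.anc κ) → Bool, condition (applyAll ((copyGates src F hne).map .classical)
        (applyAll ((S.gates κ).map (QGate.map g)) τ)) (Sum.elim e (Sum.elim f z)) := by
    intro e
    rw [sum_sumElim]
    simp only [ho]
    refine Finset.sum_congr rfl fun f _ => ?_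
    rw [Finset.sum_ite_eq']
    simp
  simp only [hs]
  simp only [Matrix.sum_apply, hc]
  rw [Finset.sum_eq_single v]
  · simp only [if_true, Sampler.init, adjoin, Matrix.of_apply, Sampler.state, Matrix.sum_apply,
      condition, ← hT]
    rw [← ite_and]
    by_cases hc : ((x ∘ Sum.inr = fun _ => false) ∧ (y ∘ Sum.inr = fun _ => false)) ∧
          (x ∘ Sum.inl) ∘ Sum.inr = z ∧ (y ∘ Sum.inl) ∘ Sum.inr = z
    · simp only [if_pos hc]
      rfl
    · simp only [if_neg hc, Finset.sum_const_zero]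
  · intro e _ he
    simp [he]
  · simp

end Conversions

/-! ### Closure properties of classical circuits -/

theorem CGate.act_not {W : Type} [DecidableEq W] (i : W) (x : W → Bool) :
    (CGate.not i).act x i = !x i := Function.update_self ..

theorem CGate.act_cnot {W : Type} [DecidableEq W] {i j : W} (h : i ≠ j) (x : W → Bool) :
    (CGate.cnot i j h).act x j = xor (x j) (x i) := Function.update_self ..

theorem CGate.act_toffoli {W : Type} [DecidableEq W] {i j k : W} (hij : i ≠ j) (hik : i ≠ k)
    (hjk : j ≠ k) (x : W → Bool) :
    (CGate.toffoli i j k hij hik hjk).act x k = xor (x k) (x i && x j) := Function.update_self ..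

section Classical

variable {I J O O' O₁ O₂ : Type} [Fintype I] [DecidableEq I] [Fintype J] [DecidableEq J]
  [Fintype O] [DecidableEq O] [Fintype O₁] [DecidableEq O₁] [Fintype O₂] [DecidableEq O₂]

theorem Computes.mono {I O : Type} {s t : ℕ} {f : (I → Bool) → (O → Bool)} (h : Computes s f)
    (hst : s ≤ t) : Computes t f := by
  obtain ⟨n, inp, out, gs, hs, h⟩ := h
  exact ⟨n, inp, out, gs, hs.trans hst, h⟩

theorem Computes.card_input_le {s : ℕ} {f : (I → Bool) → (O' → Bool)} (h : Computes s f) :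
    Fintype.card I ≤ s := by
  obtain ⟨n, inp, -, gs, hs, -⟩ := h
  have := Fintype.card_le_of_embedding inp
  simp only [Fintype.card_fin] at this
  omega

theorem Computes.card_output_le {I : Type} {s : ℕ} {f : (I → Bool) → (O → Bool)}
    (h : Computes s f) : Fintype.card O ≤ s := by
  obtain ⟨n, -, out, gs, hs, -⟩ := h
  have := Fintype.card_le_of_embedding out
  simp only [Fintype.card_fin] at this
  omega

theorem Computes.comp_output {s : ℕ} {f : (I → Bool) → (O → Bool)} (h : Computes s f)
    (e : O' ↪ O) : Computes s fun x => f x ∘ e := by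
  obtain ⟨n, inp, out, gs, hs, h⟩ := h
  exact ⟨n, inp, e.trans out, gs, hs, fun x o => h x (e o)⟩

/-- The wires of a circuit may be any finite type. -/
theorem computes_of_wires {A : Type} [Fintype A] [DecidableEq A] {f : (I → Bool) → (O' → Bool)}
    (inp : I ↪ A) (out : O' ↪ A) (gs : List (CGate A))
    (h : ∀ x, runClassical gs (Function.extend inp x fun _ => false) ∘ out = f x) :
    Computes (Fintype.card A + gs.length) f := by
  let φ := Fintype.equivFin A
  refine ⟨Fintype.card A, inp.trans φ.toEmbedding, out.trans φ.toEmbedding,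
    gs.map (CGate.map φ.toEmbedding), by simp, fun x o => ?_⟩
  have h1 : Function.extend (inp.trans φ.toEmbedding) x (fun _ => false)
      = Function.extend φ.toEmbedding (Function.extend inp x fun _ => false) fun _ => false := by
    symm
    refine (eq_extend_iff _ _ _ _).2 ⟨funext fun i => ?_, fun w hw => ?_⟩
    · exact (extend_emb_apply φ.toEmbedding _ _ (inp i)).trans (extend_emb_apply inp x _ i)
    · obtain ⟨a, rfl⟩ := φ.surjective w
      refine (extend_emb_apply φ.toEmbedding _ _ a).trans (extend_off inp x _ ?_)
      rintro ⟨i, rfl⟩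
      exact hw ⟨i, rfl⟩
  rw [h1, runClassical_map]
  exact (extend_emb_apply φ.toEmbedding _ _ (out o)).trans (congrFun (h x) o)

/-- Compute `f`, and then `g` from a selection of the inputs and of the outputs of `f`. -/
theorem Computes.seq {s t : ℕ} {f : (I → Bool) → (O₁ → Bool)} {g : (J → Bool) → (O₂ → Bool)}
    (hf : Computes s f) (hg : Computes t g) (sel : J → I ⊕ O₁) :
    Computes (2 * Fintype.card I + Fintype.card J + s + t)
      fun x => Sum.elim (f x) (g (Sum.elim x (f x) ∘ sel)) := by
  obtain ⟨n₁, inp₁, out₁, gs₁, hs₁, h₁⟩ := hf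
  obtain ⟨n₂, inp₂, out₂, gs₂, hs₂, h₂⟩ := hg
  let f₁ : Fin n₁ ↪ I ⊕ (Fin n₁ ⊕ Fin n₂) := Function.Embedding.trans .inl .inr
  let f₂ : Fin n₂ ↪ I ⊕ (Fin n₁ ⊕ Fin n₂) := Function.Embedding.trans .inr .inr
  let src : J → I ⊕ (Fin n₁ ⊕ Fin n₂) := fun p =>
    Sum.elim Sum.inl (fun d => Sum.inr (Sum.inl (out₁ d))) (sel p)
  have hsrc : ∀ p q, src p ≠ (inp₂.trans f₂) q := by
    intro p q
    simp only [src]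
    rcases sel p with e | d <;> simp [f₂]
  have hc₁ : ∀ p q, (Sum.inl p : I ⊕ (Fin n₁ ⊕ Fin n₂)) ≠ (inp₁.trans f₁) q := by
    intro p q; simp [f₁]
  let gs : List (CGate (I ⊕ (Fin n₁ ⊕ Fin n₂))) :=
    copyGates (fun p : I => Sum.inl p) (inp₁.trans f₁) hc₁ ++ (gs₁.map (CGate.map f₁) ++
      (copyGates src (inp₂.trans f₂) hsrc ++ gs₂.map (CGate.map f₂)))
  let out : O₁ ⊕ O₂ ↪ I ⊕ (Fin n₁ ⊕ Fin n₂) :=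
    (Function.Embedding.sumMap out₁ out₂).trans .inr
  refine (computes_of_wires .inl out gs fun x => ?_).mono ?_
  · have e0 : Function.extend (.inl : I ↪ I ⊕ (Fin n₁ ⊕ Fin n₂)) x (fun _ => false)
        = Sum.elim x (Sum.elim (fun _ => false) fun _ => false) := by
      rw [extend_inl_false]
      congr 1
      funext i
      rcases i with i | i <;> rfl
    have e1 : copyFun (fun p : I => Sum.inl p) (inp₁.trans f₁)
        (Sum.elim x (Sum.elim (fun _ => false) fun _ => false))
        = Sum.elim x (Sum.elim (Function.extend inp₁ x fun _ => false) fun _ => false) := by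
      symm
      refine (eq_extend_iff _ _ _ _).2 ⟨funext fun p => ?_, ?_⟩
      · change Function.extend inp₁ x (fun _ => false) (inp₁ p) = Bool.xor false (x p)
        rw [extend_emb_apply, Bool.false_xor]
      · rintro (p | p | p) hp
        · rfl
        · refine extend_off inp₁ x (fun _ => false) (w := p) ?_
          rintro ⟨q, rfl⟩; exact hp ⟨q, rfl⟩
        · rfl
    have e2 : ∀ (a b : Fin n₁ → Bool) (c : Fin n₂ → Bool),
        Function.extend f₁ b (Sum.elim x (Sum.elim a c)) = Sum.elim x (Sum.elim b c) := by
      intro a b c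
      symm
      refine (eq_extend_iff _ _ _ _).2 ⟨rfl, ?_⟩
      rintro (p | p | p) hp
      · rfl
      · exact absurd ⟨p, rfl⟩ hp
      · rfl
    have e2' : ∀ (a : Fin n₁ → Bool) (b c : Fin n₂ → Bool),
        Function.extend f₂ b (Sum.elim x (Sum.elim a c)) = Sum.elim x (Sum.elim a b) := by
      intro a b c
      symm
      refine (eq_extend_iff _ _ _ _).2 ⟨rfl, ?_⟩
      rintro (p | p | p) hp
      · rfl
      · rfl
      · exact absurd ⟨p, rfl⟩ hp
    set y := runClassical gs₁ (Function.extend inp₁ x fun _ => false)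
    have hy : y ∘ out₁ = f x := funext fun o => h₁ x o
    have e3 : copyFun src (inp₂.trans f₂) (Sum.elim x (Sum.elim y fun _ => false))
        = Sum.elim x (Sum.elim y
          (Function.extend inp₂ (Sum.elim x (f x) ∘ sel) fun _ => false)) := by
      symm
      refine (eq_extend_iff _ _ _ _).2 ⟨funext fun p => ?_, ?_⟩
      · change Function.extend inp₂ (Sum.elim x (f x) ∘ sel) (fun _ => false) (inp₂ p)
          = Bool.xor false (Sum.elim x (Sum.elim y fun _ => false) (src p))
        rw [extend_emb_apply, Bool.false_xor, ← hy]
        simp only [src, Function.comp_apply]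
        rcases sel p with q | q <;> rfl
      · rintro (p | p | p) hp
        · rfl
        · rfl
        · refine extend_off inp₂ (Sum.elim x (f x) ∘ sel) (fun _ => false) (w := p) ?_
          rintro ⟨q, rfl⟩; exact hp ⟨q, rfl⟩
    simp only [gs, runClassical_append]
    rw [runClassical_copyGates, runClassical_copyGates, e0, e1,
      ← e2 (fun _ => false) (Function.extend inp₁ x fun _ => false), runClassical_map, e2, e3,
      ← e2' y (Function.extend inp₂ (Sum.elim x (f x) ∘ sel) fun _ => false) fun _ => false,
      runClassical_map, e2']
    funext o
    rcases o with o | o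
    · exact h₁ x o
    · exact h₂ _ o
  · simp only [gs, List.length_append, List.length_map, copyGates_length, Fintype.card_sum,
      Fintype.card_fin]
    omega

theorem Computes.comp {s t : ℕ} {f : (I → Bool) → (O₁ → Bool)} {g : (O₁ → Bool) → (O₂ → Bool)}
    (hg : Computes t g) (hf : Computes s f) :
    Computes (2 * Fintype.card I + Fintype.card O₁ + s + t) fun x => g (f x) := by
  have := (hf.seq hg Sum.inr).comp_output (.inr : O₂ ↪ O₁ ⊕ O₂)
  simpa [Function.comp_def] using this

theorem Computes.pair {s t : ℕ} {f : (I → Bool) → (O₁ → Bool)} {g : (I → Bool) → (O₂ → Bool)}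
    (hf : Computes s f) (hg : Computes t g) :
    Computes (3 * Fintype.card I + s + t) fun x => Sum.elim (f x) (g x) := by
  have := hf.seq hg Sum.inl
  refine Computes.mono this ?_
  omega

theorem computes_select (e : O → I) :
    Computes (Fintype.card I + 2 * Fintype.card O) fun x : I → Bool => x ∘ e := by
  have hne : ∀ p q, (Sum.inl (e p) : I ⊕ O) ≠ (.inr : O ↪ I ⊕ O) q := by
    intro p q; simp
  refine (computes_of_wires .inl .inr (copyGates (fun p => Sum.inl (e p)) .inr hne)
    fun x => ?_).mono ?_
  · rw [runClassical_copyGates, extend_inl_false]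
    funext o
    refine (copyFun_target _ (.inr : O ↪ I ⊕ O) _ o).trans ?_
    simp
  · simp [copyGates_length]; omega

theorem Computes.comp_select {t : ℕ} {g : (J → Bool) → (O → Bool)} (hg : Computes t g)
    (e : J → I) : Computes (3 * Fintype.card I + 3 * Fintype.card J + t) fun x => g (x ∘ e) :=
  (hg.comp (computes_select e)).mono (by omega)

/-- One-bit functions computed by circuits of size at most `s`. -/
abbrev ComputesBit (s : ℕ) (f : (I → Bool) → Bool) : Prop :=
  Computes s fun x (_ : Unit) => f x

theorem Computes.bit {s : ℕ} {f : (I → Bool) → (O → Bool)} (h : Computes s f) (o : O) :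
    ComputesBit s fun x => f x o :=
  h.comp_output ⟨fun _ => o, fun _ _ _ => rfl⟩

theorem computesBit_true : ComputesBit (Fintype.card I + 2) fun _ : I → Bool => true := by
  refine (computes_of_wires (A := I ⊕ Unit) .inl .inr [.not (Sum.inr ())] fun x => ?_).mono ?_
  · rw [extend_inl_false]
    funext o
    exact CGate.act_not (W := I ⊕ Unit) (Sum.inr ()) (Sum.elim x fun _ => false)
  · simp

theorem ComputesBit.not {s : ℕ} {f : (I → Bool) → Bool} (h : ComputesBit s f) :
    ComputesBit (s + 1) fun x => !f x := by
  obtain ⟨n, inp, out, gs, hs, h⟩ := h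
  refine ⟨n, inp, out, gs ++ [.not (out ())], ?_, fun x o => ?_⟩
  · rw [List.length_append]
    exact Nat.add_le_add_right hs 1
  rw [runClassical_append]
  exact (CGate.act_not (out ()) _).trans (congrArg Bool.not (h x ()))

theorem ComputesBit.and {s t : ℕ} {f g : (I → Bool) → Bool} (hf : ComputesBit s f)
    (hg : ComputesBit t g) : ComputesBit (5 * Fintype.card I + s + t + 6) fun x => f x && g x := by
  have h : ComputesBit 4 fun x : Unit ⊕ Unit → Bool => x (Sum.inl ()) && x (Sum.inr ()) := by
    refine computes_of_wires (A := (Unit ⊕ Unit) ⊕ Unit) .inl .inr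
      [.toffoli (Sum.inl (Sum.inl ())) (Sum.inl (Sum.inr ())) (Sum.inr ())
        (by simp) (by simp) (by simp)] fun x => ?_
    rw [extend_inl_false]
    funext o
    exact (CGate.act_toffoli (W := (Unit ⊕ Unit) ⊕ Unit) (i := Sum.inl (Sum.inl ()))
      (j := Sum.inl (Sum.inr ())) (k := Sum.inr ()) (by simp) (by simp) (by simp) _).trans
      (Bool.false_xor _)
  refine (h.comp (hf.pair hg)).mono ?_
  simp only [Fintype.card_sum, Fintype.card_unit]
  omega

theorem ComputesBit.xor {s t : ℕ} {f g : (I → Bool) → Bool} (hf : ComputesBit s f)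
    (hg : ComputesBit t g) :
    ComputesBit (5 * Fintype.card I + s + t + 6) fun x => Bool.xor (f x) (g x) := by
  have h : ComputesBit 4 fun x : Unit ⊕ Unit → Bool =>
      Bool.xor (x (Sum.inl ())) (x (Sum.inr ())) := by
    refine (computes_of_wires (A := Unit ⊕ Unit) (.refl _)
      ⟨fun _ => Sum.inr (), fun _ _ _ => rfl⟩
      [.cnot (Sum.inl ()) (Sum.inr ()) (by simp)] fun x => ?_).mono (by simp)
    have hx : Function.extend (Function.Embedding.refl (Unit ⊕ Unit)) x (fun _ => false) = x :=
      funext fun i => extend_emb_apply (Function.Embedding.refl (Unit ⊕ Unit)) x _ i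
    rw [hx]
    funext o
    exact (CGate.act_cnot (i := Sum.inl ()) (j := Sum.inr ()) (by simp) x).trans (Bool.xor_comm _ _)
  refine (h.comp (hf.pair hg)).mono ?_
  simp only [Fintype.card_sum, Fintype.card_unit]
  omega

theorem computes_of_bits_fin {s : ℕ} (n : ℕ) {f : (I → Bool) → (Fin n → Bool)}
    (h : ∀ o, ComputesBit s fun x => f x o) :
    Computes (Fintype.card I + n * (3 * Fintype.card I + s)) f := by
  induction n with
  | zero =>
    refine (computes_of_wires (A := I) (.refl I) Function.Embedding.ofIsEmpty []
      fun x => Subsingleton.elim _ _).mono (by simp)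
  | succ n ih =>
    have h1 := ih (f := fun x o => f x o.castSucc) fun o => h o.castSucc
    let e : Fin (n + 1) ↪ Fin n ⊕ Unit :=
      ⟨Fin.lastCases (Sum.inr ()) Sum.inl, by
        intro i j
        refine Fin.lastCases ?_ (fun i => ?_) i <;> refine Fin.lastCases ?_ (fun j => ?_) j <;>
          simp⟩
    have h2 := (h1.pair (h (Fin.last n))).comp_output e
    have h3 : (fun x => Sum.elim (fun o : Fin n => f x o.castSucc)
        (fun _ : Unit => f x (Fin.last n)) ∘ e) = f := by
      have he : e (Fin.last n) = Sum.inr () :=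
        Fin.lastCases_last (motive := fun _ => Fin n ⊕ Unit)
      have he' : ∀ i : Fin n, e i.castSucc = Sum.inl i := fun i =>
        Fin.lastCases_castSucc (motive := fun _ => Fin n ⊕ Unit) i
      funext x i
      refine Fin.lastCases ?_ (fun i => ?_) i
      · simp only [Function.comp_apply, he, Sum.elim_inr]
      · simp only [Function.comp_apply, he', Sum.elim_inl]
    rw [h3] at h2
    refine h2.mono ?_
    have : (n + 1) * (3 * Fintype.card I + s) = n * (3 * Fintype.card I + s)
      + (3 * Fintype.card I + s) := by ring
    omega

theorem computes_of_bits {s : ℕ} {f : (I → Bool) → (O → Bool)}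
    (h : ∀ o, ComputesBit s fun x => f x o) :
    Computes (Fintype.card I + Fintype.card O * (3 * Fintype.card I + s)) f := by
  let e := Fintype.equivFin O
  have h1 := computes_of_bits_fin (Fintype.card O) (f := fun x i => f x (e.symm i))
    fun i => h (e.symm i)
  have h2 := h1.comp_output e.toEmbedding
  have h3 : (fun x => (fun i => f x (e.symm i)) ∘ e.toEmbedding) = f := by
    funext x o
    simp
  rwa [h3] at h2

theorem computesBit_forall_fin {s : ℕ} (n : ℕ) {f : (I → Bool) → (Fin n → Bool)}
    (h : ∀ o, ComputesBit s fun x => f x o) :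
    ComputesBit (Fintype.card I + 2 + n * (5 * Fintype.card I + s + 6))
      fun x => decide (∀ o, f x o = true) := by
  induction n with
  | zero => simpa using computesBit_true (I := I)
  | succ n ih =>
    have h1 := (ih (f := fun x o => f x o.castSucc) fun o => h o.castSucc).and (h (Fin.last n))
    have h3 : (fun x => (decide (∀ o : Fin n, f x o.castSucc = true)) && f x (Fin.last n))
        = fun x => decide (∀ o, f x o = true) := by
      funext x
      rw [Bool.eq_iff_iff]
      simp [Fin.forall_fin_succ', and_comm]
    rw [h3] at h1
    refine h1.mono ?_
    have : (n + 1) * (5 * Fintype.card I + s + 6) = n * (5 * Fintype.card I + s + 6)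
      + (5 * Fintype.card I + s + 6) := by ring
    omega

theorem computesBit_eq {s n : ℕ} {f g : (I → Bool) → (Fin n → Bool)} (hf : Computes s f)
    (hg : Computes s g) :
    ComputesBit (Fintype.card I + 2 + n * (10 * Fintype.card I + 2 * s + 13))
      fun x => decide (f x = g x) := by
  have h := computesBit_forall_fin n (f := fun x o => !Bool.xor (f x o) (g x o))
    fun o => ((hf.bit o).xor (hg.bit o)).not
  have h3 : (fun x => decide (∀ o, (!Bool.xor (f x o) (g x o)) = true))
      = fun x => decide (f x = g x) := by
    funext x
    rw [Bool.eq_iff_iff]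
    simp [funext_iff]
  rw [h3] at h
  refine h.mono ?_
  have : n * (5 * Fintype.card I + (5 * Fintype.card I + s + s + 6 + 1) + 6)
    = n * (10 * Fintype.card I + 2 * s + 13) := by ring
  omega

end Classical

/-! ### Polynomial bounds -/

theorem PolyBounded.of_le {f g : ℕ → ℕ} (hg : PolyBounded g) (h : ∀ κ, f κ ≤ g κ) :
    PolyBounded f := by
  obtain ⟨p, hp⟩ := hg
  exact ⟨p, fun κ => (h κ).trans (hp κ)⟩

theorem polyBounded_const (c : ℕ) : PolyBounded fun _ => c :=
  ⟨Polynomial.C c, fun κ => by simp⟩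

theorem polyBounded_id : PolyBounded fun κ => κ :=
  ⟨Polynomial.X, fun κ => by simp⟩

theorem polyBounded_eval (p : Polynomial ℕ) : PolyBounded fun κ => p.eval κ :=
  ⟨p, fun _ => le_rfl⟩

theorem PolyBounded.add {f g : ℕ → ℕ} (hf : PolyBounded f) (hg : PolyBounded g) :
    PolyBounded fun κ => f κ + g κ := by
  obtain ⟨p, hp⟩ := hf
  obtain ⟨q, hq⟩ := hg
  exact ⟨p + q, fun κ => by simpa using Nat.add_le_add (hp κ) (hq κ)⟩

theorem PolyBounded.mul {f g : ℕ → ℕ} (hf : PolyBounded f) (hg : PolyBounded g) :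
    PolyBounded fun κ => f κ * g κ := by
  obtain ⟨p, hp⟩ := hf
  obtain ⟨q, hq⟩ := hg
  exact ⟨p * q, fun κ => by simpa using Nat.mul_le_mul (hp κ) (hq κ)⟩

/-! ### Families of classical circuits of polynomial size -/

/-- Families of functions with classical circuits of polynomial size. -/
def PolyComputes {I O : ℕ → Type} (f : ∀ κ, (I κ → Bool) → (O κ → Bool)) : Prop :=
  ∃ s, PolyBounded s ∧ ∀ κ, Computes (s κ) (f κ)

/-- Families of one-bit functions with classical circuits of polynomial size. -/
abbrev PolyBit {I : ℕ → Type} (f : ∀ κ, (I κ → Bool) → Bool) : Prop :=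
  PolyComputes fun κ x (_ : Unit) => f κ x

section PolyComputes

variable {I J O O₁ O₂ : ℕ → Type} [∀ κ, Fintype (I κ)] [∀ κ, DecidableEq (I κ)]
  [∀ κ, Fintype (J κ)] [∀ κ, DecidableEq (J κ)] [∀ κ, Fintype (O κ)] [∀ κ, DecidableEq (O κ)]
  [∀ κ, Fintype (O₁ κ)] [∀ κ, DecidableEq (O₁ κ)] [∀ κ, Fintype (O₂ κ)] [∀ κ, DecidableEq (O₂ κ)]

theorem PolyComputes.card_input {f : ∀ κ, (I κ → Bool) → (O κ → Bool)} (h : PolyComputes f) :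
    PolyBounded fun κ => Fintype.card (I κ) := by
  obtain ⟨s, hs, h⟩ := h
  exact hs.of_le fun κ => (h κ).card_input_le

theorem PolyComputes.card_output {f : ∀ κ, (I κ → Bool) → (O κ → Bool)} (h : PolyComputes f) :
    PolyBounded fun κ => Fintype.card (O κ) := by
  obtain ⟨s, hs, h⟩ := h
  exact hs.of_le fun κ => (h κ).card_output_le

theorem PolyComputes.comp {f : ∀ κ, (I κ → Bool) → (O₁ κ → Bool)}
    {g : ∀ κ, (O₁ κ → Bool) → (O₂ κ → Bool)} (hg : PolyComputes g) (hf : PolyComputes f) :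
    PolyComputes fun κ x => g κ (f κ x) := by
  have h1 := hf.card_input
  have h2 := hg.card_input
  obtain ⟨s, hs, hf⟩ := hf
  obtain ⟨t, ht, hg⟩ := hg
  exact ⟨_, ((((polyBounded_const 2).mul h1).add h2).add hs).add ht, fun κ => (hg κ).comp (hf κ)⟩

theorem PolyComputes.pair {f : ∀ κ, (I κ → Bool) → (O₁ κ → Bool)}
    {g : ∀ κ, (I κ → Bool) → (O₂ κ → Bool)} (hf : PolyComputes f) (hg : PolyComputes g) :
    PolyComputes fun κ x => Sum.elim (f κ x) (g κ x) := by
  have h1 := hf.card_input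
  obtain ⟨s, hs, hf⟩ := hf
  obtain ⟨t, ht, hg⟩ := hg
  exact ⟨_, (((polyBounded_const 3).mul h1).add hs).add ht, fun κ => (hf κ).pair (hg κ)⟩

theorem polyComputes_select (hI : PolyBounded fun κ => Fintype.card (I κ))
    (hO : PolyBounded fun κ => Fintype.card (O κ)) (e : ∀ κ, O κ → I κ) :
    PolyComputes fun κ (x : I κ → Bool) => x ∘ e κ :=
  ⟨_, hI.add ((polyBounded_const 2).mul hO), fun κ => computes_select (e κ)⟩

theorem PolyComputes.comp_select {g : ∀ κ, (J κ → Bool) → (O κ → Bool)} (hg : PolyComputes g)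
    (hI : PolyBounded fun κ => Fintype.card (I κ)) (e : ∀ κ, J κ → I κ) :
    PolyComputes fun κ (x : I κ → Bool) => g κ (x ∘ e κ) :=
  hg.comp (polyComputes_select hI hg.card_input e)

theorem polyComputes_of_bits {s : ℕ → ℕ} (hs : PolyBounded s)
    (hI : PolyBounded fun κ => Fintype.card (I κ)) (hO : PolyBounded fun κ => Fintype.card (O κ))
    {f : ∀ κ, (I κ → Bool) → (O κ → Bool)} (h : ∀ κ o, ComputesBit (s κ) fun x => f κ x o) :
    PolyComputes f :=
  ⟨_, hI.add (hO.mul (((polyBounded_const 3).mul hI).add hs)), fun κ => computes_of_bits (h κ)⟩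

theorem PolyBit.and {f g : ∀ κ, (I κ → Bool) → Bool} (hf : PolyBit f) (hg : PolyBit g) :
    PolyBit fun κ x => f κ x && g κ x := by
  have h1 := hf.card_input
  obtain ⟨s, hs, hf⟩ := hf
  obtain ⟨t, ht, hg⟩ := hg
  exact ⟨_, ((((polyBounded_const 5).mul h1).add hs).add ht).add (polyBounded_const 6),
    fun κ => ComputesBit.and (hf κ) (hg κ)⟩

theorem PolyBit.mask {b : ∀ κ, (I κ → Bool) → Bool} {f : ∀ κ, (I κ → Bool) → (O κ → Bool)}
    (hb : PolyBit b) (hf : PolyComputes f) :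
    PolyComputes fun κ x o => b κ x && f κ x o := by
  have h1 := hf.card_input
  have h2 := hf.card_output
  obtain ⟨s, hs, hf⟩ := hf
  obtain ⟨t, ht, hb⟩ := hb
  exact polyComputes_of_bits
    (((((polyBounded_const 5).mul h1).add ht).add hs).add (polyBounded_const 6)) h1 h2
    fun κ o => ComputesBit.and (hb κ) ((hf κ).bit o)

theorem PolyComputes.xor {f g : ∀ κ, (I κ → Bool) → (O κ → Bool)}
    (hf : PolyComputes f) (hg : PolyComputes g) :
    PolyComputes fun κ x o => Bool.xor (f κ x o) (g κ x o) := by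
  have h1 := hf.card_input
  have h2 := hf.card_output
  obtain ⟨s, hs, hf⟩ := hf
  obtain ⟨t, ht, hg⟩ := hg
  exact polyComputes_of_bits
    (((((polyBounded_const 5).mul h1).add hs).add ht).add (polyBounded_const 6)) h1 h2
    fun κ o => ((hf κ).bit o).xor ((hg κ).bit o)

theorem PolyComputes.eq_bit {n : ℕ → ℕ} {f g : ∀ κ, (I κ → Bool) → (Fin (n κ) → Bool)}
    (hf : PolyComputes f) (hg : PolyComputes g) :
    PolyBit fun κ x => decide (f κ x = g κ x) := by
  have h1 := hf.card_input
  have h2 := hf.card_output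
  simp only [Fintype.card_fin] at h2
  obtain ⟨s, hs, hf⟩ := hf
  obtain ⟨t, ht, hg⟩ := hg
  exact ⟨_, (h1.add (polyBounded_const 2)).add (h2.mul ((((polyBounded_const 10).mul h1).add
    ((polyBounded_const 2).mul (hs.add ht))).add (polyBounded_const 13))),
    fun κ => computesBit_eq ((hf κ).mono (Nat.le_add_right _ _))
      ((hg κ).mono (Nat.le_add_left _ _))⟩

/-- A validity bit followed by a string. -/
theorem PolyBit.cons {n : ℕ → ℕ} {b : ∀ κ, (I κ → Bool) → Bool}
    {f : ∀ κ, (I κ → Bool) → (Fin (n κ) → Bool)} (hb : PolyBit b) (hf : PolyComputes f) :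
    PolyComputes fun κ x => (Fin.cons (b κ x) (f κ x) : Fin (n κ + 1) → Bool) := by
  have h1 := hf.card_input
  have h2 := hf.card_output
  obtain ⟨s, hs, hf⟩ := hf
  obtain ⟨t, ht, hb⟩ := hb
  refine polyComputes_of_bits (hs.add ht) h1 ?_ fun κ o => ?_
  · simpa using h2.add (polyBounded_const 1)
  · refine Fin.cases ?_ (fun i => ?_) o
    · exact (hb κ).mono (Nat.le_add_left _ _)
    · exact ((hf κ).bit i).mono (Nat.le_add_right _ _)

end PolyComputes

/-! ### Families of kernels of polynomial size -/

/-- Families of kernels that are implemented by circuits of polynomial size. -/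
def PolyImplements {W E E' : ℕ → Type} [∀ κ, Fintype (W κ)] [∀ κ, DecidableEq (W κ)]
    [∀ κ, Fintype (E' κ)] (k : ∀ κ, Kernel (W κ) (E κ) (E' κ)) : Prop :=
  ∃ s, PolyBounded s ∧ ∀ κ, Implements (s κ) (k κ)

section PolyImplements

variable {W E E' E₁ E₂ E₃ : ℕ → Type} [∀ κ, Fintype (W κ)] [∀ κ, DecidableEq (W κ)]
  [∀ κ, Fintype (E κ)] [∀ κ, DecidableEq (E κ)] [∀ κ, Fintype (E' κ)] [∀ κ, DecidableEq (E' κ)]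
  [∀ κ, Fintype (E₁ κ)] [∀ κ, DecidableEq (E₁ κ)] [∀ κ, Fintype (E₂ κ)] [∀ κ, DecidableEq (E₂ κ)]
  [∀ κ, Fintype (E₃ κ)] [∀ κ, DecidableEq (E₃ κ)]

theorem PolyImplements.card_input {k : ∀ κ, Kernel (W κ) (E κ) (E' κ)} (h : PolyImplements k) :
    PolyBounded fun κ => Fintype.card (E κ) := by
  obtain ⟨s, hs, h⟩ := h
  exact hs.of_le fun κ => (h κ).card_input_le

theorem PolyImplements.bind {k : ∀ κ, Kernel (W κ) (E κ) (E₁ κ)}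
    {G : ∀ κ, Kernel (W κ) (E₃ κ) (E₂ κ)} (hk : PolyImplements k) (hG : PolyImplements G)
    (sel : ∀ κ, E₃ κ → E κ ⊕ E₁ κ) :
    PolyImplements fun κ v ρ w => ∑ d, G κ (Sum.elim v d ∘ sel κ) (k κ v ρ d) w := by
  obtain ⟨s, hs, hk⟩ := hk
  obtain ⟨t, ht, hG⟩ := hG
  exact ⟨_, (polyBounded_const 3).mul (hs.add ht), fun κ => (hk κ).bind (hG κ) (sel κ)⟩

theorem PolyComputes.polyImplements {f : ∀ κ, (E κ → Bool) → (E' κ → Bool)} (hf : PolyComputes f) :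
    PolyImplements fun κ => (pureKernel (f κ) : Kernel (W κ) (E κ) (E' κ)) := by
  obtain ⟨s, hs, hf⟩ := hf
  exact ⟨s, hs, fun κ => implements_pure (hf κ)⟩

/-- A classical computation, followed by a circuit. -/
theorem PolyImplements.precomp {G : ∀ κ, Kernel (W κ) (E₁ κ) (E₂ κ)} (hG : PolyImplements G)
    {f : ∀ κ, (E κ → Bool) → (E₁ κ → Bool)} (hf : PolyComputes f) :
    PolyImplements fun κ v ρ w => G κ (f κ v) ρ w := by
  have h := (hf.polyImplements (W := W)).bind hG fun _ => Sum.inr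
  obtain ⟨s, -, hs⟩ := hG
  convert h using 5 with κ v ρ w
  rw [Finset.sum_eq_single (f κ v)]
  · simp [pureKernel]
  · intro d _ hd
    simp only [pureKernel, if_neg hd]
    exact (hs κ).map_zero _ _
  · simp

theorem PolyImplements.gates {G : ∀ κ, Kernel (W κ) (E κ) (E₂ κ)} (hG : PolyImplements G)
    (gs : ∀ κ, List (QGate (W κ))) (hgs : PolyBounded fun κ => (gs κ).length) :
    PolyImplements fun κ v ρ w => G κ v (applyAll (gs κ) ρ) w := by
  have h0 : PolyImplements fun κ => (fun _ ρ _ => applyAll (gs κ) ρ : Kernel (W κ) (E κ) (Fin 0)) :=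
    ⟨_, hG.card_input.add hgs, fun κ => implements_applyAll (gs κ)⟩
  convert h0.bind hG fun _ => Sum.inl using 5 with κ v ρ w
  rw [Fintype.sum_unique]
  rfl

/-- A measurement, followed by a circuit that obtains the result. -/
theorem PolyImplements.measure {m : ℕ → ℕ} {G : ∀ κ, Kernel (W κ) (E κ ⊕ Fin (m κ)) (E₂ κ)}
    (hG : PolyImplements G) (port : ∀ κ, Fin (m κ) ↪ W κ) :
    PolyImplements fun κ v ρ w =>
      ∑ u : Bits (m κ), G κ (Sum.elim v u) (project (port κ) u ρ) w := by
  have hE := hG.card_input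
  have h0 : PolyImplements fun κ =>
      (fun _ ρ u => project (port κ) u ρ : Kernel (W κ) (E κ) (Fin (m κ))) :=
    ⟨fun κ => 2 * Fintype.card (E κ ⊕ Fin (m κ)), (polyBounded_const 2).mul hE,
      fun κ => (implements_project (port κ)).mono (by
        simp only [Fintype.card_sum, Fintype.card_fin]; omega)⟩
  exact h0.bind hG fun _ => id

/-- Random bits, followed by a circuit that obtains them. -/
theorem PolyImplements.random {m : ℕ → ℕ} {G : ∀ κ, Kernel (W κ) (E κ ⊕ Fin (m κ)) (E₂ κ)}
    (hG : PolyImplements G) :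
    PolyImplements fun κ v ρ w =>
      ((2 : ℂ) ^ m κ)⁻¹ • ∑ u : Bits (m κ), G κ (Sum.elim v u) ρ w := by
  have hE := hG.card_input
  have h0 : PolyImplements fun κ =>
      (fun _ ρ _ => ((2 : ℂ) ^ m κ)⁻¹ • ρ : Kernel (W κ) (E κ) (Fin (m κ))) :=
    ⟨fun κ => 2 * Fintype.card (E κ ⊕ Fin (m κ)), (polyBounded_const 2).mul hE,
      fun κ => (implements_random (m κ)).mono (by
        simp only [Fintype.card_sum, Fintype.card_fin]; omega)⟩
  have h := h0.bind hG fun _ => id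
  obtain ⟨s, -, hs⟩ := hG
  convert h using 5 with κ v ρ w
  rw [Finset.smul_sum]
  exact Finset.sum_congr rfl fun u _ => ((hs κ).map_smul _ _ _ _).symm

/-- Writing a computed string on wires of the register, followed by a circuit. -/
theorem PolyImplements.write {m : ℕ → ℕ} {G : ∀ κ, Kernel (W κ) (E κ) (E₂ κ)}
    (hG : PolyImplements G) (port : ∀ κ, Fin (m κ) ↪ W κ)
    {f : ∀ κ, (E κ → Bool) → Bits (m κ)} (hf : PolyComputes f) :
    PolyImplements fun κ v ρ w => G κ v (write (port κ) (f κ v) ρ) w := by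
  have hE := hG.card_input
  have hm := hf.card_output
  have h0 : PolyImplements fun κ =>
      (fun v ρ _ => CoinFlip.write (port κ) (v ∘ Sum.inr) ρ :
        Kernel (W κ) (E κ ⊕ Fin (m κ)) (Fin 0)) :=
    ⟨_, hE.add ((polyBounded_const 6).mul hm), fun κ => (implements_write (port κ) Sum.inr).mono (by
        simp only [Fintype.card_sum, Fintype.card_fin]; omega)⟩
  have h1 := h0.bind hG fun _ e => Sum.inl (Sum.inl e)
  have hid : PolyComputes fun κ (v : E κ → Bool) => v := polyComputes_select hE hE fun _ => id
  have h2 := h1.precomp (hid.pair hf)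
  convert h2 using 5 with κ v ρ w
  rw [Fintype.sum_unique]
  rfl

/-- The final state of a quantum strategy in the place of Alice with two moves, weighted with the
probability of her messages `A` and `op`, when the answer to the first one is `m`, and the answer to
the second one is empty. -/
def QAlice.twoMoves {W : Type} [Fintype W] [DecidableEq W] {nA nB nO : ℕ}
    (s : QAlice W [(nA, nB), (nO, 0)]) (A : Bits nA) (m : Bits nB) (op : Bits nO) (ρ : State W) :
    State W :=
  applyAll s.2.2 (CoinFlip.write s.2.1.inp Fin.elim0 (project s.2.1.out op
    (applyAll s.2.1.gates (CoinFlip.write s.1.inp m (project s.1.out A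
      (applyAll s.1.gates ρ))))))

/-- The run of such a strategy where the answer and the classical output are functions of the
classical input and of the messages. -/
def interaction {W E E' : Type} [Fintype W] [DecidableEq W] [Fintype E'] [DecidableEq E']
    {nA nB nO : ℕ} (s : QAlice W [(nA, nB), (nO, 0)]) (msg : (E → Bool) → Bits nA → Bits nB)
    (fin : (E → Bool) → Bits nA → Bits nO → (E' → Bool)) : Kernel W E E' :=
  fun v ρ w => ∑ A : Bits nA, ∑ op : Bits nO,
    if w = fin v A op then QAlice.twoMoves s A (msg v A) op ρ else 0

theorem polyImplements_interaction {nA nB nO : ℕ → ℕ}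
    (s : ∀ κ, QAlice (W κ) [(nA κ, nB κ), (nO κ, 0)])
    (hs : PolyBounded fun κ => QAlice.gateCount _ (s κ))
    {msg : ∀ κ, (E κ → Bool) → Bits (nA κ) → Bits (nB κ)}
    {fin : ∀ κ, (E κ → Bool) → Bits (nA κ) → Bits (nO κ) → (E' κ → Bool)}
    (hmsg : PolyComputes fun κ (v : E κ ⊕ Fin (nA κ) → Bool) =>
      msg κ (v ∘ Sum.inl) (v ∘ Sum.inr))
    (hfin : PolyComputes fun κ (v : (E κ ⊕ Fin (nA κ)) ⊕ Fin (nO κ) → Bool) =>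
      fin κ (v ∘ Sum.inl ∘ Sum.inl) (v ∘ Sum.inl ∘ Sum.inr) (v ∘ Sum.inr)) :
    PolyImplements fun κ => interaction (s κ) (msg κ) (fin κ) := by
  have hE := hfin.card_input
  have hcount : ∀ κ, (s κ).1.gates.length + ((s κ).2.1.gates.length + (s κ).2.2.length)
    = QAlice.gateCount _ (s κ) := fun κ => rfl
  have h0 := (hfin.polyImplements (W := W)).gates (fun κ => (s κ).2.2)
    (hs.of_le fun κ => by have := hcount κ; omega)
  have h1 := h0.write (m := fun _ => 0) (fun κ => (s κ).2.1.inp) (f := fun κ _ => Fin.elim0) (by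
    convert polyComputes_select hE (O := fun _ => Fin 0) (polyBounded_const 0)
      (fun κ => Fin.elim0) using 3)
  have h2 := (h1.measure fun κ => (s κ).2.1.out).gates (fun κ => (s κ).2.1.gates)
    (hs.of_le fun κ => by have := hcount κ; omega)
  have h3 := ((h2.write (fun κ => (s κ).1.inp) hmsg).measure fun κ => (s κ).1.out).gates
    (fun κ => (s κ).1.gates) (hs.of_le fun κ => by have := hcount κ; omega)
  exact h3

end PolyImplements

/-! ### Bit strings -/

theorem decOpt_encOpt {n : ℕ} (o : Option (Bits n)) : decOpt (encOpt o) = o := by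
  cases o with
  | none => rfl
  | some c => rfl

theorem encOpt_decOpt_zero {n : ℕ} (o : Option (Bits n)) : encOpt o 0 = o.isSome := by
  cases o <;> rfl

theorem append_left_right {m n : ℕ} (t : Bits (m + n)) : Fin.append (left t) (right t) = t :=
  Fin.append_castAdd_natAdd

theorem left_append {m n : ℕ} (u : Bits m) (w : Bits n) :
    left (Fin.append u w : Bits (m + n)) = u :=
  funext fun i => Fin.append_left u w i

theorem right_append {m n : ℕ} (u : Bits m) (w : Bits n) :
    right (Fin.append u w : Bits (m + n)) = w :=
  funext fun i => Fin.append_right u w i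

theorem sum_left_right {M : Type*} [AddCommMonoid M] {m n : ℕ} (F : Bits m → Bits n → M) :
    ∑ t : Bits (m + n), F (left t) (right t) = ∑ u, ∑ w, F u w := by
  rw [← Fintype.sum_prod_type']
  refine Fintype.sum_equiv ⟨fun t => (left t, right t), fun p => Fin.append p.1 p.2,
    fun t => append_left_right t, fun p => ?_⟩ _ _ fun t => rfl
  simp only [left_append, right_append]

theorem bxor_bxor {n : ℕ} (a b : Bits n) : bxor a (bxor a b) = b := by
  funext i
  simp [bxor]

theorem bxor_comm {n : ℕ} (a b : Bits n) : bxor a b = bxor b a := by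
  funext i
  simp [bxor, Bool.xor_comm]

theorem bxor_eq_iff {n : ℕ} (a b c : Bits n) : bxor a b = c ↔ b = bxor a c := by
  constructor
  · rintro rfl
    rw [bxor_bxor]
  · rintro rfl
    rw [bxor_bxor]

/-- Translations are bijections. -/
theorem sum_bxor {M : Type*} [AddCommMonoid M] {n : ℕ} (a : Bits n) (F : Bits n → M) :
    ∑ b, F (bxor a b) = ∑ b, F b :=
  Fintype.sum_equiv ⟨bxor a, bxor a, bxor_bxor a, bxor_bxor a⟩ _ _ fun _ => rfl

/-! ### The honest players are efficient -/

theorem Computes.of_eq {I O : Type} {s t : ℕ} {f g : (I → Bool) → (O → Bool)} (h : Computes s f)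
    (hst : s ≤ t) (hfg : ∀ x, g x = f x) : Computes t g := by
  rw [funext hfg]
  exact h.mono hst

/-- Compute `F` from the output of `g` and from further bits, where the inputs of `g` and the
further bits are selected among the inputs `I'`. The size bound is crude, but does not mention `K`, `O₁` and
`O₂`. -/
theorem Computes.comp_pair_select {I I' K O₁ O₂ : Type} [Fintype I] [DecidableEq I] [Fintype I']
    [DecidableEq I'] [Fintype K] [DecidableEq K] [Fintype O₁] [DecidableEq O₁] [Fintype O₂]
    [DecidableEq O₂] {s t : ℕ} {g : (I → Bool) → (O₁ → Bool)} {F : (O₁ ⊕ K → Bool) → (O₂ → Bool)}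
    (hF : Computes t F) (hg : Computes s g) (eI : I → I') (eK : K → I') :
    Computes (9 * Fintype.card I' + 5 * s + 4 * t)
      fun x => F (Sum.elim (g (x ∘ eI)) (x ∘ eK)) := by
  have h1 := hg.card_input_le
  have h2 := hF.card_input_le
  rw [Fintype.card_sum] at h2
  refine (hF.comp ((hg.comp_select eI).pair (computes_select eK))).mono ?_
  rw [Fintype.card_sum]
  have h3 := hg.card_output_le
  omega

/-- The size of a composed strategy. The coins of the first strategy `f` and of the continuation `k`
are selected by `eI` and `eJ` among the wires `I'`, which gain the messages received so far. At the
end of `f`, the continuation depends on the output of `f`, which has a circuit of size `s` by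
assumption, so that `base` concerns the continuation of a computed value `g`. -/
theorem AliceStrat.sizeLE_bind {L L' s t extra : ℕ} {rs' : List (ℕ × ℕ)} {J : Type}
    (k : Option (Bits L) → (J → Bool) → AliceStrat (Option (Bits L')) rs')
    (ht : 7 * s + 3 * extra ≤ t)
    (base : ∀ (I I' : Type) [Fintype I] [DecidableEq I] [Fintype I'] [DecidableEq I']
      (g : (I → Bool) → Option (Bits L)) (eI : I → I') (eJ : J → I'),
      Computes s (fun x => encOpt (g x)) → Fintype.card I' ≤ s + extra →
      AliceStrat.SizeLE L' t rs' I' fun x => k (g (x ∘ eI)) (x ∘ eJ)) :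
    ∀ (rs : List (ℕ × ℕ)) (I I' : Type) [Fintype I] [DecidableEq I] [Fintype I'] [DecidableEq I']
      (f : (I → Bool) → AliceStrat (Option (Bits L)) rs) (eI : I → I') (eJ : J → I'),
      AliceStrat.SizeLE L s rs I f → Fintype.card I' ≤ Fintype.card I + extra →
      AliceStrat.SizeLE L' t (rs ++ rs') I' fun x =>
        AliceStrat.bind rs (f (x ∘ eI)) fun pk => k pk (x ∘ eJ)
  | [], I, I', _, _, _, _, f, eI, eJ, hf, hI =>
      base I I' f eI eJ hf (hI.trans (Nat.add_le_add_right (Computes.card_input_le hf) _))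
  | (m, n) :: rs, I, I', _, _, _, _, f, eI, eJ, hf, hI => by
      obtain ⟨h1, h2⟩ := hf
      have hc := h1.card_input_le
      refine ⟨(h1.comp_select eI).mono (by omega), ?_⟩
      exact AliceStrat.sizeLE_bind k ht base rs (I ⊕ Fin n) (I' ⊕ Fin n) _
        (Sum.map eI id) (Sum.inl ∘ eJ) h2 (by simp only [Fintype.card_sum]; omega)

/-- The size of a composed strategy, as in `AliceStrat.sizeLE_bind`. -/
theorem BobStrat.sizeLE_bind {L L' s t extra : ℕ} {rs' : List (ℕ × ℕ)} {J : Type}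
    (k : Option (Bits L) → (J → Bool) → BobStrat (Option (Bits L')) rs')
    (ht : 7 * s + 3 * extra ≤ t)
    (base : ∀ (I I' : Type) [Fintype I] [DecidableEq I] [Fintype I'] [DecidableEq I']
      (g : (I → Bool) → Option (Bits L)) (eI : I → I') (eJ : J → I'),
      Computes s (fun x => encOpt (g x)) → Fintype.card I' ≤ s + extra →
      BobStrat.SizeLE L' t rs' I' fun x => k (g (x ∘ eI)) (x ∘ eJ)) :
    ∀ (rs : List (ℕ × ℕ)) (I I' : Type) [Fintype I] [DecidableEq I] [Fintype I'] [DecidableEq I']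
      (f : (I → Bool) → BobStrat (Option (Bits L)) rs) (eI : I → I') (eJ : J → I'),
      BobStrat.SizeLE L s rs I f → Fintype.card I' ≤ Fintype.card I + extra →
      BobStrat.SizeLE L' t (rs ++ rs') I' fun x =>
        BobStrat.bind rs (f (x ∘ eI)) fun pk => k pk (x ∘ eJ)
  | [], I, I', _, _, _, _, f, eI, eJ, hf, hI =>
      base I I' f eI eJ hf (hI.trans (Nat.add_le_add_right (Computes.card_input_le hf) _))
  | (m, n) :: rs, I, I', _, _, _, _, f, eI, eJ, hf, hI => by
      obtain ⟨h1, h2⟩ := hf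
      have hc := h1.card_input_le
      rw [Fintype.card_sum, Fintype.card_fin] at hc
      refine ⟨(h1.comp_select (Sum.map eI id)).mono ?_, ?_⟩
      · simp only [Fintype.card_sum, Fintype.card_fin]
        omega
      exact BobStrat.sizeLE_bind k ht base rs (I ⊕ Fin m) (I' ⊕ Fin m) _
        (Sum.map eI id) (Sum.inl ∘ eJ) h2 (by simp only [Fintype.card_sum]; omega)

section Efficient

variable {ℓ : ℕ → ℕ} {C : CommitmentScheme ℓ}

theorem CommitmentScheme.Efficient.polyComputes_commit (hC : C.Efficient) :
    PolyComputes fun κ (v : Fin κ ⊕ (Fin (ℓ κ) ⊕ Fin (C.rLen κ)) → Bool) =>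
      C.commit κ (v ∘ Sum.inl) (v ∘ Sum.inr ∘ Sum.inl) (v ∘ Sum.inr ∘ Sum.inr) := by
  obtain ⟨p, hp⟩ := hC
  exact ⟨_, polyBounded_eval p, fun κ => (hp κ).2.2.1⟩

theorem CommitmentScheme.Efficient.polyComputes_xtr (hC : C.Efficient) :
    PolyComputes fun κ (v : Fin (C.comLen κ) ⊕ Fin (C.skLen κ) → Bool) =>
      C.xtr κ (v ∘ Sum.inl) (v ∘ Sum.inr) := by
  obtain ⟨p, hp⟩ := hC
  exact ⟨_, polyBounded_eval p, fun κ => (hp κ).2.2.2⟩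

theorem CommitmentScheme.Efficient.polyComputes_genB (hC : C.Efficient) :
    PolyComputes fun κ (t : Bits (C.coinsB κ)) => Sum.elim (C.genB κ t).1 (C.genB κ t).2 := by
  obtain ⟨p, hp⟩ := hC
  exact ⟨_, polyBounded_eval p, fun κ => (hp κ).2.1⟩

theorem CommitmentScheme.Efficient.polyBounded_rLen (hC : C.Efficient) : PolyBounded C.rLen :=
  hC.polyComputes_commit.card_input.of_le fun κ => by
    simp only [Fintype.card_sum, Fintype.card_fin]; omega

theorem CommitmentScheme.Efficient.polyBounded_comLen (hC : C.Efficient) : PolyBounded C.comLen :=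
  hC.polyComputes_commit.card_output.of_le fun κ => by simp

theorem CommitmentScheme.Efficient.polyBounded_msgLen (hC : C.Efficient) : PolyBounded ℓ :=
  hC.polyComputes_commit.card_input.of_le fun κ => by
    simp only [Fintype.card_sum, Fintype.card_fin]; omega

section Functions

variable {I : ℕ → Type} [∀ κ, Fintype (I κ)] [∀ κ, DecidableEq (I κ)]

/-- Failures are encoded by the zero string, so that the output can be masked with the validity
bit. -/
theorem PolyComputes.encOpt_mask {n : ℕ → ℕ} {b : ∀ κ, (I κ → Bool) → Bool}
    {f : ∀ κ, (I κ → Bool) → Bits (n κ)} (hb : PolyBit b) (hf : PolyComputes f) :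
    PolyComputes fun κ x => encOpt (if b κ x then some (f κ x) else none) := by
  convert PolyBit.cons hb (PolyBit.mask hb hf) using 3 with κ x
  cases hx : b κ x
  · funext i
    refine Fin.cases ?_ (fun i => ?_) i
    · rfl
    · rfl
  · simp [encOpt]

variable {e : ∀ κ, Fin (κ + 1) → I κ} {a b : ∀ κ, Fin (ℓ κ) → I κ}
  {r : ∀ κ, Fin (C.rLen κ) → I κ} {v : ∀ κ, Fin (ℓ κ + 1) → I κ}
  {A : ∀ κ, Fin (C.comLen κ) → I κ} {op : ∀ κ, Fin (ℓ κ + C.rLen κ) → I κ}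

theorem polyBit_select (hI : PolyBounded fun κ => Fintype.card (I κ)) (i : ∀ κ, I κ) :
    PolyBit fun κ (x : I κ → Bool) => x (i κ) :=
  polyComputes_select (O := fun _ => Unit) hI (by simpa using polyBounded_const 1) fun κ _ => i κ

theorem CommitmentScheme.Efficient.polyComputes_commitAlice (hC : C.Efficient)
    (hI : PolyBounded fun κ => Fintype.card (I κ)) :
    PolyComputes fun κ (x : I κ → Bool) =>
      (commitAlice C κ (decOpt (x ∘ e κ)) (left (x ∘ op κ)) (right (x ∘ op κ))).1 := by
  have h1 := hC.polyComputes_commit.comp_select hI fun κ =>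
    Sum.elim (fun i => e κ i.succ) (Sum.elim (fun i => op κ (Fin.castAdd _ i))
      fun i => op κ (Fin.natAdd _ i))
  convert (polyBit_select hI fun κ => e κ 0).mask h1 using 3 with κ x
  rw [decOpt]
  by_cases hx : (x ∘ e κ) 0 = true
  · rw [if_pos hx]
    simp only [Function.comp_apply] at hx
    simp only [hx, Bool.true_and]
    rfl
  · rw [if_neg hx]
    simp only [Function.comp_apply, Bool.not_eq_true] at hx
    simp only [hx, Bool.false_and]
    rfl

theorem CommitmentScheme.Efficient.polyComputes_commitAlice_opening (hC : C.Efficient)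
    (hI : PolyBounded fun κ => Fintype.card (I κ)) :
    PolyComputes fun κ (x : I κ → Bool) =>
      ((commitAlice C κ (decOpt (x ∘ e κ)) (left (x ∘ op κ)) (right (x ∘ op κ))).2
        (x ∘ v κ)).1 := by
  have hop : PolyComputes fun κ (x : I κ → Bool) => x ∘ op κ := polyComputes_select hI
    (by simpa using hC.polyBounded_msgLen.add hC.polyBounded_rLen) op
  convert ((polyBit_select hI fun κ => e κ 0).and (polyBit_select hI fun κ => v κ 0)).mask hop
    using 3 with κ x
  rw [decOpt]
  by_cases hx : (x ∘ e κ) 0 = true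
  · rw [if_pos hx]
    simp only [Function.comp_apply] at hx
    simp only [hx, Bool.true_and, commitAlice, decOpt]
    by_cases hv : (x ∘ v κ) 0 = true
    · rw [if_pos hv]
      simp only [Function.comp_apply] at hv
      simp only [hv, Bool.true_and]
      exact append_left_right _
    · rw [if_neg hv]
      simp only [Function.comp_apply, Bool.not_eq_true] at hv
      simp only [hv, Bool.false_and]
  · rw [if_neg hx]
    simp only [Function.comp_apply, Bool.not_eq_true] at hx
    simp only [hx, Bool.false_and]
    rfl

theorem CommitmentScheme.Efficient.polyComputes_commitAlice_output (hC : C.Efficient)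
    (hI : PolyBounded fun κ => Fintype.card (I κ)) (w : ∀ κ, (I κ → Bool) → Bits 0) :
    PolyComputes fun κ (x : I κ → Bool) =>
      encOpt (((commitAlice C κ (decOpt (x ∘ e κ)) (left (x ∘ op κ)) (right (x ∘ op κ))).2
        (x ∘ v κ)).2 (w κ x)) := by
  have ha : PolyComputes fun κ (x : I κ → Bool) => x ∘ fun i => op κ (Fin.castAdd _ i) :=
    polyComputes_select hI (by simpa using hC.polyBounded_msgLen) _
  have hv : PolyComputes fun κ (x : I κ → Bool) => x ∘ fun i : Fin (ℓ κ) => v κ i.succ :=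
    polyComputes_select hI (by simpa using hC.polyBounded_msgLen) _
  convert PolyComputes.encOpt_mask
    ((polyBit_select hI fun κ => e κ 0).and (polyBit_select hI fun κ => v κ 0)) (ha.xor hv)
    using 4 with κ x
  rw [decOpt]
  by_cases hx : (x ∘ e κ) 0 = true
  · rw [if_pos hx]
    simp only [Function.comp_apply] at hx
    simp only [hx, Bool.true_and, commitAlice, decOpt]
    by_cases hv : (x ∘ v κ) 0 = true
    · rw [if_pos hv]
      simp only [Function.comp_apply] at hv
      simp only [hv]
      rfl
    · rw [if_neg hv]
      simp only [Function.comp_apply, Bool.not_eq_true] at hv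
      simp only [hv]
      rfl
  · rw [if_neg hx]
    simp only [Function.comp_apply, Bool.not_eq_true] at hx
    simp only [hx, Bool.false_and]
    rfl

theorem CommitmentScheme.Efficient.polyComputes_commitBob (hC : C.Efficient)
    (hI : PolyBounded fun κ => Fintype.card (I κ)) (w : ∀ κ, (I κ → Bool) → Bits (C.comLen κ)) :
    PolyComputes fun κ (x : I κ → Bool) =>
      (commitBob C κ (decOpt (x ∘ e κ)) (x ∘ b κ) (w κ x)).1 := by
  have hb : PolyComputes fun κ (x : I κ → Bool) => x ∘ b κ :=
    polyComputes_select hI (by simpa using hC.polyBounded_msgLen) _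
  convert PolyComputes.encOpt_mask (polyBit_select hI fun κ => e κ 0) hb using 3 with κ x
  rw [decOpt, commitBob]
  by_cases hx : (x ∘ e κ) 0 = true
  · rw [if_pos hx, if_pos (by simpa using hx)]
    rfl
  · rw [if_neg hx, if_neg (by simpa using hx)]
    rfl

theorem CommitmentScheme.Efficient.polyComputes_commitBob_output (hC : C.Efficient)
    (hI : PolyBounded fun κ => Fintype.card (I κ)) :
    PolyComputes fun κ (x : I κ → Bool) =>
      encOpt ((commitBob C κ (decOpt (x ∘ e κ)) (x ∘ b κ) (x ∘ A κ)).2 (x ∘ op κ)).2 := by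
  have hb : PolyComputes fun κ (x : I κ → Bool) => x ∘ b κ :=
    polyComputes_select hI (by simpa using hC.polyBounded_msgLen) _
  have ha : PolyComputes fun κ (x : I κ → Bool) => x ∘ fun i => op κ (Fin.castAdd _ i) :=
    polyComputes_select hI (by simpa using hC.polyBounded_msgLen) _
  have hA : PolyComputes fun κ (x : I κ → Bool) => x ∘ A κ :=
    polyComputes_select hI (by simpa using hC.polyBounded_comLen) _
  have h1 := hC.polyComputes_commit.comp_select hI fun κ =>
    Sum.elim (fun i => e κ i.succ) (Sum.elim (fun i => op κ (Fin.castAdd _ i))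
      fun i => op κ (Fin.natAdd _ i))
  convert PolyComputes.encOpt_mask
    ((polyBit_select hI fun κ => e κ 0).and (h1.eq_bit hA)) (ha.xor hb) using 4 with κ x
  rw [decOpt]
  by_cases hx : (x ∘ e κ) 0 = true
  · rw [if_pos hx]
    simp only [Function.comp_apply] at hx
    simp only [hx, Bool.true_and, commitBob, decide_eq_true_eq]
    rfl
  · rw [if_neg hx]
    simp only [Function.comp_apply, Bool.not_eq_true] at hx
    simp only [hx, Bool.false_and]
    rfl

end Functions

theorem forceRandom_efficient (hC : C.Efficient) {π : Protocol fun κ => κ} (hπ : π.Efficient) :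
    (forceRandom C π).Efficient := by
  obtain ⟨p, hp⟩ := hπ
  have hℓ := hC.polyBounded_msgLen
  have hr := hC.polyBounded_rLen
  have hcom := hC.polyBounded_comLen
  obtain ⟨s₁, hs₁, h₁⟩ := hC.polyComputes_commitAlice
    (I := fun κ => Fin (κ + 1) ⊕ Fin (ℓ κ + C.rLen κ)) (e := fun _ => Sum.inl)
    (op := fun _ => Sum.inr)
    (by simpa using (polyBounded_id.add (polyBounded_const 1)).add (hℓ.add hr))
  have hI₂ : PolyBounded fun κ =>
      Fintype.card (Fin (κ + 1) ⊕ (Fin (ℓ κ + C.rLen κ) ⊕ Fin (ℓ κ + 1))) := by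
    simpa using (polyBounded_id.add (polyBounded_const 1)).add
      ((hℓ.add hr).add (hℓ.add (polyBounded_const 1)))
  obtain ⟨s₂, hs₂, h₂⟩ := hC.polyComputes_commitAlice_opening hI₂ (e := fun _ => Sum.inl)
    (op := fun _ i => Sum.inr (Sum.inl i)) (v := fun _ i => Sum.inr (Sum.inr i))
  obtain ⟨s₃, hs₃, h₃⟩ := hC.polyComputes_commitAlice_output hI₂ (e := fun _ => Sum.inl)
    (op := fun _ i => Sum.inr (Sum.inl i)) (v := fun _ i => Sum.inr (Sum.inr i))
    fun _ _ => Fin.elim0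
  obtain ⟨s₄, hs₄, h₄⟩ := hC.polyComputes_commitBob
    (I := fun κ => Fin (κ + 1) ⊕ Fin (ℓ κ)) (e := fun _ => Sum.inl) (b := fun _ => Sum.inr)
    (by simpa using (polyBounded_id.add (polyBounded_const 1)).add hℓ) fun _ _ _ => false
  obtain ⟨s₅, hs₅, h₅⟩ := hC.polyComputes_commitBob_output
    (I := fun κ => Fin (κ + 1) ⊕ ((Fin (ℓ κ) ⊕ Fin (C.comLen κ)) ⊕ Fin (ℓ κ + C.rLen κ)))
    (e := fun _ => Sum.inl) (b := fun _ i => Sum.inr (Sum.inl (Sum.inl i)))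
    (A := fun _ i => Sum.inr (Sum.inl (Sum.inr i))) (op := fun _ i => Sum.inr (Sum.inr i))
    (by simpa using (polyBounded_id.add (polyBounded_const 1)).add ((hℓ.add hcom).add (hℓ.add hr)))
  -- a crude bound for all sizes that the composition lemmas give below
  obtain ⟨q, hq⟩ := (((polyBounded_const 14).mul (polyBounded_eval p)).add
    ((polyBounded_const 40).mul (((hℓ.add hr).add hcom).add (polyBounded_const 1)))).add
    ((polyBounded_const 4).mul ((((hs₁.add hs₂).add hs₃).add hs₄).add hs₅))
  refine ⟨q, fun κ => ?_⟩
  obtain ⟨hp₀, hpA, hpB⟩ := hp κ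
  have hq := hq κ
  beta_reduce at hq
  refine ⟨?_, ?_, ?_⟩
  · change (π.rounds κ ++ commitRounds C κ).length ≤ _
    rw [List.length_append]
    simp only [List.length_cons, List.length_nil]
    omega
  · refine AliceStrat.sizeLE_bind (s := p.eval κ) (extra := ℓ κ + C.rLen κ)
      (J := Fin (ℓ κ + C.rLen κ))
      (fun pk (j : Bits (ℓ κ + C.rLen κ)) => commitAlice C κ pk (left j) (right j)) (by omega) ?_
      (π.rounds κ) (Fin (π.coinsA κ)) (Fin (π.coinsA κ + (ℓ κ + C.rLen κ))) (π.alice κ)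
      (Fin.castAdd _) (Fin.natAdd _) hpA (by simp)
    intro I I' _ _ _ _ g eI eJ hg hI'
    refine ⟨?_, ?_, ?_⟩
    · have h := (h₁ κ).comp_pair_select hg eI eJ
      simp only [Sum.elim_comp_inl, Sum.elim_comp_inr, decOpt_encOpt] at h
      refine h.mono ?_
      omega
    · have h := (h₂ κ).comp_pair_select hg (Sum.inl ∘ eI : I → I' ⊕ Fin (ℓ κ + 1))
        (Sum.map eJ id)
      refine h.of_eq ?_ fun x => ?_
      rotate_left
      · change _ = ((commitAlice C κ (decOpt (encOpt _)) _ _).2 _).1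
        rw [decOpt_encOpt]
        rfl
      · simp only [Fintype.card_sum, Fintype.card_fin]
        omega
    · have h := (h₃ κ).comp_pair_select hg
        (Sum.inl ∘ Sum.inl ∘ eI : I → (I' ⊕ Fin (ℓ κ + 1)) ⊕ Fin 0) (Sum.inl ∘ Sum.map eJ id)
      refine h.of_eq ?_ fun x => ?_
      rotate_left
      · change _ = encOpt (((commitAlice C κ (decOpt (encOpt _)) _ _).2 _).2 _)
        have hw : (Fin.elim0 : Bits 0) = x ∘ Sum.inr := Subsingleton.elim _ _
        rw [decOpt_encOpt, hw]
        rfl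
      · simp only [Fintype.card_sum, Fintype.card_fin]
        omega
  · refine BobStrat.sizeLE_bind (s := p.eval κ) (extra := ℓ κ) (J := Fin (ℓ κ))
      (fun pk (j : Bits (ℓ κ)) => commitBob C κ pk j) (by omega) ?_
      (π.rounds κ) (Fin (π.coinsB κ)) (Fin (π.coinsB κ + ℓ κ)) (π.bob κ)
      (Fin.castAdd _) (Fin.natAdd _) hpB (by simp)
    intro I I' _ _ _ _ g eI eJ hg hI'
    refine ⟨?_, ?_, ?_⟩
    · have h := (h₄ κ).comp_pair_select hg (Sum.inl ∘ eI : I → I' ⊕ Fin (C.comLen κ))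
        (Sum.inl ∘ eJ)
      refine h.of_eq ?_ fun x => ?_
      rotate_left
      · change _ = (commitBob C κ (decOpt (encOpt _)) _ _).1
        rw [decOpt_encOpt]
        rfl
      · simp only [Fintype.card_sum, Fintype.card_fin]
        omega
    · refine (computes_select (I := (I' ⊕ Fin (C.comLen κ)) ⊕ Fin (ℓ κ + C.rLen κ))
        (O := Fin 0) Fin.elim0).of_eq ?_ fun x => ?_
      rotate_left
      · exact Subsingleton.elim _ _
      · simp only [Fintype.card_sum, Fintype.card_fin]
        omega
    · have h := (h₅ κ).comp_pair_select hg
        (Sum.inl ∘ Sum.inl ∘ eI : I → (I' ⊕ Fin (C.comLen κ)) ⊕ Fin (ℓ κ + C.rLen κ))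
        (Sum.map (Sum.map eJ id) id)
      refine h.of_eq ?_ fun x => ?_
      rotate_left
      · change _ = encOpt ((commitBob C κ (decOpt (encOpt _)) _ _).2 _).2
        rw [decOpt_encOpt]
        rfl
      · simp only [Fintype.card_sum, Fintype.card_fin]
        omega

end Efficient

/-! ### Honest runs -/

theorem honestRun_bind {O O' P P' : Type} {rs' : List (ℕ × ℕ)} (k : O → AliceStrat O' rs')
    (k' : P → BobStrat P' rs') : ∀ (rs : List (ℕ × ℕ)) (a : AliceStrat O rs) (b : BobStrat P rs),
    honestRun (rs ++ rs') (AliceStrat.bind rs a k) (BobStrat.bind rs b k') =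
      honestRun rs' (k (honestRun rs a b).1) (k' (honestRun rs a b).2)
  | [], _, _ => rfl
  | (_, _) :: rs, _, _ => honestRun_bind k k' rs _ _

theorem honestRun_commit {ℓ : ℕ → ℕ} (C : CommitmentScheme ℓ) (κ : ℕ) (pk : Bits κ)
    (a b : Bits (ℓ κ)) (r : Bits (C.rLen κ)) :
    honestRun (commitRounds C κ) (commitAlice C κ (some pk) a r) (commitBob C κ (some pk) b)
      = (some (bxor a b), some (bxor a b)) := by
  simp only [honestRun, commitAlice, commitBob, Option.map_some, decOpt_encOpt, left_append,
    right_append, ↓reduceIte]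

theorem law_nonneg {T α : Type} [Fintype T] (f : T → α) (a : α) : 0 ≤ law f a := by
  unfold law; positivity

theorem law_eq_sum {T α : Type} [Fintype T] [DecidableEq α] (f : T → α) (a : α) :
    law f a = (Fintype.card T : ℝ)⁻¹ * ∑ t, if f t = a then 1 else 0 := by
  rw [law, Finset.sum_boole, mul_comm, div_eq_mul_inv]
  congr!

/-- Expectations of functions of `f t`. -/
theorem sum_law_mul {T α : Type} [Fintype T] [Fintype α] (f : T → α) (g : α → ℝ) :
    ∑ a, law f a * g a = (Fintype.card T : ℝ)⁻¹ * ∑ t, g (f t) := by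
  classical
  simp only [law_eq_sum, mul_assoc, ← Finset.mul_sum, Finset.sum_mul]
  rw [Finset.sum_comm]
  congr 1
  refine Finset.sum_congr rfl fun t _ => ?_
  simp

theorem sum_law {T α : Type} [Fintype T] [Nonempty T] [Fintype α] (f : T → α) :
    ∑ a, law f a = 1 := by
  have := sum_law_mul f fun _ => 1
  simpa using this

/-- In an unbiased protocol, honest players always agree on a string: the probabilities of the
agreements on the single strings add up to one. -/
theorem Protocol.Unbiased.exists_honestRun_eq {lam : ℕ → ℕ} {π : Protocol lam} (h : π.Unbiased)
    (κ : ℕ) (t : Bits (π.coinsA κ) × Bits (π.coinsB κ)) :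
    ∃ c, honestRun (π.rounds κ) (π.alice κ t.1) (π.bob κ t.2) = (some c, some c) := by
  classical
  by_contra! hne
  set f := fun t : Bits (π.coinsA κ) × Bits (π.coinsB κ) =>
      honestRun (π.rounds κ) (π.alice κ t.1) (π.bob κ t.2) with hf
  have h1 : ∑ c : Bits (lam κ), law f (some c, some c) = 1 := by
    rw [Finset.sum_congr rfl fun c _ => h κ c]
    simp
  have hpos : 0 < law f (f t) := by
    rw [law_eq_sum]
    refine mul_pos (by positivity) ?_
    exact Finset.sum_pos' (fun _ _ => by positivity) ⟨t, by simp, by simp⟩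
  have h2 : ∑ c : Bits (lam κ), law f (some c, some c) + law f (f t)
      ≤ ∑ y, law f y := by
    have hinj : Function.Injective fun c : Bits (lam κ) => (some c, some c) := by
      intro c d hcd
      simpa using hcd
    rw [← Finset.sum_image (f := law f) (g := fun c : Bits (lam κ) => (some c, some c))
      (fun c _ d _ hcd => hinj hcd), add_comm, ← Finset.sum_insert]
    · exact Finset.sum_le_sum_of_subset_of_nonneg (Finset.subset_univ _)
        fun _ _ _ => law_nonneg _ _
    · simp only [Finset.mem_image, Finset.mem_univ, true_and, not_exists]
      exact fun c hc => hne c hc.symm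
  rw [sum_law] at h2
  linarith

theorem forceRandom_unbiased {ℓ : ℕ → ℕ} (C : CommitmentScheme ℓ) {π : Protocol fun κ => κ}
    (hπ : π.Unbiased) : (forceRandom C π).Unbiased := by
  intro κ c
  have hrun : ∀ t : Bits (π.coinsA κ + (ℓ κ + C.rLen κ)) × Bits (π.coinsB κ + ℓ κ),
      honestRun ((forceRandom C π).rounds κ) ((forceRandom C π).alice κ t.1)
        ((forceRandom C π).bob κ t.2) =
      (some (bxor (left (right t.1)) (right t.2)), some (bxor (left (right t.1)) (right t.2))) := by
    intro t
    obtain ⟨pk, hpk⟩ := hπ.exists_honestRun_eq κ (left t.1, left t.2)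
    refine (honestRun_bind _ _ _ _ _).trans ?_
    rw [hpk]
    exact honestRun_commit C κ pk _ _ _
  rw [law_eq_sum, Fintype.sum_congr _ _ fun t => if_congr (by rw [hrun t]) rfl rfl]
  have hc : ∀ b : Bits (ℓ κ), ((some b, some b) = (some c, some c)) ↔ b = c := by
    intro b; simp
  simp only [hc]
  rw [Fintype.sum_prod_type]
  have e1 : ∀ x : Bits (π.coinsA κ + (ℓ κ + C.rLen κ)),
      ∑ y : Bits (π.coinsB κ + ℓ κ), (if bxor (left (right x)) (right y) = c then (1 : ℝ) else 0)
      = 2 ^ π.coinsB κ := by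
    intro x
    rw [sum_left_right fun (_ : Bits (π.coinsB κ)) w =>
      if bxor (left (right x)) w = c then (1 : ℝ) else 0]
    simp only [bxor_eq_iff, Finset.sum_ite_eq', Finset.mem_univ, if_true]
    simp
  change ((Fintype.card (Bits (π.coinsA κ + (ℓ κ + C.rLen κ)) × Bits (π.coinsB κ + ℓ κ)) : ℕ) : ℝ)⁻¹
    * ∑ x : Bits (π.coinsA κ + (ℓ κ + C.rLen κ)), ∑ y : Bits (π.coinsB κ + ℓ κ),
      (if bxor (left (right x)) (right y) = c then (1 : ℝ) else 0) = _
  rw [Fintype.sum_congr _ _ e1]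
  simp only [Fintype.card_prod, Fintype.card_fun, Fintype.card_bool, Fintype.card_fin,
    Finset.sum_const, Finset.card_univ, nsmul_eq_mul]
  push_cast
  rw [pow_add 2 (π.coinsB κ) (ℓ κ)]
  field_simp

/-! ### Runs with an adversary -/

section Runs

variable {W : Type} [Fintype W] [DecidableEq W]

theorem project_exists_linear {m : ℕ} (port : Fin m ↪ W) (u : Bits m) :
    ∃ L : State W →ₗ[ℂ] State W, ∀ ρ, project port u ρ = L ρ :=
  (implements_project (E := Fin 0) port).exists_linear Fin.elim0 u

theorem write_exists_linear {m : ℕ} (port : Fin m ↪ W) (u : Bits m) :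
    ∃ L : State W →ₗ[ℂ] State W, ∀ ρ, write port u ρ = L ρ :=
  (implements_write port (id : Fin m → Fin m)).exists_linear u Fin.elim0

theorem project_posSemidef {m : ℕ} (port : Fin m ↪ W) (u : Bits m) {ρ : State W}
    (h : ρ.PosSemidef) : (project port u ρ).PosSemidef :=
  (implements_project (E := Fin 0) port).posSemidef Fin.elim0 h u

theorem write_posSemidef {m : ℕ} (port : Fin m ↪ W) (u : Bits m) {ρ : State W}
    (h : ρ.PosSemidef) : (write port u ρ).PosSemidef :=
  (implements_write port (id : Fin m → Fin m)).posSemidef u h Fin.elim0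

theorem sum_project_trace {m : ℕ} (port : Fin m ↪ W) (ρ : State W) :
    ∑ u, (project port u ρ).trace = ρ.trace :=
  (implements_project (E := Fin 0) port).sum_trace Fin.elim0 ρ

theorem write_trace {m : ℕ} (port : Fin m ↪ W) (u : Bits m) (ρ : State W) :
    (write port u ρ).trace = ρ.trace := by
  rw [← (implements_write port (id : Fin m → Fin m)).sum_trace u ρ, Fintype.sum_unique]
  rfl

section

variable {O : Type} [DecidableEq O]

theorem QAlice.run_exists_linear : ∀ (rs : List (ℕ × ℕ)) (s : QAlice W rs) (b : BobStrat O rs)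
    (y : O), ∃ L : State W →ₗ[ℂ] State W, ∀ ρ, QAlice.run rs s b ρ y = L ρ
  | [], gs, (o : O), y => by
      by_cases h : y = o
      · exact ⟨applyHom gs, fun ρ => by rw [QAlice.run, if_pos h]; exact (applyHom_apply _ _).symm⟩
      · exact ⟨0, fun ρ => by rw [QAlice.run, if_neg h, LinearMap.zero_apply]⟩
  | (m, n) :: rs, s, b, y => by
      choose L hL using fun v => QAlice.run_exists_linear rs s.2 (b v).2 y
      choose L' hL' using fun v => write_exists_linear s.1.inp (b v).1
      choose L'' hL'' using fun v => project_exists_linear s.1.out v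
      refine ⟨∑ v, L v ∘ₗ L' v ∘ₗ L'' v ∘ₗ applyHom s.1.gates, fun ρ => ?_⟩
      simp only [QAlice.run, LinearMap.sum_apply, LinearMap.comp_apply, ← hL, ← hL', ← hL'',
        applyHom_apply]

theorem QBob.run_exists_linear : ∀ (rs : List (ℕ × ℕ)) (s : QBob W rs) (a : AliceStrat O rs)
    (y : O), ∃ L : State W →ₗ[ℂ] State W, ∀ ρ, QBob.run rs s a ρ y = L ρ
  | [], gs, (o : O), y => by
      by_cases h : y = o
      · exact ⟨applyHom gs, fun ρ => by rw [QBob.run, if_pos h]; exact (applyHom_apply _ _).symm⟩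
      · exact ⟨0, fun ρ => by rw [QBob.run, if_neg h, LinearMap.zero_apply]⟩
  | (m, n) :: rs, s, a, y => by
      choose L hL using fun v => QBob.run_exists_linear rs s.2 (a.2 v) y
      obtain ⟨L', hL'⟩ := write_exists_linear s.1.inp a.1
      choose L'' hL'' using fun v => project_exists_linear s.1.out v
      refine ⟨∑ v, L v ∘ₗ L'' v ∘ₗ applyHom s.1.gates ∘ₗ L', fun ρ => ?_⟩
      simp only [QBob.run, LinearMap.sum_apply, LinearMap.comp_apply, ← hL, ← hL', ← hL'',
        applyHom_apply]

theorem QBob.run_posSemidef : ∀ (rs : List (ℕ × ℕ)) (s : QBob W rs) (a : AliceStrat O rs)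
    {ρ : State W}, ρ.PosSemidef → ∀ y : O, (QBob.run rs s a ρ y).PosSemidef
  | [], gs, (o : O), ρ, h, y => by
      rw [QBob.run]
      split_ifs
      · exact applyAll_posSemidef _ h
      · exact Matrix.PosSemidef.zero
  | (m, n) :: rs, s, a, ρ, h, y => by
      rw [QBob.run]
      exact sum_posSemidef _ fun v _ => QBob.run_posSemidef rs _ _
        (project_posSemidef _ _ (applyAll_posSemidef _ (write_posSemidef _ _ h))) _

theorem QBob.sum_run_trace [Fintype O] : ∀ (rs : List (ℕ × ℕ)) (s : QBob W rs)
    (a : AliceStrat O rs) (ρ : State W), ∑ y : O, (QBob.run rs s a ρ y).trace = ρ.trace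
  | [], gs, (o : O), ρ => by
      rw [Finset.sum_eq_single o]
      · rw [QBob.run, if_pos rfl]
        exact applyAll_trace _ _
      · intro y _ hy
        rw [QBob.run, if_neg hy, Matrix.trace_zero]
      · simp
  | (m, n) :: rs, s, a, ρ => by
      simp only [QBob.run, Matrix.trace_sum]
      rw [Finset.sum_comm]
      simp only [QBob.sum_run_trace rs]
      rw [sum_project_trace, applyAll_trace, write_trace]

end

variable {rs' : List (ℕ × ℕ)}

/-- The moves of a strategy in the first rounds. -/
def QAlice.take : (rs : List (ℕ × ℕ)) → QAlice W (rs ++ rs') → QAlice W rs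
  | [], _ => ([] : List (QGate W))
  | (_, _) :: rs, s => (s.1, QAlice.take rs s.2)

/-- The moves of a strategy in the last rounds. -/
def QAlice.drop : (rs : List (ℕ × ℕ)) → QAlice W (rs ++ rs') → QAlice W rs'
  | [], s => s
  | (_, _) :: rs, s => QAlice.drop rs s.2

/-- The moves of a strategy in the first rounds. -/
def QBob.take : (rs : List (ℕ × ℕ)) → QBob W (rs ++ rs') → QBob W rs
  | [], _ => ([] : List (QGate W))
  | (_, _) :: rs, s => (s.1, QBob.take rs s.2)

/-- The moves of a strategy in the last rounds. -/
def QBob.drop : (rs : List (ℕ × ℕ)) → QBob W (rs ++ rs') → QBob W rs'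
  | [], s => s
  | (_, _) :: rs, s => QBob.drop rs s.2

theorem QAlice.gateCount_append : ∀ (rs : List (ℕ × ℕ)) (s : QAlice W (rs ++ rs')),
    QAlice.gateCount (rs ++ rs') s =
      QAlice.gateCount rs (QAlice.take rs s) + QAlice.gateCount rs' (QAlice.drop rs s)
  | [], s => (Nat.zero_add _).symm
  | (m, n) :: rs, s => by
      change s.1.gates.length + QAlice.gateCount (rs ++ rs') s.2 = (s.1.gates.length +
        QAlice.gateCount rs (QAlice.take rs s.2)) + QAlice.gateCount rs' (QAlice.drop rs s.2)
      rw [QAlice.gateCount_append rs s.2, Nat.add_assoc]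

theorem QBob.gateCount_append : ∀ (rs : List (ℕ × ℕ)) (s : QBob W (rs ++ rs')),
    QBob.gateCount (rs ++ rs') s =
      QBob.gateCount rs (QBob.take rs s) + QBob.gateCount rs' (QBob.drop rs s)
  | [], s => (Nat.zero_add _).symm
  | (m, n) :: rs, s => by
      change s.1.gates.length + QBob.gateCount (rs ++ rs') s.2 = (s.1.gates.length +
        QBob.gateCount rs (QBob.take rs s.2)) + QBob.gateCount rs' (QBob.drop rs s.2)
      rw [QBob.gateCount_append rs s.2, Nat.add_assoc]

variable {O P : Type} [Fintype O] [DecidableEq O] [DecidableEq P]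

/-- A run against a composed strategy is a run of its first part, followed by a run of the
continuation on each of the outcomes. The states are not normalized and carry the probabilities. -/
theorem QAlice.run_bind (k : O → BobStrat P rs') (y : P) : ∀ (rs : List (ℕ × ℕ))
    (s : QAlice W (rs ++ rs')) (b : BobStrat O rs) (ρ : State W),
    QAlice.run (rs ++ rs') s (BobStrat.bind rs b k) ρ y =
      ∑ o, QAlice.run rs' (QAlice.drop rs s) (k o) (QAlice.run rs (QAlice.take rs s) b ρ o) y
  | [], s, (o : O), ρ => by
      rw [Finset.sum_eq_single o]
      · rw [QAlice.run, if_pos rfl]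
        rfl
      · intro o' _ ho
        obtain ⟨L, hL⟩ := QAlice.run_exists_linear rs' (QAlice.drop [] s) (k o') y
        rw [hL, QAlice.run, if_neg ho, map_zero]
      · simp
  | (m, n) :: rs, s, b, ρ => by
      choose L hL using fun o => QAlice.run_exists_linear rs'
        (QAlice.drop ((m, n) :: rs) s) (k o) y
      simp only [hL]
      simp only [QAlice.run, map_sum]
      rw [Finset.sum_comm]
      refine Finset.sum_congr rfl fun v _ => ?_
      simp only [← hL]
      exact QAlice.run_bind k y rs s.2 (b v).2 _

theorem QBob.run_bind (k : O → AliceStrat P rs') (y : P) : ∀ (rs : List (ℕ × ℕ))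
    (s : QBob W (rs ++ rs')) (a : AliceStrat O rs) (ρ : State W),
    QBob.run (rs ++ rs') s (AliceStrat.bind rs a k) ρ y =
      ∑ o, QBob.run rs' (QBob.drop rs s) (k o) (QBob.run rs (QBob.take rs s) a ρ o) y
  | [], s, (o : O), ρ => by
      rw [Finset.sum_eq_single o]
      · rw [QBob.run, if_pos rfl]
        rfl
      · intro o' _ ho
        obtain ⟨L, hL⟩ := QBob.run_exists_linear rs' (QBob.drop [] s) (k o') y
        rw [hL, QBob.run, if_neg ho, map_zero]
      · simp
  | (m, n) :: rs, s, a, ρ => by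
      choose L hL using fun o => QBob.run_exists_linear rs'
        (QBob.drop ((m, n) :: rs) s) (k o) y
      simp only [hL]
      simp only [QBob.run, map_sum]
      rw [Finset.sum_comm]
      refine Finset.sum_congr rfl fun v _ => ?_
      simp only [← hL]
      exact QBob.run_bind k y rs s.2 (a.2 v) _

end Runs

theorem single_posSemidef {W : Type} [Fintype W] [DecidableEq W] :
    (Matrix.single (fun _ => false) (fun _ => false) 1 : State W).PosSemidef := by
  have h : (Matrix.single (fun _ => false) (fun _ => false) 1 : State W)
      = Matrix.diagonal fun x => if x = fun _ => false then 1 else 0 := by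
    ext x y
    simp only [Matrix.single_apply, Matrix.diagonal_apply]
    by_cases hx : x = fun _ => false
    · subst hx
      simp
    · have := Ne.symm hx
      simp [hx, this]
  rw [h]
  refine Matrix.PosSemidef.diagonal fun x => ?_
  dsimp only
  split_ifs
  · exact zero_le_one
  · exact le_rfl

theorem single_trace {W : Type} [Fintype W] [DecidableEq W] :
    (Matrix.single (fun _ => false) (fun _ => false) 1 : State W).trace = 1 :=
  Matrix.trace_single_eq_same _ _

theorem Sampler.init_posSemidef {uLen zLen : ℕ → ℕ} (S : Sampler uLen zLen) (κ a : ℕ)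
    (z : Bits (zLen κ)) : (S.init κ a z).PosSemidef := by
  obtain ⟨k, hk, h⟩ := S.exists_kernel (E := Fin 0) κ a
  rw [← h Fin.elim0 z]
  exact hk.posSemidef _ single_posSemidef _

theorem Sampler.sum_init_trace {uLen zLen : ℕ → ℕ} (S : Sampler uLen zLen) (κ a : ℕ) :
    ∑ z, (S.init κ a z).trace = 1 := by
  obtain ⟨k, hk, h⟩ := S.exists_kernel (E := Fin 0) κ a
  simp only [← h Fin.elim0]
  rw [hk.sum_trace, single_trace]

/-! ### The commitment phase against a dishonest Alice -/

section Interaction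

variable {W E E' F : Type} [Fintype W] [DecidableEq W] [Fintype E'] [DecidableEq E'] [Fintype F]
  [DecidableEq F] {nA nB nO : ℕ}

theorem adjoin_sum {ι : Type*} (t : Finset ι) (f : ι → State W) (v : F → Bool) :
    adjoin (∑ i ∈ t, f i) v = ∑ i ∈ t, adjoin (f i) v :=
  map_sum (adjoinHom v) f t

theorem adjoin_smul (c : ℂ) (ρ : State W) (v : F → Bool) : adjoin (c • ρ) v = c • adjoin ρ v :=
  map_smul (adjoinHom v) c ρ

theorem adjoin_ite (p : Prop) [Decidable p] (ρ : State W) (v : F → Bool) :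
    adjoin (if p then ρ else 0) v = if p then adjoin ρ v else 0 := by
  split_ifs
  · rfl
  · exact map_zero (adjoinHom v)

theorem sum_adjoin_interaction (s : QAlice W [(nA, nB), (nO, 0)])
    (msg : (E → Bool) → Bits nA → Bits nB) (fin : (E → Bool) → Bits nA → Bits nO → (E' → Bool))
    (v : E → Bool) (ρ : State W) (g : (E' → Bool) → (F → Bool)) :
    ∑ w, adjoin (interaction s msg fin v ρ w) (g w) =
      ∑ A, ∑ op, adjoin (QAlice.twoMoves s A (msg v A) op ρ) (g (fin v A op)) := by
  simp only [interaction, adjoin_sum, adjoin_ite]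
  rw [Finset.sum_comm]
  refine Finset.sum_congr rfl fun A _ => ?_
  rw [Finset.sum_comm]
  refine Finset.sum_congr rfl fun op _ => ?_
  simp

theorem sum_adjoin_run {O : Type} [Fintype O] [DecidableEq O] (s : QAlice W [(nA, nB), (nO, 0)])
    (b : BobStrat O [(nA, nB), (nO, 0)]) {out : Bits nA → Bits nO → O}
    (hout : ∀ A op, out A op = ((b A).2 op).2) (ρ : State W) (g : O → (F → Bool)) :
    ∑ y, adjoin (QAlice.run [(nA, nB), (nO, 0)] s b ρ y) (g y) =
      ∑ A, ∑ op, adjoin (QAlice.twoMoves s A (b A).1 op ρ) (g (out A op)) := by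
  have h : ∀ y, QAlice.run [(nA, nB), (nO, 0)] s b ρ y = ∑ A, ∑ op,
      if y = out A op then QAlice.twoMoves s A (b A).1 op ρ else 0 := by
    intro y
    refine Finset.sum_congr rfl fun A _ => Finset.sum_congr rfl fun op _ => ?_
    have he : (Fin.elim0 : Bits 0) = ((b A).2 op).1 := Subsingleton.elim _ _
    rw [hout, QAlice.twoMoves, he]
    rfl
  simp only [h, adjoin_sum, adjoin_ite]
  rw [Finset.sum_comm]
  refine Finset.sum_congr rfl fun A _ => ?_
  rw [Finset.sum_comm]
  refine Finset.sum_congr rfl fun op _ => ?_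
  simp

end Interaction

section CommitPhase

variable {ℓ : ℕ → ℕ} (C : CommitmentScheme ℓ) (κ : ℕ) {W : Type} [Fintype W] [DecidableEq W]

/-- The commitment phase of the protocol, on input of the classical input of the adversary and of
the output of Bob in the key generation. The output consists of the classical input and of the
output of Bob. -/
def commitPhase (s : QAlice W (commitRounds C κ)) (z : ℕ) :
    Kernel W (Fin z ⊕ Fin (κ + 1)) (Fin z ⊕ Fin (ℓ κ + 1)) :=
  fun v ρ w => ((2 : ℂ) ^ ℓ κ)⁻¹ • ∑ b : Bits (ℓ κ),
    interaction s
      (fun (x : (Fin z ⊕ Fin (κ + 1)) ⊕ Fin (ℓ κ) → Bool) A =>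
        (commitBob C κ (decOpt (x ∘ Sum.inl ∘ Sum.inr)) (x ∘ Sum.inr) A).1)
      (fun x A op => Sum.elim (x ∘ Sum.inl ∘ Sum.inl)
        (encOpt ((commitBob C κ (decOpt (x ∘ Sum.inl ∘ Sum.inr)) (x ∘ Sum.inr) A).2 op).2))
      (Sum.elim v b) ρ w

/-- The final state after the commitment phase, together with the classical output. -/
def commitPhaseState (s : QAlice W (commitRounds C κ)) {z : ℕ} (v : Fin z ⊕ Fin (κ + 1) → Bool)
    (ρ : State W) : State (W ⊕ (Fin z ⊕ Fin (ℓ κ + 1))) :=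
  ∑ w, adjoin (commitPhase C κ s z v ρ w) w

theorem commitPhaseState_eq (s : QAlice W (commitRounds C κ)) {z : ℕ} (x : Bits z)
    (o : Option (Bits κ)) (ρ : State W) :
    commitPhaseState C κ s (Sum.elim x (encOpt o)) ρ = ((2 : ℂ) ^ ℓ κ)⁻¹ • ∑ b : Bits (ℓ κ),
      ∑ A, ∑ op, adjoin (QAlice.twoMoves s A (commitBob C κ o b A).1 op ρ)
        (Sum.elim x (encOpt ((commitBob C κ o b A).2 op).2)) := by
  simp only [commitPhaseState, commitPhase, adjoin_smul, adjoin_sum]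
  rw [← Finset.smul_sum, Finset.sum_comm]
  congr 1
  refine Finset.sum_congr rfl fun b _ => ?_
  refine (sum_adjoin_interaction s _ _ _ ρ id).trans ?_
  have h1 : ((Sum.elim (Sum.elim x (encOpt o)) b : (Fin z ⊕ Fin (κ + 1)) ⊕ Fin (ℓ κ) → Bool) ∘
    Sum.inl ∘ Sum.inr) = encOpt o := rfl
  simp only [h1, decOpt_encOpt]
  rfl

/-- The run of the whole protocol in terms of the run of the key generation. -/
theorem realOutput_forceRandom (π : Protocol fun κ => κ)
    (A : AliceAdversary (forceRandom C π).rounds) (S : Sampler A.uLen A.zLen) :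
    realOutput (forceRandom C π) A S κ = ((2 : ℂ) ^ π.coinsB κ)⁻¹ • ∑ t : Bits (π.coinsB κ),
      ∑ z : Bits (A.zLen κ), ∑ o : Option (Bits κ),
        commitPhaseState C κ (QAlice.drop (π.rounds κ) (A.strat κ)) (Sum.elim z (encOpt o))
          (QAlice.run (π.rounds κ) (QAlice.take (π.rounds κ) (A.strat κ)) (π.bob κ t)
            (S.init κ (A.anc κ) z) o) := by
  have h : ∀ (t : Bits (π.coinsB κ)) (b : Bits (ℓ κ)) (z : Bits (A.zLen κ)),
      ∑ y, adjoin (QAlice.run (π.rounds κ ++ commitRounds C κ) (A.strat κ)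
        (BobStrat.bind (π.rounds κ) (π.bob κ t) fun pk => commitBob C κ pk b)
        (S.init κ (A.anc κ) z) y) (Sum.elim z (encOpt y)) =
      ∑ o, ∑ A', ∑ op, adjoin (QAlice.twoMoves (QAlice.drop (π.rounds κ) (A.strat κ)) A'
        (commitBob C κ o b A').1 op (QAlice.run (π.rounds κ)
          (QAlice.take (π.rounds κ) (A.strat κ)) (π.bob κ t) (S.init κ (A.anc κ) z) o))
        (Sum.elim z (encOpt ((commitBob C κ o b A').2 op).2)) := by
    intro t b z
    rw [Finset.sum_congr rfl fun y _ => congrArg (adjoin · (Sum.elim z (encOpt y)))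
      (QAlice.run_bind (fun pk => commitBob C κ pk b) y (π.rounds κ) (A.strat κ) (π.bob κ t)
        (S.init κ (A.anc κ) z))]
    simp only [adjoin_sum]
    rw [Finset.sum_comm]
    exact Finset.sum_congr rfl fun o _ => sum_adjoin_run (O := Option (Bits (ℓ κ))) _ _
      (out := fun A' op => ((commitBob C κ o b A').2 op).2) (fun _ _ => rfl) _
      fun y => Sum.elim z (encOpt y)
  have h1 : realOutput (forceRandom C π) A S κ = ((2 : ℂ) ^ (π.coinsB κ + ℓ κ))⁻¹ •
      ∑ t : Bits (π.coinsB κ + ℓ κ), ∑ z : Bits (A.zLen κ), ∑ y,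
      adjoin (QAlice.run (π.rounds κ ++ commitRounds C κ) (A.strat κ)
        (BobStrat.bind (π.rounds κ) (π.bob κ (left t)) fun pk => commitBob C κ pk (right t))
        (S.init κ (A.anc κ) z) y) (Sum.elim z (encOpt y)) := rfl
  rw [h1]
  simp only [h]
  rw [sum_left_right (fun t b => ∑ z : Bits (A.zLen κ), ∑ o, ∑ A', ∑ op,
    adjoin (QAlice.twoMoves (QAlice.drop (π.rounds κ) (A.strat κ)) A'
        (commitBob C κ o b A').1 op (QAlice.run (π.rounds κ)
          (QAlice.take (π.rounds κ) (A.strat κ)) (π.bob κ t) (S.init κ (A.anc κ) z) o))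
        (Sum.elim z (encOpt ((commitBob C κ o b A').2 op).2)))]
  simp only [commitPhaseState_eq, ← Finset.smul_sum, smul_smul]
  rw [pow_add, mul_inv]
  congr 1
  refine Finset.sum_congr rfl fun t _ => ?_
  rw [Finset.sum_comm]
  refine Finset.sum_congr rfl fun z _ => ?_
  rw [Finset.sum_comm]

/-- The simulator, on input of a string `h` from the functionality: run the ideal-world adversary
`k` for the key generation on a binding key, extract the message from the commitment, send the
string that leads to the outcome `h`, and accept if Bob would output a string. -/
def simulator (s : QAlice W (commitRounds C κ)) (k : Kernel W (Fin κ) (Fin 1)) :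
    Kernel W (Fin (ℓ κ)) (Fin 1) :=
  fun h ρ w => ((2 : ℂ) ^ C.coinsB κ)⁻¹ • ∑ t : Bits (C.coinsB κ), ∑ d : Fin 1 → Bool,
    interaction s
      (fun (x : (Fin (ℓ κ) ⊕ Fin (C.coinsB κ)) ⊕ Fin 1 → Bool) A =>
        (commitBob C κ
          (if x (Sum.inr 0) then some (C.genB κ (x ∘ Sum.inl ∘ Sum.inr)).1 else none)
          (bxor (x ∘ Sum.inl ∘ Sum.inl) (C.xtr κ A (C.genB κ (x ∘ Sum.inl ∘ Sum.inr)).2)) A).1)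
      (fun x A op _ => encOpt ((commitBob C κ
          (if x (Sum.inr 0) then some (C.genB κ (x ∘ Sum.inl ∘ Sum.inr)).1 else none)
          (x ∘ Sum.inl ∘ Sum.inl) A).2 op).2 0)
      (Sum.elim (Sum.elim h t) d) (k (C.genB κ t).1 ρ d) w

variable {C} in
/-- With the string sent by the simulator, Bob outputs `h` unless he rejects. -/
theorem commitBob_extract (hC : C.IsMixed) (t : Bits (C.coinsB κ)) (d : Bool) (h b : Bits (ℓ κ))
    (A : Bits (C.comLen κ)) (op : Bits (ℓ κ + C.rLen κ)) :
    ((commitBob C κ (if d then some (C.genB κ t).1 else none)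
      (bxor h (C.xtr κ A (C.genB κ t).2)) A).2 op).2 =
    if encOpt ((commitBob C κ (if d then some (C.genB κ t).1 else none) b A).2 op).2 0
      then some h else none := by
  cases d
  · rfl
  · have e : ∀ b', ((commitBob C κ (if true then some (C.genB κ t).1 else none) b' A).2 op).2 =
        (if C.commit κ (C.genB κ t).1 (left op) (right op) = A then some (bxor (left op) b')
          else none : Option (Bits (ℓ κ))) := fun _ => rfl
    refine (e _).trans (Eq.trans ?_ (congrArg (fun o : Option (Bits (ℓ κ)) =>
      if encOpt o 0 then some h else none) (e b)).symm)
    by_cases hop : C.commit κ (C.genB κ t).1 (left op) (right op) = A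
    · rw [if_pos hop, if_pos hop, encOpt_decOpt_zero, if_pos Option.isSome_some, ← hop,
        hC.extractable, bxor_comm h, bxor_bxor]
    · rw [if_neg hop, if_neg hop, encOpt_decOpt_zero, if_neg (by simp)]

/-- With a uniform `h` and a binding key, the simulation of the commitment phase is perfect. -/
theorem sum_adjoin_simulator (hC : C.IsMixed) (s : QAlice W (commitRounds C κ))
    (k : Kernel W (Fin κ) (Fin 1)) {z : ℕ} (x : Bits z) (ρ : State W) :
    ((2 : ℂ) ^ ℓ κ)⁻¹ • ∑ h : Bits (ℓ κ), ∑ d : Fin 1 → Bool,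
      adjoin (simulator C κ s k h ρ d) (Sum.elim x (encOpt (if d 0 then some h else none))) =
    ((2 : ℂ) ^ C.coinsB κ)⁻¹ • ∑ t : Bits (C.coinsB κ), ∑ d : Fin 1 → Bool,
      commitPhaseState C κ s
        (Sum.elim x (encOpt (if d 0 then some (C.genB κ t).1 else none)))
        (k (C.genB κ t).1 ρ d) := by
  have h1 : ∀ h : Bits (ℓ κ), ∑ w : Fin 1 → Bool,
      adjoin (simulator C κ s k h ρ w) (Sum.elim x (encOpt (if w 0 then some h else none))) =
      ((2 : ℂ) ^ C.coinsB κ)⁻¹ • ∑ t : Bits (C.coinsB κ), ∑ d : Fin 1 → Bool, ∑ A, ∑ op,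
        adjoin (QAlice.twoMoves s A (commitBob C κ
          (if d 0 then some (C.genB κ t).1 else none)
          (bxor h (C.xtr κ A (C.genB κ t).2)) A).1 op (k (C.genB κ t).1 ρ d))
          (Sum.elim x (encOpt ((commitBob C κ
          (if d 0 then some (C.genB κ t).1 else none)
          (bxor h (C.xtr κ A (C.genB κ t).2)) A).2 op).2)) := by
    intro h
    simp only [simulator, adjoin_smul, adjoin_sum]
    rw [← Finset.smul_sum, Finset.sum_comm]
    congr 1
    refine Finset.sum_congr rfl fun t _ => ?_
    rw [Finset.sum_comm]
    refine Finset.sum_congr rfl fun d _ => ?_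
    refine (sum_adjoin_interaction s _ _ _ _
      fun w => Sum.elim x (encOpt (if w 0 then some h else none))).trans ?_
    refine Finset.sum_congr rfl fun A _ => Finset.sum_congr rfl fun op _ => ?_
    rw [commitBob_extract κ hC t (d 0) h h A op]
    rfl
  -- for a fixed commitment `A`, the string `h ⊕ xtr A` of the simulator is uniform, like that of an
  -- honest Bob
  simp only [h1, commitPhaseState_eq]
  simp only [← Finset.smul_sum, smul_smul]
  rw [mul_comm]
  congr 1
  rw [Finset.sum_comm]
  refine Finset.sum_congr rfl fun t _ => ?_
  rw [Finset.sum_comm]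
  refine Finset.sum_congr rfl fun d _ => ?_
  rw [Finset.sum_comm, Finset.sum_comm (s := (Finset.univ : Finset (Bits (ℓ κ))))]
  refine Finset.sum_congr rfl fun A _ => ?_
  simp only [bxor_comm _ (C.xtr κ A (C.genB κ t).2)]
  exact sum_bxor (C.xtr κ A (C.genB κ t).2) fun b => ∑ op,
        adjoin (QAlice.twoMoves s A (commitBob C κ
          (if d 0 then some (C.genB κ t).1 else none) b A).1 op (k (C.genB κ t).1 ρ d))
          (Sum.elim x (encOpt ((commitBob C κ
          (if d 0 then some (C.genB κ t).1 else none) b A).2 op).2))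

end CommitPhase

/-! ### Negligible functions -/

theorem Negligible.add {f g : ℕ → ℝ} (hf : Negligible f) (hg : Negligible g) :
    Negligible fun κ => f κ + g κ :=
  Asymptotics.SuperpolynomialDecay.add hf hg

theorem Negligible.const_mul {f : ℕ → ℝ} (hf : Negligible f) (c : ℝ) :
    Negligible fun κ => c * f κ :=
  Asymptotics.SuperpolynomialDecay.const_mul hf c

theorem Negligible.of_abs_le {f g : ℕ → ℝ} (hg : Negligible g) (h : ∀ κ, |f κ| ≤ g κ) :
    Negligible f :=
  Asymptotics.SuperpolynomialDecay.trans_abs_le hg fun κ => (h κ).trans (le_abs_self _)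

/-! ### Efficiency of the commitment phase and of the simulator -/

theorem PolyComputes.comp_output {I O O' : ℕ → Type} [∀ κ, Fintype (I κ)]
    [∀ κ, DecidableEq (I κ)] [∀ κ, Fintype (O κ)] [∀ κ, DecidableEq (O κ)] [∀ κ, Fintype (O' κ)]
    [∀ κ, DecidableEq (O' κ)] {f : ∀ κ, (I κ → Bool) → (O κ → Bool)} (hf : PolyComputes f)
    (hO' : PolyBounded fun κ => Fintype.card (O' κ)) (e : ∀ κ, O' κ → O κ) :
    PolyComputes fun κ x => f κ x ∘ e κ :=
  (polyComputes_select hf.card_output hO' e).comp hf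

section CommitPhase

variable {ℓ : ℕ → ℕ} {C : CommitmentScheme ℓ} {W : ℕ → Type} [∀ κ, Fintype (W κ)]
  [∀ κ, DecidableEq (W κ)]

theorem polyImplements_commitPhase (hC : C.Efficient) (s : ∀ κ, QAlice (W κ) (commitRounds C κ))
    (hs : PolyBounded fun κ => QAlice.gateCount _ (s κ)) {z : ℕ → ℕ} (hz : PolyBounded z) :
    PolyImplements fun κ => commitPhase C κ (s κ) (z κ) := by
  have hℓ := hC.polyBounded_msgLen
  have hr := hC.polyBounded_rLen
  have hcom := hC.polyBounded_comLen
  have hI₂ : PolyBounded fun κ => Fintype.card ((((Fin (z κ) ⊕ Fin (κ + 1)) ⊕ Fin (ℓ κ)) ⊕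
      Fin (C.comLen κ)) ⊕ Fin (ℓ κ + C.rLen κ)) := by
    simpa using (((hz.add (polyBounded_id.add (polyBounded_const 1))).add hℓ).add hcom).add
      (hℓ.add hr)
  have hI₁ : PolyBounded fun κ => Fintype.card (((Fin (z κ) ⊕ Fin (κ + 1)) ⊕ Fin (ℓ κ)) ⊕
      Fin (C.comLen κ)) :=
    hI₂.of_le fun κ => by simp only [Fintype.card_sum]; omega
  refine PolyImplements.random (polyImplements_interaction s hs ?_ ?_)
  · exact hC.polyComputes_commitBob hI₁ (e := fun _ i => Sum.inl (Sum.inl (Sum.inr i)))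
      (b := fun _ i => Sum.inl (Sum.inr i)) fun _ x => x ∘ Sum.inr
  · exact (polyComputes_select (O := fun κ => Fin (z κ)) hI₂ (by simpa using hz)
      fun κ i => Sum.inl (Sum.inl (Sum.inl (Sum.inl i)))).pair
      (hC.polyComputes_commitBob_output hI₂
        (e := fun _ i => Sum.inl (Sum.inl (Sum.inl (Sum.inr i))))
        (b := fun _ i => Sum.inl (Sum.inl (Sum.inr i)))
        (A := fun _ i => Sum.inl (Sum.inr i)) (op := fun _ i => Sum.inr i))

theorem polyImplements_simulator (hC : C.Efficient) (s : ∀ κ, QAlice (W κ) (commitRounds C κ))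
    (hs : PolyBounded fun κ => QAlice.gateCount _ (s κ)) {k : ∀ κ, Kernel (W κ) (Fin κ) (Fin 1)}
    (hk : PolyImplements k) :
    PolyImplements fun κ => simulator C κ (s κ) (k κ) := by
  have hℓ := hC.polyBounded_msgLen
  have hr := hC.polyBounded_rLen
  have hcom := hC.polyBounded_comLen
  have hcoins : PolyBounded C.coinsB := hC.polyComputes_genB.card_input.of_le fun κ => by simp
  have hsk : PolyBounded C.skLen := hC.polyComputes_genB.card_output.of_le fun κ => by simp
  have hI₂ : PolyBounded fun κ => Fintype.card ((((Fin (ℓ κ) ⊕ Fin (C.coinsB κ)) ⊕ Fin 1) ⊕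
      Fin (C.comLen κ)) ⊕ Fin (ℓ κ + C.rLen κ)) := by
    simpa using (((hℓ.add hcoins).add (polyBounded_const 1)).add hcom).add (hℓ.add hr)
  have hI₁ : PolyBounded fun κ => Fintype.card (((Fin (ℓ κ) ⊕ Fin (C.coinsB κ)) ⊕ Fin 1) ⊕
      Fin (C.comLen κ)) :=
    hI₂.of_le fun κ => by simp only [Fintype.card_sum]; omega
  have hI₀ : PolyBounded fun κ => Fintype.card (Fin (ℓ κ) ⊕ Fin (C.coinsB κ)) :=
    hI₂.of_le fun κ => by simp only [Fintype.card_sum]; omega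
  have hcard : ∀ {n : ℕ → ℕ}, PolyBounded n → PolyBounded fun κ => Fintype.card (Fin (n κ)) :=
    fun h => by simpa using h
  have hpk : PolyComputes fun κ (t : Bits (C.coinsB κ)) => (C.genB κ t).1 :=
    hC.polyComputes_genB.comp_output (hcard polyBounded_id) fun _ => Sum.inl
  have hskc : PolyComputes fun κ (t : Bits (C.coinsB κ)) => (C.genB κ t).2 :=
    hC.polyComputes_genB.comp_output (hcard hsk) fun _ => Sum.inr
  -- the output of Bob in the key generation, as seen by the simulator
  have hkey₁ := PolyComputes.encOpt_mask
    (polyBit_select hI₁ fun κ => Sum.inl (Sum.inr (0 : Fin 1)))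
    (hpk.comp_select hI₁ fun κ i => Sum.inl (Sum.inl (Sum.inr i)))
  have hkey₂ := PolyComputes.encOpt_mask
    (polyBit_select hI₂ fun κ => Sum.inl (Sum.inl (Sum.inr (0 : Fin 1))))
    (hpk.comp_select hI₂ fun κ i => Sum.inl (Sum.inl (Sum.inl (Sum.inr i))))
  have hA₁ := polyComputes_select (O := fun κ => Fin (C.comLen κ)) hI₁ (hcard hcom)
    fun κ i => Sum.inr i
  have hh₁ := polyComputes_select (O := fun κ => Fin (ℓ κ)) hI₁ (hcard hℓ)
    fun κ i => Sum.inl (Sum.inl (Sum.inl i))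
  have hx₁ := hC.polyComputes_xtr.comp
    (hA₁.pair (hskc.comp_select hI₁ fun κ i => Sum.inl (Sum.inl (Sum.inr i))))
  have hmsg := (hC.polyComputes_commitBob (I := fun κ => Fin (κ + 1) ⊕ Fin (ℓ κ))
    (e := fun _ => Sum.inl) (b := fun _ => Sum.inr)
    (by simpa using (polyBounded_id.add (polyBounded_const 1)).add hℓ) fun _ _ _ => false).comp
    (hkey₁.pair (hh₁.xor hx₁))
  have hrest := polyComputes_select
    (O := fun κ => (Fin (ℓ κ) ⊕ Fin (C.comLen κ)) ⊕ Fin (ℓ κ + C.rLen κ)) hI₂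
    (by simpa using (hℓ.add hcom).add (hℓ.add hr))
    fun κ => Sum.map (Sum.map (fun i => Sum.inl (Sum.inl i)) id) id
  have hB := hC.polyComputes_commitBob_output
    (I := fun κ => Fin (κ + 1) ⊕ ((Fin (ℓ κ) ⊕ Fin (C.comLen κ)) ⊕ Fin (ℓ κ + C.rLen κ)))
    (e := fun _ => Sum.inl) (b := fun _ i => Sum.inr (Sum.inl (Sum.inl i)))
    (A := fun _ i => Sum.inr (Sum.inl (Sum.inr i))) (op := fun _ i => Sum.inr (Sum.inr i))
    (by simpa using
          (polyBounded_id.add (polyBounded_const 1)).add ((hℓ.add hcom).add (hℓ.add hr)))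
  have hout := (hB.comp (hkey₂.pair hrest)).comp_output
    (O' := fun _ => Fin 1) (by simpa using polyBounded_const 1) fun κ _ => 0
  refine PolyImplements.random (PolyImplements.bind
    (hk.precomp (hpk.comp_select hI₀ fun κ => Sum.inr))
    (polyImplements_interaction s hs (E := fun κ => (Fin (ℓ κ) ⊕ Fin (C.coinsB κ)) ⊕ Fin 1)
      (msg := fun κ x A => (commitBob C κ
          (if x (Sum.inr 0) then some (C.genB κ (x ∘ Sum.inl ∘ Sum.inr)).1 else none)
          (bxor (x ∘ Sum.inl ∘ Sum.inl) (C.xtr κ A (C.genB κ (x ∘ Sum.inl ∘ Sum.inr)).2)) A).1)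
      (fin := fun κ x A op _ => encOpt ((commitBob C κ
          (if x (Sum.inr 0) then some (C.genB κ (x ∘ Sum.inl ∘ Sum.inr)).1 else none)
          (x ∘ Sum.inl ∘ Sum.inl) A).2 op).2 0) ?_ ?_) fun _ => id)
  · convert hmsg using 3 with κ x
    rw [Sum.elim_comp_inl, decOpt_encOpt]
    rfl
  · convert hout using 3 with κ x
    rw [Sum.elim_comp_inl, decOpt_encOpt]
    rfl

end CommitPhase

/-- A distinguisher for keys: on input of a key `pk`, prepare the input of the adversary, run the
ideal-world adversary `k` with `pk`, and run the circuit `G` on the resulting state. -/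
theorem exists_key_distinguisher {uLen zLen aLen : ℕ → ℕ} (S : Sampler uLen zLen) (hS : S.Poly)
    (ha : PolyBounded aLen)
    {k : ∀ κ, Kernel (Reg (uLen κ) (zLen κ) (aLen κ)) (Fin κ) (Fin 1)} (hk : PolyImplements k)
    {G : ∀ κ, Kernel (Reg (uLen κ) (zLen κ) (aLen κ)) (Fin (zLen κ) ⊕ Fin (κ + 1)) (Fin 1)}
    (hG : PolyImplements G) :
    ∃ (g : ∀ κ, Bits κ → ℝ) (D : ∀ κ, Distinguisher (Fin κ)),
      (∀ κ pk, g κ pk = ∑ z, ∑ d, (G κ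
        (Sum.elim z (encOpt (if d 0 then some pk else none)))
        (k κ pk (S.init κ (aLen κ) z) d) fun _ => true).trace.re) ∧
      PolyBounded (fun κ => (D κ).anc + (D κ).gates.length) ∧
      (∀ κ p, (D κ).accept (classicalState p) = ∑ pk, p pk * g κ pk) ∧
      ∀ κ pk, 0 ≤ g κ pk ∧ g κ pk ≤ 1 := by
  have hu : PolyBounded uLen := PolyBounded.of_le hS fun κ => by omega
  have hz : PolyBounded zLen := PolyBounded.of_le hS fun κ => by omega
  have hcard : ∀ {n : ℕ → ℕ}, PolyBounded n → PolyBounded fun κ => Fintype.card (Fin (n κ)) :=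
    fun h => by simpa using h
  choose kS hkS hkS' using fun κ => S.exists_kernel (E := Fin κ) κ (aLen κ)
  have hkS : PolyImplements kS := by
    refine ⟨_, ?_, hkS⟩
    exact ((polyBounded_id.add ((polyBounded_const 2).mul hS))).of_le fun κ => by
      simp only [Fintype.card_fin]; omega
  have hI₁ : PolyBounded fun κ => Fintype.card (Fin κ ⊕ Fin (zLen κ)) := by
    simpa using polyBounded_id.add hz
  have hI₂ : PolyBounded fun κ => Fintype.card ((Fin κ ⊕ Fin (zLen κ)) ⊕ Fin 1) := by
    simpa using (polyBounded_id.add hz).add (polyBounded_const 1)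
  have hf := (polyComputes_select (O := fun κ => Fin (zLen κ)) hI₂ (hcard hz)
    fun κ i => Sum.inl (Sum.inr i)).pair (PolyComputes.encOpt_mask
      (polyBit_select hI₂ fun κ => Sum.inr (0 : Fin 1))
      (polyComputes_select (O := fun κ => Fin κ) hI₂ (hcard polyBounded_id)
        fun κ i => Sum.inl (Sum.inl i)))
  have hK := hkS.bind (PolyImplements.bind (hk.precomp
    (polyComputes_select (O := fun κ => Fin κ) hI₁ (hcard polyBounded_id) fun κ => Sum.inl))
    (hG.precomp hf) fun _ => id) fun _ => id
  obtain ⟨t, ht, hK⟩ := hK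
  choose D hD hD' using fun κ => (hK κ).exists_classical_distinguisher
  refine ⟨_, D, fun κ pk => ?_, ?_, hD', fun κ pk => ⟨?_, ?_⟩⟩
  · simp only [hkS', Matrix.trace_sum, Complex.re_sum]
    rfl
  · refine (((hu.add hz).add ha).add ht).of_le fun κ => (hD κ).trans ?_
    simp
  · exact (Complex.nonneg_iff.1
      ((hK κ).posSemidef pk single_posSemidef fun _ => true).trace_nonneg).1
  · have h1 := congrArg Complex.re ((hK κ).sum_trace pk
      (Matrix.single (fun _ => false) (fun _ => false) 1))
    rw [single_trace, Complex.one_re, Complex.re_sum] at h1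
    rw [← h1]
    exact Finset.single_le_sum (f := fun w => Complex.re (Matrix.trace _))
      (fun w _ => (Complex.nonneg_iff.1
        ((hK κ).posSemidef pk single_posSemidef w).trace_nonneg).1) (Finset.mem_univ fun _ => true)

/-! ### Enforceability against Alice -/

theorem Distinguisher.accept_inv_two_pow_smul {E : Type} [Fintype E] [DecidableEq E]
    (D : Distinguisher E) (n : ℕ) (ρ : State E) :
    D.accept (((2 : ℂ) ^ n)⁻¹ • ρ) = ((2 : ℝ) ^ n)⁻¹ * D.accept ρ := by
  rw [← D.accept_smul]
  push_cast
  rfl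

/-- The expectations of a function with values in `[0, 1]` differ by at most twice the statistical
distance. -/
theorem abs_sum_sub_le_statDist {α : Type} [Fintype α] (p q g : α → ℝ)
    (hg : ∀ a, 0 ≤ g a ∧ g a ≤ 1) :
    |∑ a, p a * g a - ∑ a, q a * g a| ≤ 2 * statDist p q := by
  have h : 2 * statDist p q = ∑ a, |p a - q a| := by
    rw [statDist]
    ring
  rw [h, ← Finset.sum_sub_distrib]
  refine (Finset.abs_sum_le_sum_abs _ _).trans 
    (Finset.sum_le_sum (f := fun a => |p a * g a - q a * g a|) fun a _ => ?_)
  rw [← sub_mul, abs_mul, abs_of_nonneg (hg a).1]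
  exact mul_le_of_le_one_right (abs_nonneg _) (hg a).2

theorem statDist_nonneg {α : Type} [Fintype α] (p q : α → ℝ) : 0 ≤ statDist p q := by
  unfold statDist
  positivity

/-- Indistinguishability from the simulator: the key from the ideal functionality for `π` is
replaced by a key from the hiding generator, since these are almost uniform, and then by a key from
the binding generator. With the latter, the commitment phase is simulated perfectly. -/
theorem forceRandom_enforceable {ℓ : ℕ → ℕ} {C : CommitmentScheme ℓ} (hC : C.IsMixed)
    {π : Protocol fun κ => κ} (hπ : π.EnforceableAgainstAlice) :
    (forceRandom C π).EnforceableAgainstAlice := by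
  refine ⟨forceRandom_efficient hC.efficient hπ.1, forceRandom_unbiased C hπ.2.1, fun A hA => ?_⟩
  have hu : PolyBounded A.uLen := PolyBounded.of_le hA fun κ => by omega
  have hz : PolyBounded A.zLen := PolyBounded.of_le hA fun κ => by omega
  have ha : PolyBounded A.anc := PolyBounded.of_le hA fun κ => by omega
  have hcount : ∀ κ, QAlice.gateCount ((forceRandom C π).rounds κ) (A.strat κ) =
      QAlice.gateCount (π.rounds κ) (QAlice.take (π.rounds κ) (A.strat κ)) +
      QAlice.gateCount (commitRounds C κ) (QAlice.drop (π.rounds κ) (A.strat κ)) :=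
    fun κ => QAlice.gateCount_append (π.rounds κ) (A.strat κ)
  obtain ⟨I, hI, hind⟩ := hπ.2.2
    ⟨A.uLen, A.zLen, A.anc, fun κ => QAlice.take (π.rounds κ) (A.strat κ)⟩
    (PolyBounded.of_le hA fun κ => by rw [hcount κ]; dsimp only; omega)
  have hs : PolyBounded fun κ =>
      QAlice.gateCount (commitRounds C κ) (QAlice.drop (π.rounds κ) (A.strat κ)) :=
    PolyBounded.of_le hA fun κ => by rw [hcount κ]; omega
  have hkI : PolyImplements fun κ => (I κ).kernel :=
    ⟨_, (polyBounded_id.add hI).of_le fun κ => by rw [Nat.add_assoc],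
      fun κ => (I κ).implements_kernel⟩
  obtain ⟨t, ht, hsim⟩ := polyImplements_simulator hC.efficient
    (fun κ => QAlice.drop (π.rounds κ) (A.strat κ)) hs hkI
  choose J hJ hJk using fun κ => (hsim κ).exists_idealAlice
  refine ⟨J, ht.of_le hJ, fun S hS D hD => ?_⟩
  have hphase := polyImplements_commitPhase hC.efficient
    (fun κ => QAlice.drop (π.rounds κ) (A.strat κ)) hs hz
  choose kD hkD hkD' using fun κ => (D κ).exists_kernel
  have hkD : PolyImplements kD := by
    refine ⟨_, ?_, hkD⟩
    simp only [Fintype.card_sum, Fintype.card_fin]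
    exact ((hz.add (hC.efficient.polyBounded_msgLen.add (polyBounded_const 1))).add hD).add
      (polyBounded_const 2) |>.of_le fun κ => by omega
  have hG := hphase.bind hkD fun _ => Sum.inr
  have hGacc : ∀ κ v ρ, Complex.re (Matrix.trace (∑ d, kD κ (Sum.elim v d ∘ Sum.inr)
      (commitPhase C κ (QAlice.drop (π.rounds κ) (A.strat κ)) (A.zLen κ) v ρ d) fun _ => true)) =
      (D κ).accept (commitPhaseState C κ (QAlice.drop (π.rounds κ) (A.strat κ)) v ρ) := by
    intro κ v ρ
    rw [Matrix.trace_sum, Complex.re_sum, commitPhaseState, Distinguisher.accept_sum]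
    exact Finset.sum_congr rfl fun d _ => hkD' κ _ _
  obtain ⟨g, K, hg, hK, hKacc, hg01⟩ := exists_key_distinguisher S hS ha hkI hG
  obtain ⟨t', ht', hG'⟩ := hG
  choose D' hD' hDacc using fun κ => (hG' κ).exists_distinguisher
  have hDacc' : ∀ κ v ρ, (D' κ).accept (adjoin ρ v) =
      (D κ).accept (commitPhaseState C κ (QAlice.drop (π.rounds κ) (A.strat κ)) v ρ) :=
    fun κ v ρ => (hDacc κ v ρ).trans (hGacc κ v ρ)
  have h1 := hind S hS D' (ht'.of_le hD')
  have h2 := hC.keyIndist K hK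
  refine ((h1.add (hC.almostUniform.const_mul 2)).add h2).of_abs_le fun κ => ?_
  rw [abs_abs]
  -- the protocol, with the key generation of `π`
  have e1 : (D κ).accept (realOutput (forceRandom C π) A S κ) = (D' κ).accept (realOutput π
      ⟨A.uLen, A.zLen, A.anc, fun κ => QAlice.take (π.rounds κ) (A.strat κ)⟩ S κ) := by
    rw [realOutput_forceRandom, realOutput]
    simp only [Distinguisher.accept_inv_two_pow_smul, Distinguisher.accept_sum]
    simp only [hDacc']
  -- the ideal key generation: a uniform key
  have e2 : (D' κ).accept (idealOutput I S κ) = ∑ pk, ((2 : ℝ) ^ κ)⁻¹ * g κ pk := by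
    rw [idealOutput_eq, ← Finset.mul_sum]
    simp only [Distinguisher.accept_inv_two_pow_smul, Distinguisher.accept_sum]
    simp only [hDacc', hg, ← hGacc]
  -- the simulation: a binding key
  have e3 : (D κ).accept (idealOutput J S κ) =
      ∑ pk, law (fun t => (C.genB κ t).1) pk * g κ pk := by
    have e4 : idealOutput J S κ = ∑ z, (((2 : ℂ) ^ ℓ κ)⁻¹ • ∑ h : Bits (ℓ κ), ∑ d : Fin 1 → Bool,
        adjoin (simulator C κ (QAlice.drop (π.rounds κ) (A.strat κ)) (I κ).kernel h
          (S.init κ (A.anc κ) z) d) (Sum.elim z (encOpt (if d 0 then some h else none)))) := by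
      rw [idealOutput_eq, ← Finset.smul_sum, Finset.sum_comm]
      simp only [hJk]
    rw [e4, sum_law_mul]
    simp only [sum_adjoin_simulator C κ hC, Distinguisher.accept_inv_two_pow_smul,
      Distinguisher.accept_sum]
    rw [← Finset.mul_sum, Finset.sum_comm]
    simp only [hg, hGacc, Fintype.card_fun, Fintype.card_bool, Fintype.card_fin]
    push_cast
    rfl
  have e5 := abs_sum_sub_le_statDist (law (C.genH κ)) (fun _ => ((2 : ℝ) ^ κ)⁻¹) (g κ) (hg01 κ)
  rw [e1, e3, e2, hKacc, hKacc]
  rw [abs_sub_comm] at e5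
  refine (abs_sub_le _ (∑ pk, ((2 : ℝ) ^ κ)⁻¹ * g κ pk) _).trans ?_
  rw [add_assoc]
  refine add_le_add_right ((abs_sub_le _ (∑ pk, law (C.genH κ) pk * g κ pk) _).trans ?_) _
  rw [abs_sub_comm (∑ pk, law (C.genH κ) pk * g κ pk)]
  exact add_le_add_left e5 _

/-! ### The commitment phase against a dishonest Bob -/

theorem trace_re_nonneg {W : Type} [Fintype W] [DecidableEq W] {ρ : State W} (h : ρ.PosSemidef) :
    0 ≤ ρ.trace.re :=
  (Complex.nonneg_iff.1 h.trace_nonneg).1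

theorem encOpt_some_injective {n : ℕ} : Function.Injective fun b : Bits n => encOpt (some b) := by
  intro b c h
  have := congrArg decOpt h
  simpa [decOpt_encOpt] using this

theorem encOpt_eq_of_decOpt {n : ℕ} {v : Bits (n + 1)} {b : Bits n} (h : decOpt v = some b) :
    v = encOpt (some b) := by
  by_cases hv : v 0 = true
  · rw [decOpt, if_pos hv, Option.some.injEq] at h
    rw [← h]
    refine (Fin.cons_self_tail v).symm.trans ?_
    rw [hv]
    rfl
  · rw [decOpt, if_neg hv] at h
    cases h

section CommitBob

variable {ℓ : ℕ → ℕ} (C : CommitmentScheme ℓ) (κ : ℕ) {W : Type} [Fintype W] [DecidableEq W]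

theorem QBob.trace_run_last {O : Type} [DecidableEq O] {m : ℕ} (s : QBob W [(m, 0)]) (op : Bits m)
    (out : O) (ρ : State W) (y : O) :
    (QBob.run [(m, 0)] s ((op, fun _ => out) : Bits m × (Bits 0 → O)) ρ y).trace =
      if y = out then ρ.trace else 0 := by
  have h : QBob.run [(m, 0)] s ((op, fun _ => out) : Bits m × (Bits 0 → O)) ρ y =
      ∑ v : Bits 0, if y = out then applyAll s.2 (project s.1.out v (applyAll s.1.gates
        (write s.1.inp op ρ))) else 0 := rfl
  rw [h]
  split_ifs
  · rw [Matrix.trace_sum]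
    refine (Finset.sum_congr rfl fun v _ => applyAll_trace _ _).trans ?_
    rw [sum_project_trace, applyAll_trace, write_trace]
  · simp

/-- The probability that a dishonest Bob with register in state `ρ` answers the commitment `A`
with `b`. -/
def QBob.answerProb {nA nB : ℕ} {rs : List (ℕ × ℕ)} (s : QBob W ((nA, nB + 1) :: rs)) (ρ : State W)
    (A : Bits nA) (b : Bits nB) : ℝ :=
  (project s.1.out (encOpt (some b)) (applyAll s.1.gates (write s.1.inp A ρ))).trace.re

theorem QBob.answerProb_nonneg {nA nB : ℕ} {rs : List (ℕ × ℕ)} (s : QBob W ((nA, nB + 1) :: rs))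
    {ρ : State W} (hρ : ρ.PosSemidef) (A : Bits nA) (b : Bits nB) : 0 ≤ s.answerProb ρ A b :=
  trace_re_nonneg (project_posSemidef _ _ (applyAll_posSemidef _ (write_posSemidef _ _ hρ)))

theorem QBob.sum_answerProb_le {nA nB : ℕ} {rs : List (ℕ × ℕ)} (s : QBob W ((nA, nB + 1) :: rs))
    {ρ : State W} (hρ : ρ.PosSemidef) (A : Bits nA) :
    ∑ b, s.answerProb ρ A b ≤ ρ.trace.re := by
  have h := congrArg Complex.re
    (sum_project_trace s.1.out (applyAll s.1.gates (write s.1.inp A ρ)))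
  rw [applyAll_trace, write_trace, Complex.re_sum] at h
  rw [← h]
  simp only [QBob.answerProb]
  rw [← Finset.sum_image (s := Finset.univ) (g := fun b : Bits nB => encOpt (some b))
    (f := fun v => (project s.1.out v (applyAll s.1.gates (write s.1.inp A ρ))).trace.re)
    fun b _ c _ hbc => encOpt_some_injective hbc]
  exact Finset.sum_le_sum_of_subset_of_nonneg (Finset.subset_univ _) fun v _ _ =>
    trace_re_nonneg (project_posSemidef _ _ (applyAll_posSemidef _ (write_posSemidef _ _ hρ)))

/-- Alice outputs `x` exactly if the answer is `a ⊕ x`. The reaction of Bob to the opening does not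
matter. -/
theorem trace_run_commitAlice_some (s : QBob W (commitRounds C κ)) (k : Bits κ) (a : Bits (ℓ κ))
    (r : Bits (C.rLen κ)) (ρ : State W) (x : Bits (ℓ κ)) :
    (QBob.run (commitRounds C κ) s (commitAlice C κ (some k) a r) ρ (some x)).trace.re =
      s.answerProb ρ (C.commit κ k a r) (bxor a x) := by
  have h : ∀ v : Bits (ℓ κ + 1), (QBob.run [(ℓ κ + C.rLen κ, 0)] s.2
      ((commitAlice C κ (some k) a r).2 v) (project s.1.out v (applyAll s.1.gates
        (write s.1.inp (C.commit κ k a r) ρ))) (some x)).trace =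
      if v = encOpt (some (bxor a x)) then (project s.1.out v (applyAll s.1.gates
        (write s.1.inp (C.commit κ k a r) ρ))).trace else 0 := by
    intro v
    cases hv : decOpt v with
    | none =>
      have he : (commitAlice C κ (some k) a r).2 v = (((fun _ => false), fun _ => none) :
          Bits (ℓ κ + C.rLen κ) × (Bits 0 → Option (Bits (ℓ κ)))) := by
        simp only [commitAlice, hv]
        rfl
      rw [he]
      refine (QBob.trace_run_last s.2 _ _ _ _).trans (if_congr ?_ rfl rfl)
      refine ⟨fun h => (by cases h), ?_⟩
      rintro rfl
      rw [decOpt_encOpt] at hv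
      cases hv
    | some b =>
      have he : (commitAlice C κ (some k) a r).2 v = ((Fin.append a r, fun _ => some (bxor a b)) :
          Bits (ℓ κ + C.rLen κ) × (Bits 0 → Option (Bits (ℓ κ)))) := by
        simp only [commitAlice, hv]
        rfl
      rw [he]
      refine (QBob.trace_run_last s.2 _ _ _ _).trans (if_congr ?_ rfl rfl)
      rw [encOpt_eq_of_decOpt hv, encOpt_some_injective.eq_iff, Option.some.injEq,
        eq_comm, bxor_eq_iff]
  have h1 : QBob.run (commitRounds C κ) s (commitAlice C κ (some k) a r) ρ (some x) =
      ∑ v : Bits (ℓ κ + 1), QBob.run [(ℓ κ + C.rLen κ, 0)] s.2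
        ((commitAlice C κ (some k) a r).2 v) (project s.1.out v (applyAll s.1.gates
        (write s.1.inp (C.commit κ k a r) ρ))) (some x) := rfl
  rw [h1, Matrix.trace_sum, Finset.sum_congr rfl fun v _ => h v]
  rw [Finset.sum_ite_eq' Finset.univ (encOpt (some (bxor a x))), if_pos (Finset.mem_univ _)]
  rfl

theorem run_commitAlice_none (s : QBob W (commitRounds C κ)) (a : Bits (ℓ κ))
    (r : Bits (C.rLen κ)) (ρ : State W) (x : Bits (ℓ κ)) :
    (QBob.run (commitRounds C κ) s (commitAlice C κ none a r) ρ (some x)).trace = 0 := by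
  have h1 : QBob.run (commitRounds C κ) s (commitAlice C κ none a r) ρ (some x) =
      ∑ v : Bits (ℓ κ + 1), QBob.run [(ℓ κ + C.rLen κ, 0)] s.2
        (((fun _ => false), fun _ => none) : Bits (ℓ κ + C.rLen κ) × (Bits 0 → Option (Bits (ℓ κ))))
        (project s.1.out v (applyAll s.1.gates (write s.1.inp (fun _ => false) ρ))) (some x) := rfl
  rw [h1, Matrix.trace_sum]
  refine Finset.sum_eq_zero fun v _ => ?_
  exact (QBob.trace_run_last s.2 _ (none : Option (Bits (ℓ κ))) _ (some x)).trans (if_neg (by simp))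

/-- The probability that the key generation has the outcome `o` for Alice and that she outputs `y`
at the end. Here `ρ` is the state of the register of Bob after the key generation, and its trace is
the probability of `o`. -/
def commitOutcome (s : QBob W (commitRounds C κ)) (o : Option (Bits κ)) (ρ : State W)
    (y : Option (Bits (ℓ κ))) : ℝ :=
  ((2 : ℝ) ^ (ℓ κ + C.rLen κ))⁻¹ * ∑ a, ∑ r,
    (QBob.run (commitRounds C κ) s (commitAlice C κ o a r) ρ y).trace.re

theorem commitOutcome_nonneg (s : QBob W (commitRounds C κ)) (o : Option (Bits κ)) {ρ : State W}
    (hρ : ρ.PosSemidef) (y : Option (Bits (ℓ κ))) : 0 ≤ commitOutcome C κ s o ρ y :=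
  mul_nonneg (by positivity) (Finset.sum_nonneg fun _ _ => Finset.sum_nonneg fun _ _ =>
    trace_re_nonneg (QBob.run_posSemidef _ _ _ hρ _))

theorem sum_commitOutcome (s : QBob W (commitRounds C κ)) (o : Option (Bits κ)) (ρ : State W) :
    ∑ y, commitOutcome C κ s o ρ y = ρ.trace.re := by
  simp only [commitOutcome]
  rw [← Finset.mul_sum, Finset.sum_comm]
  have h : ∀ a r, ∑ y, (QBob.run (commitRounds C κ) s (commitAlice C κ o a r) ρ y).trace.re =
      ρ.trace.re := by
    intro a r
    rw [← Complex.re_sum, QBob.sum_run_trace]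
  have h' : ∀ a : Bits (ℓ κ), ∑ y, ∑ r,
      (QBob.run (commitRounds C κ) s (commitAlice C κ o a r) ρ y).trace.re =
      2 ^ C.rLen κ * ρ.trace.re := by
    intro a
    rw [Finset.sum_comm, Finset.sum_congr rfl fun r _ => h a r]
    simp
  rw [Finset.sum_congr rfl fun a _ => h' a]
  simp only [Finset.sum_const, Finset.card_univ, Fintype.card_fun, Fintype.card_bool,
    Fintype.card_fin, nsmul_eq_mul]
  push_cast
  rw [pow_add]
  field_simp

theorem commitOutcome_none_some (s : QBob W (commitRounds C κ)) (ρ : State W) (x : Bits (ℓ κ)) :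
    commitOutcome C κ s none ρ (some x) = 0 := by
  simp [commitOutcome, run_commitAlice_none]

theorem commitOutcome_some_some (s : QBob W (commitRounds C κ)) (k : Bits κ) (ρ : State W)
    (x : Bits (ℓ κ)) :
    commitOutcome C κ s (some k) ρ (some x) = ((2 : ℝ) ^ ℓ κ)⁻¹ * ∑ a, ∑ A,
      law (C.commit κ k a) A * s.answerProb ρ A (bxor a x) := by
  simp only [commitOutcome, trace_run_commitAlice_some]
  rw [pow_add, mul_inv, mul_assoc, Finset.mul_sum]
  congr 1
  refine Finset.sum_congr rfl fun a _ => ?_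
  rw [sum_law_mul]
  simp

/-- A bound on the advantage that Bob has for the outcome `x` when commitments are not perfectly
hiding. -/
def hidingDefect (s : QBob W (commitRounds C κ)) (k : Bits κ) (ρ : State W) (x : Bits (ℓ κ)) : ℝ :=
  ((2 : ℝ) ^ ℓ κ)⁻¹ * ∑ a, ∑ A, |law (C.commit κ k a) A - law (C.commit κ k fun _ => false) A| *
    s.answerProb ρ A (bxor a x)

/-- The average statistical distance of a commitment to a random message and a commitment to zero,
for a fixed key. -/
def hidingDistance (k : Bits κ) : ℝ :=
  ((2 : ℝ) ^ ℓ κ)⁻¹ * ∑ a, statDist (law (C.commit κ k a)) (law (C.commit κ k fun _ => false))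

/-- If the commitment were independent of `a`, then so would be the answer `b`, and `a ⊕ b` would
be uniform. -/
theorem commitOutcome_le (s : QBob W (commitRounds C κ)) (k : Bits κ) {ρ : State W}
    (hρ : ρ.PosSemidef) (x : Bits (ℓ κ)) :
    commitOutcome C κ s (some k) ρ (some x) ≤
      ((2 : ℝ) ^ ℓ κ)⁻¹ * ρ.trace.re + hidingDefect C κ s k ρ x := by
  rw [commitOutcome_some_some, hidingDefect, ← mul_add]
  refine mul_le_mul_of_nonneg_left ?_ (by positivity)
  have h1 : ∑ a, ∑ A, law (C.commit κ k fun _ => false) A * s.answerProb ρ A (bxor a x)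
      ≤ ρ.trace.re := by
    rw [Finset.sum_comm]
    have h2 : ∀ A, ∑ a, law (C.commit κ k fun _ => false) A * s.answerProb ρ A (bxor a x)
        ≤ law (C.commit κ k fun _ => false) A * ρ.trace.re := by
      intro A
      rw [← Finset.mul_sum]
      refine mul_le_mul_of_nonneg_left ?_ (law_nonneg _ _)
      simp only [bxor_comm _ x]
      rw [sum_bxor x fun b => s.answerProb ρ A b]
      exact s.sum_answerProb_le hρ A
    refine (Finset.sum_le_sum fun A _ => h2 A).trans ?_
    rw [← Finset.sum_mul, sum_law, one_mul]
  refine le_trans ?_ (add_le_add_left h1 _)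
  rw [← Finset.sum_add_distrib]
  refine Finset.sum_le_sum fun a _ => ?_
  rw [← Finset.sum_add_distrib]
  refine Finset.sum_le_sum fun A _ => ?_
  rw [← add_mul]
  refine mul_le_mul_of_nonneg_right ?_ (s.answerProb_nonneg hρ _ _)
  have := le_abs_self (law (C.commit κ k a) A - law (C.commit κ k fun _ => false) A)
  linarith

theorem hidingDefect_nonneg (s : QBob W (commitRounds C κ)) (k : Bits κ) {ρ : State W}
    (hρ : ρ.PosSemidef) (x : Bits (ℓ κ)) : 0 ≤ hidingDefect C κ s k ρ x :=
  mul_nonneg (by positivity) (Finset.sum_nonneg fun _ _ => Finset.sum_nonneg fun _ _ =>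
    mul_nonneg (abs_nonneg _) (s.answerProb_nonneg hρ _ _))

theorem sum_hidingDefect_le (s : QBob W (commitRounds C κ)) (k : Bits κ) {ρ : State W}
    (hρ : ρ.PosSemidef) :
    ∑ x, hidingDefect C κ s k ρ x ≤ 2 * (hidingDistance C κ k * ρ.trace.re) := by
  simp only [hidingDefect, hidingDistance]
  have e : 2 * (((2 : ℝ) ^ ℓ κ)⁻¹ * (∑ a, statDist (law (C.commit κ k a))
      (law (C.commit κ k fun _ => false))) * ρ.trace.re) = ((2 : ℝ) ^ ℓ κ)⁻¹ * ∑ a,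
      2 * statDist (law (C.commit κ k a)) (law (C.commit κ k fun _ => false)) * ρ.trace.re := by
    rw [← Finset.sum_mul, ← Finset.mul_sum]
    ring
  rw [e, ← Finset.mul_sum, Finset.sum_comm]
  refine mul_le_mul_of_nonneg_left ?_ (by positivity)
  refine Finset.sum_le_sum fun a _ => ?_
  rw [Finset.sum_comm, statDist]
  have h : ∀ A, ∑ x, |law (C.commit κ k a) A - law (C.commit κ k fun _ => false) A| *
      s.answerProb ρ A (bxor a x) ≤
      |law (C.commit κ k a) A - law (C.commit κ k fun _ => false) A| * ρ.trace.re := by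
    intro A
    rw [← Finset.mul_sum, sum_bxor a fun b => s.answerProb ρ A b]
    exact mul_le_mul_of_nonneg_left (s.sum_answerProb_le hρ A) (abs_nonneg _)
  refine (Finset.sum_le_sum fun A _ => h A).trans (le_of_eq ?_)
  rw [← Finset.sum_mul]
  ring

end CommitBob

/-! ### The key generation against a dishonest Bob -/

section KeyState

variable {ℓ : ℕ → ℕ} (C : CommitmentScheme ℓ) (π : Protocol fun κ => κ)
  (B : BobAdversary (forceRandom C π).rounds) (S : Sampler B.uLen B.zLen) (κ : ℕ)

/-- The part of an adversary that takes part in the key generation. -/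
def keyAdversary : BobAdversary π.rounds :=
  ⟨B.uLen, B.zLen, B.anc, fun κ => QBob.take (π.rounds κ) (B.strat κ)⟩

variable {C π B} in
theorem keyAdversary_poly (hB : B.Poly) : (keyAdversary C π B).Poly :=
  PolyBounded.of_le hB fun κ => by
    have h : QBob.gateCount ((forceRandom C π).rounds κ) (B.strat κ) =
      QBob.gateCount (π.rounds κ) (QBob.take (π.rounds κ) (B.strat κ)) +
      QBob.gateCount (commitRounds C κ) (QBob.drop (π.rounds κ) (B.strat κ)) :=
      QBob.gateCount_append (π.rounds κ) (B.strat κ)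
    rw [h]
    dsimp only [keyAdversary]
    omega

/-- The state of the register of Bob after the key generation, weighted with the probability of the
outcome `o` for Alice. -/
def keyState (o : Option (Bits κ)) : State (Reg (B.uLen κ) (B.zLen κ) (B.anc κ)) :=
  ((2 : ℂ) ^ π.coinsA κ)⁻¹ • ∑ t : Bits (π.coinsA κ), ∑ z : Bits (B.zLen κ),
    QBob.run (π.rounds κ) (QBob.take (π.rounds κ) (B.strat κ)) (π.alice κ t)
      (S.init κ (B.anc κ) z) o

theorem keyState_posSemidef (o : Option (Bits κ)) : (keyState C π B S κ o).PosSemidef := by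
  refine (sum_posSemidef _ fun t _ => sum_posSemidef _ fun z _ =>
    QBob.run_posSemidef _ _ _ (S.init_posSemidef κ _ z) _).smul ?_
  rw [← Complex.ofReal_ofNat, ← Complex.ofReal_pow, ← Complex.ofReal_inv]
  exact Complex.zero_le_real.2 (by positivity)

theorem re_inv_two_pow_mul (n : ℕ) (c : ℂ) :
    (((2 : ℂ) ^ n)⁻¹ * c).re = ((2 : ℝ) ^ n)⁻¹ * c.re := by
  rw [← Complex.re_ofReal_mul]
  push_cast
  rfl

theorem keyState_trace (o : Option (Bits κ)) :
    (keyState C π B S κ o).trace.re = outcomeProb π (keyAdversary C π B) S κ o := by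
  rw [keyState, Matrix.trace_smul, smul_eq_mul, re_inv_two_pow_mul]
  simp only [Matrix.trace_sum, Complex.re_sum]
  rfl

theorem sum_keyState_trace : ∑ o, (keyState C π B S κ o).trace.re = 1 := by
  have h : ∑ o, (keyState C π B S κ o).trace = 1 := by
    simp only [keyState, Matrix.trace_smul, Matrix.trace_sum]
    rw [← Finset.smul_sum, Finset.sum_comm]
    have h1 : ∀ t : Bits (π.coinsA κ), ∑ o, ∑ z : Bits (B.zLen κ),
        (QBob.run (π.rounds κ) (QBob.take (π.rounds κ) (B.strat κ)) (π.alice κ t)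
          (S.init κ (B.anc κ) z) o).trace = 1 := by
      intro t
      rw [Finset.sum_comm, Finset.sum_congr rfl fun z _ => QBob.sum_run_trace _ _ _ _]
      exact S.sum_init_trace κ _
    rw [Finset.sum_congr rfl fun t _ => h1 t]
    simp
  rw [← Complex.re_sum, h, Complex.one_re]

theorem outcomeProb_forceRandom (y : Option (Bits (ℓ κ))) :
    outcomeProb (forceRandom C π) B S κ y = ∑ o, commitOutcome C κ
      (QBob.drop (π.rounds κ) (B.strat κ)) o (keyState C π B S κ o) y := by
  have h1 : outcomeProb (forceRandom C π) B S κ y =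
      ((2 : ℝ) ^ (π.coinsA κ + (ℓ κ + C.rLen κ)))⁻¹ *
      ∑ t : Bits (π.coinsA κ + (ℓ κ + C.rLen κ)), ∑ z : Bits (B.zLen κ),
      (QBob.run (π.rounds κ ++ commitRounds C κ) (B.strat κ)
        (AliceStrat.bind (π.rounds κ) (π.alice κ (left t)) fun pk =>
          commitAlice C κ pk (left (right t)) (right (right t)))
        (S.init κ (B.anc κ) z) y).trace.re := rfl
  have h2 : ∀ (t : Bits (π.coinsA κ)) (a : Bits (ℓ κ)) (r : Bits (C.rLen κ)) (z : Bits (B.zLen κ)),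
      (QBob.run (π.rounds κ ++ commitRounds C κ) (B.strat κ)
        (AliceStrat.bind (π.rounds κ) (π.alice κ t) fun pk => commitAlice C κ pk a r)
        (S.init κ (B.anc κ) z) y).trace.re = ∑ o, (QBob.run (commitRounds C κ)
          (QBob.drop (π.rounds κ) (B.strat κ)) (commitAlice C κ o a r)
          (QBob.run (π.rounds κ) (QBob.take (π.rounds κ) (B.strat κ)) (π.alice κ t)
            (S.init κ (B.anc κ) z) o) y).trace.re := by
    intro t a r z
    rw [QBob.run_bind (fun pk => commitAlice C κ pk a r) y (π.rounds κ) (B.strat κ) (π.alice κ t),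
      Matrix.trace_sum, Complex.re_sum]
  rw [h1]
  simp only [h2]
  rw [sum_left_right (fun t w => ∑ z : Bits (B.zLen κ), ∑ o, (QBob.run (commitRounds C κ)
          (QBob.drop (π.rounds κ) (B.strat κ)) (commitAlice C κ o (left w) (right w))
          (QBob.run (π.rounds κ) (QBob.take (π.rounds κ) (B.strat κ)) (π.alice κ t)
            (S.init κ (B.anc κ) z) o) y).trace.re)]
  have h3 : ∀ t, ∑ w : Bits (ℓ κ + C.rLen κ), ∑ z : Bits (B.zLen κ), ∑ o,
      (QBob.run (commitRounds C κ)
          (QBob.drop (π.rounds κ) (B.strat κ)) (commitAlice C κ o (left w) (right w))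
          (QBob.run (π.rounds κ) (QBob.take (π.rounds κ) (B.strat κ)) (π.alice κ t)
            (S.init κ (B.anc κ) z) o) y).trace.re = ∑ a, ∑ r, ∑ z : Bits (B.zLen κ), ∑ o,
      (QBob.run (commitRounds C κ)
          (QBob.drop (π.rounds κ) (B.strat κ)) (commitAlice C κ o a r)
          (QBob.run (π.rounds κ) (QBob.take (π.rounds κ) (B.strat κ)) (π.alice κ t)
            (S.init κ (B.anc κ) z) o) y).trace.re := fun t =>
    sum_left_right (fun a r => ∑ z : Bits (B.zLen κ), ∑ o,
      (QBob.run (commitRounds C κ)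
          (QBob.drop (π.rounds κ) (B.strat κ)) (commitAlice C κ o a r)
          (QBob.run (π.rounds κ) (QBob.take (π.rounds κ) (B.strat κ)) (π.alice κ t)
            (S.init κ (B.anc κ) z) o) y).trace.re)
  simp only [h3]
  have h4 : ∀ o, commitOutcome C κ (QBob.drop (π.rounds κ) (B.strat κ)) o (keyState C π B S κ o) y
      = ((2 : ℝ) ^ (ℓ κ + C.rLen κ))⁻¹ * (((2 : ℝ) ^ π.coinsA κ)⁻¹ *
        ∑ a, ∑ r, ∑ t : Bits (π.coinsA κ), ∑ z : Bits (B.zLen κ), (QBob.run (commitRounds C κ)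
          (QBob.drop (π.rounds κ) (B.strat κ)) (commitAlice C κ o a r)
          (QBob.run (π.rounds κ) (QBob.take (π.rounds κ) (B.strat κ)) (π.alice κ t)
            (S.init κ (B.anc κ) z) o) y).trace.re) := by
    intro o
    rw [commitOutcome]
    congr 1
    simp only [Finset.mul_sum (s := (Finset.univ : Finset (Bits (ℓ κ)))),
      Finset.mul_sum (s := (Finset.univ : Finset (Bits (C.rLen κ))))]
    refine Finset.sum_congr rfl fun a _ => Finset.sum_congr rfl fun r _ => ?_
    obtain ⟨L, hL⟩ := QBob.run_exists_linear (commitRounds C κ)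
      (QBob.drop (π.rounds κ) (B.strat κ)) (commitAlice C κ o a r) y
    simp only [hL, keyState, map_smul, map_sum, Matrix.trace_smul, smul_eq_mul,
      re_inv_two_pow_mul, Matrix.trace_sum, Complex.re_sum]
  simp only [h4]
  rw [← Finset.mul_sum, ← Finset.mul_sum, ← mul_assoc, pow_add, mul_inv,
    mul_comm ((2 : ℝ) ^ π.coinsA κ)⁻¹]
  congr 1
  rw [Finset.sum_comm]
  rw [Finset.sum_comm (s := (Finset.univ : Finset (Option (Bits κ))))]
  refine Finset.sum_congr rfl fun a _ => ?_
  rw [Finset.sum_comm]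
  rw [Finset.sum_comm (s := (Finset.univ : Finset (Option (Bits κ))))]
  refine Finset.sum_congr rfl fun r _ => ?_
  rw [Finset.sum_comm (s := (Finset.univ : Finset (Option (Bits κ))))]
  refine Finset.sum_congr rfl fun t _ => ?_
  rw [Finset.sum_comm]

end KeyState

/-! ### Most keys hide the message -/

theorem Negligible.sqrt {f : ℕ → ℝ} (hf : Negligible f) : Negligible fun κ => √(f κ) := by
  intro n
  have h := (Real.continuous_sqrt.tendsto 0).comp (hf (2 * n))
  rw [Real.sqrt_zero] at h
  refine h.congr fun κ => ?_
  change √((κ : ℝ) ^ (2 * n) * f κ) = (κ : ℝ) ^ n * √(f κ)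
  rw [Real.sqrt_mul (by positivity), mul_comm 2 n, pow_mul, Real.sqrt_sq (by positivity)]

theorem law_pair {T T' α β : Type} [Fintype T] [Fintype T'] (f : T → α) (g : α → T' → β) (a : α)
    (b : β) :
    law (fun t : T × T' => (f t.1, g (f t.1) t.2)) (a, b) = law f a * law (g a) b := by
  classical
  simp only [law_eq_sum, Fintype.card_prod, Nat.cast_mul, mul_inv, Fintype.sum_prod_type]
  rw [mul_mul_mul_comm, Finset.sum_mul_sum]
  congr 1
  refine Finset.sum_congr rfl fun t _ => Finset.sum_congr rfl fun t' _ => ?_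
  by_cases h : f t = a
  · subst h
    simp
  · simp [h]

theorem statDist_law_pair {T T' α β : Type} [Fintype T] [Fintype T'] [Fintype α] [Fintype β]
    (f : T → α) (g g' : α → T' → β) :
    statDist (law fun t : T × T' => (f t.1, g (f t.1) t.2))
      (law fun t : T × T' => (f t.1, g' (f t.1) t.2)) =
    ∑ a, law f a * statDist (law (g a)) (law (g' a)) := by
  simp only [statDist, Fintype.sum_prod_type, law_pair, ← mul_sub, abs_mul,
    abs_of_nonneg (law_nonneg f _), ← Finset.mul_sum]
  rw [Finset.mul_sum]
  exact Finset.sum_congr rfl fun a _ => by ring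

theorem statDist_law_le_one {T α : Type} [Fintype T] [Nonempty T] [Fintype α] (f g : T → α) :
    statDist (law f) (law g) ≤ 1 := by
  have h : ∑ a, |law f a - law g a| ≤ ∑ a, (law f a + law g a) :=
    Finset.sum_le_sum fun a _ => abs_le.2
      ⟨by linarith [law_nonneg f a, law_nonneg g a], by linarith [law_nonneg f a, law_nonneg g a]⟩
  rw [Finset.sum_add_distrib, sum_law, sum_law] at h
  rw [statDist]
  linarith

section Keys

variable {ℓ : ℕ → ℕ} {C : CommitmentScheme ℓ}

theorem hidingDistance_nonneg (κ : ℕ) (k : Bits κ) : 0 ≤ hidingDistance C κ k :=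
  mul_nonneg (by positivity) (Finset.sum_nonneg fun _ _ => statDist_nonneg _ _)

theorem inv_two_pow_mul_sum_le {n : ℕ} {f : Bits n → ℝ} {c : ℝ} (h : ∀ a, f a ≤ c) :
    ((2 : ℝ) ^ n)⁻¹ * ∑ a, f a ≤ c := by
  rw [inv_mul_le_iff₀ (by positivity)]
  refine (Finset.sum_le_sum fun a _ => h a).trans (le_of_eq ?_)
  simp

theorem hidingDistance_le_one (κ : ℕ) (k : Bits κ) : hidingDistance C κ k ≤ 1 :=
  inv_two_pow_mul_sum_le fun _ => statDist_law_le_one _ _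

/-- For all but a negligible fraction of the keys, the average statistical distance of commitments
to random messages and commitments to zero is negligible. The bound is the square root of the
expectation for a uniform key, so that Markov's inequality applies. -/
theorem CommitmentScheme.IsMixed.exists_hidingDistance_le (hC : C.IsMixed) :
    ∃ η : ℕ → ℝ, Negligible η ∧ (∀ κ, 0 ≤ η κ) ∧ ∃ Q : ∀ κ, Finset (Bits κ),
      NegligibleSubset (lam := fun κ => κ) Q ∧ ∀ κ, ∀ k ∉ Q κ, hidingDistance C κ k ≤ η κ := by
  obtain ⟨ε, hε, hstat⟩ := hC.statHiding
  let δ : ℕ → ℝ := fun κ => ε κ + 2 * statDist (law (C.genH κ)) (fun _ => ((2 : ℝ) ^ κ)⁻¹)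
  have hδ : Negligible δ := hε.add (hC.almostUniform.const_mul 2)
  have hmean : ∀ κ, ∑ k, ((2 : ℝ) ^ κ)⁻¹ * hidingDistance C κ k ≤ δ κ := by
    intro κ
    have h1 : ∑ k, law (C.genH κ) k * hidingDistance C κ k ≤ ε κ := by
      simp only [hidingDistance, Finset.mul_sum]
      rw [Finset.sum_comm]
      simp only [mul_left_comm _ ((2 : ℝ) ^ ℓ κ)⁻¹]
      simp only [← Finset.mul_sum]
      refine inv_two_pow_mul_sum_le fun a => ?_
      rw [← statDist_law_pair (C.genH κ) (fun k => C.commit κ k a)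
        fun k => C.commit κ k fun _ => false]
      exact hstat κ a _
    have h2 := abs_le.1 (abs_sum_sub_le_statDist (law (C.genH κ)) (fun _ => ((2 : ℝ) ^ κ)⁻¹)
      (hidingDistance C κ) fun k => ⟨hidingDistance_nonneg κ k, hidingDistance_le_one κ k⟩)
    change _ ≤ ε κ + 2 * statDist (law (C.genH κ)) (fun _ => ((2 : ℝ) ^ κ)⁻¹)
    linarith [h2.1]
  have hterm : ∀ κ (k : Bits κ), 0 ≤ ((2 : ℝ) ^ κ)⁻¹ * hidingDistance C κ k := fun κ k =>
    mul_nonneg (by positivity) (hidingDistance_nonneg κ k)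
  have hδ0 : ∀ κ, 0 ≤ δ κ := fun κ => (Finset.sum_nonneg fun k _ => hterm κ k).trans (hmean κ)
  refine ⟨fun κ => √(δ κ), hδ.sqrt, fun κ => Real.sqrt_nonneg _,
    fun κ => Finset.univ.filter fun k => √(δ κ) < hidingDistance C κ k, ?_, fun κ k hk => ?_⟩
  · refine hδ.sqrt.of_abs_le fun κ => ?_
    change |((Finset.univ.filter fun k : Bits κ => √(δ κ) < hidingDistance C κ k).card : ℝ) *
      ((2 : ℝ) ^ κ)⁻¹| ≤ √(δ κ)
    rw [abs_of_nonneg (by positivity)]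
    set Q := Finset.univ.filter fun k => √(δ κ) < hidingDistance C κ k with hQ
    have h1 : √(δ κ) * ((Q.card : ℝ) * ((2 : ℝ) ^ κ)⁻¹) ≤ √(δ κ) * √(δ κ) := by
      rw [Real.mul_self_sqrt (hδ0 κ)]
      refine le_trans ?_ (hmean κ)
      refine le_trans ?_ (Finset.sum_le_sum_of_subset_of_nonneg (Finset.subset_univ Q)
        fun k _ _ => hterm κ k)
      rw [mul_left_comm, ← nsmul_eq_mul]
      refine Finset.card_nsmul_le_sum _ _ _ fun k hk => ?_
      rw [mul_comm]
      exact mul_le_mul_of_nonneg_left (Finset.mem_filter.1 hk).2.le (by positivity)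
    rcases (Real.sqrt_nonneg (δ κ)).eq_or_lt with h0 | h0
    · -- if the bound on the expectation vanishes, then so does the distance for every key
      have hempty : Q = ∅ := by
        refine Finset.filter_eq_empty_iff.2 fun k _ hk => ?_
        have h3 : δ κ = 0 := (Real.sqrt_eq_zero (hδ0 κ)).1 h0.symm
        have h4 := (Finset.single_le_sum (fun k _ => hterm κ k) (Finset.mem_univ k)).trans (hmean κ)
        rw [← h0] at hk
        have h5 : 0 < ((2 : ℝ) ^ κ)⁻¹ * hidingDistance C κ k := mul_pos (by positivity) hk
        linarith
      rw [hempty, Finset.card_empty, Nat.cast_zero, zero_mul]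
      exact h0.le
    · exact le_of_mul_le_mul_left h1 h0
  · simpa using hk

end Keys

/-! ### Randomness against Bob -/

section Random

variable {ℓ : ℕ → ℕ} {C : CommitmentScheme ℓ} {π : Protocol fun κ => κ}

theorem outcomeProb_keyAdversary_nonneg (B : BobAdversary (forceRandom C π).rounds)
    (S : Sampler B.uLen B.zLen) (κ : ℕ) (o : Option (Bits κ)) :
    0 ≤ outcomeProb π (keyAdversary C π B) S κ o := by
  rw [← keyState_trace]
  exact trace_re_nonneg (keyState_posSemidef C π B S κ o)

theorem sum_outcomeProb_keyAdversary_le (B : BobAdversary (forceRandom C π).rounds)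
    (S : Sampler B.uLen B.zLen) (κ : ℕ) :
    ∑ k : Bits κ, outcomeProb π (keyAdversary C π B) S κ (some k) ≤ 1 := by
  rw [← sum_keyState_trace C π B S κ, Fintype.sum_option]
  simp only [keyState_trace]
  linarith [outcomeProb_keyAdversary_nonneg B S κ none]

theorem outcomeProb_forceRandom_some (B : BobAdversary (forceRandom C π).rounds)
    (S : Sampler B.uLen B.zLen) (κ : ℕ) (x : Bits (ℓ κ)) :
    outcomeProb (forceRandom C π) B S κ (some x) = ∑ k : Bits κ, commitOutcome C κ
      (QBob.drop (π.rounds κ) (B.strat κ)) (some k) (keyState C π B S κ (some k)) (some x) := by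
  rw [outcomeProb_forceRandom, Fintype.sum_option, commitOutcome_none_some, zero_add]

theorem outcomeProb_forceRandom_nonneg (B : BobAdversary (forceRandom C π).rounds)
    (S : Sampler B.uLen B.zLen) (κ : ℕ) (y : Option (Bits (ℓ κ))) :
    0 ≤ outcomeProb (forceRandom C π) B S κ y := by
  rw [outcomeProb_forceRandom]
  exact Finset.sum_nonneg fun o _ =>
    commitOutcome_nonneg C κ _ o (keyState_posSemidef C π B S κ o) y

/-- The event is that the outcome is in the part of its distribution that exceeds `2^(-ℓ)`, and it
has small probability since the sum of the hiding defects is small. -/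
theorem forceRandom_statisticallyRandom (hC : C.IsMixed) (hπ : π.UncontrollableAgainstBob) :
    (forceRandom C π).StatisticallyRandomAgainstBob := by
  refine ⟨forceRandom_efficient hC.efficient hπ.1, forceRandom_unbiased C hπ.2.1,
    fun B S hB hS => ?_⟩
  obtain ⟨η, hη, hη0, Q, hQ, hdist⟩ := hC.exists_hidingDistance_le
  have hbad := hπ.2.2 (keyAdversary C π B) S (keyAdversary_poly hB) hS Q hQ
  -- the part of the distribution outside of the event
  let m : ∀ κ, Option (Bits (ℓ κ)) → ℝ := fun κ y =>
    y.elim (outcomeProb (forceRandom C π) B S κ none) fun x =>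
      min (outcomeProb (forceRandom C π) B S κ (some x)) ((2 : ℝ) ^ ℓ κ)⁻¹
  have hm : ∀ κ y, 0 ≤ m κ y ∧ m κ y ≤ outcomeProb (forceRandom C π) B S κ y := by
    intro κ y
    have h0 := outcomeProb_forceRandom_nonneg B S κ y
    cases y with
    | none => exact ⟨h0, le_rfl⟩
    | some x => exact ⟨le_min h0 (by positivity), min_le_left _ _⟩
  refine ⟨fun κ => ⟨fun y e => if e then outcomeProb (forceRandom C π) B S κ y - m κ y else m κ y,
    fun y e => ?_, fun y => ?_⟩, ?_, fun κ x => ?_⟩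
  · cases e
    · exact (hm κ y).1
    · exact sub_nonneg.2 (hm κ y).2
  · simp
  · refine ((hbad.add hη).const_mul 2).of_abs_le fun κ => ?_
    change |∑ y, (outcomeProb (forceRandom C π) B S κ y - m κ y)| ≤ _
    rw [abs_of_nonneg (Finset.sum_nonneg fun y _ => sub_nonneg.2 (hm κ y).2)]
    have hx : ∀ x, outcomeProb (forceRandom C π) B S κ (some x) - m κ (some x) ≤
        ∑ k, hidingDefect C κ (QBob.drop (π.rounds κ) (B.strat κ)) k
          (keyState C π B S κ (some k)) x := by
      intro x
      have h0 : 0 ≤ ∑ k, hidingDefect C κ (QBob.drop (π.rounds κ) (B.strat κ)) k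
          (keyState C π B S κ (some k)) x := Finset.sum_nonneg fun k _ =>
        hidingDefect_nonneg C κ _ k (keyState_posSemidef C π B S κ _) x
      have h1 : outcomeProb (forceRandom C π) B S κ (some x) ≤ ((2 : ℝ) ^ ℓ κ)⁻¹ +
          ∑ k, hidingDefect C κ (QBob.drop (π.rounds κ) (B.strat κ)) k
            (keyState C π B S κ (some k)) x := by
        rw [outcomeProb_forceRandom_some]
        refine (Finset.sum_le_sum fun k _ => commitOutcome_le C κ _ k
          (keyState_posSemidef C π B S κ (some k)) x).trans ?_
        rw [Finset.sum_add_distrib, ← Finset.mul_sum]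
        refine add_le_add_left (mul_le_of_le_one_right (by positivity) ?_) _
        simp only [keyState_trace]
        exact sum_outcomeProb_keyAdversary_le B S κ
      rcases min_choice (outcomeProb (forceRandom C π) B S κ (some x)) ((2 : ℝ) ^ ℓ κ)⁻¹
        with h | h
      · change _ - min _ _ ≤ _
        rw [h, sub_self]
        exact h0
      · change _ - min _ _ ≤ _
        rw [h]
        linarith
    have hnone : outcomeProb (forceRandom C π) B S κ none - m κ none = 0 := sub_self _
    rw [Fintype.sum_option, hnone, zero_add]
    refine (Finset.sum_le_sum fun x _ => hx x).trans ?_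
    rw [Finset.sum_comm]
    refine (Finset.sum_le_sum fun k _ => sum_hidingDefect_le C κ _ k
      (keyState_posSemidef C π B S κ (some k))).trans ?_
    rw [← Finset.mul_sum]
    refine mul_le_mul_of_nonneg_left ?_ (by norm_num)
    simp only [keyState_trace]
    -- bad keys have negligible probability, and good keys have a negligible defect
    have h2 : ∀ k : Bits κ, hidingDistance C κ k * outcomeProb π (keyAdversary C π B) S κ (some k) ≤
        (if k ∈ Q κ then outcomeProb π (keyAdversary C π B) S κ (some k) else 0) +
        η κ * outcomeProb π (keyAdversary C π B) S κ (some k) := by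
      intro k
      have hq := outcomeProb_keyAdversary_nonneg B S κ (some k)
      split_ifs with hk
      · have := mul_le_of_le_one_left hq (hidingDistance_le_one (C := C) κ k)
        linarith [mul_nonneg (hη0 κ) hq]
      · rw [zero_add]
        exact mul_le_mul_of_nonneg_right (hdist κ k hk) hq
    refine (Finset.sum_le_sum fun k _ => h2 k).trans ?_
    rw [Finset.sum_add_distrib, ← Finset.mul_sum, Finset.sum_ite_mem, Finset.univ_inter]
    exact add_le_add_right (mul_le_of_le_one_right (hη0 κ)
      (sum_outcomeProb_keyAdversary_le B S κ)) _
  · exact min_le_right _ _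

open Classical in
/-- The event is that the key is not perfectly hiding. Given any other key, the outcome is uniform
up to aborts. -/
theorem forceRandom_random (hC : C.IsMixed) (hπ : π.UncontrollableAgainstBob)
    (hperf : C.PerfectlyHiding) : (forceRandom C π).RandomAgainstBob := by
  refine ⟨forceRandom_efficient hC.efficient hπ.1, forceRandom_unbiased C hπ.2.1,
    fun B S hB hS => ?_⟩
  let Q : ∀ κ, Finset (Bits κ) := fun κ => Finset.univ.filter fun pk : Bits κ =>
      ¬ ∀ m₁ m₂ : Bits (ℓ κ), law (C.commit κ pk m₁) = law (C.commit κ pk m₂)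
  have hbad := hπ.2.2 (keyAdversary C π B) S (keyAdversary_poly hB) hS Q hperf
  let p : ∀ κ, Option (Bits κ) → Option (Bits (ℓ κ)) → ℝ := fun κ o y =>
    commitOutcome C κ (QBob.drop (π.rounds κ) (B.strat κ)) o (keyState C π B S κ o) y
  have hp0 : ∀ κ o y, 0 ≤ p κ o y := fun κ o y =>
    commitOutcome_nonneg C κ _ o (keyState_posSemidef C π B S κ o) y
  have hpsum : ∀ κ o, ∑ y, p κ o y = outcomeProb π (keyAdversary C π B) S κ o := fun κ o =>
    (sum_commitOutcome C κ _ o _).trans (keyState_trace C π B S κ o)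
  let bad : ∀ κ, Option (Bits κ) → Prop := fun κ o => ∃ k ∈ Q κ, o = some k
  refine ⟨fun κ => ⟨fun y e => ∑ o, if (bad κ o ↔ e = true) then p κ o y else 0,
    fun y e => ?_, fun y => ?_⟩, ?_, fun κ x => ?_⟩
  · refine Finset.sum_nonneg fun o _ => ?_
    split_ifs
    · exact hp0 κ o y
    · exact le_rfl
  · rw [outcomeProb_forceRandom, ← Finset.sum_add_distrib]
    refine Finset.sum_congr rfl fun o _ => ?_
    by_cases ho : bad κ o <;> simp [ho, p]
  · refine hbad.of_abs_le fun κ => ?_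
    have h : ∑ y, ∑ o, (if (bad κ o ↔ true = true) then p κ o y else 0) =
        ∑ x ∈ Q κ, outcomeProb π (keyAdversary C π B) S κ (some x) := by
      rw [Finset.sum_comm, Fintype.sum_option]
      have hnone : ¬ bad κ none := by rintro ⟨k, -, hk⟩; cases hk
      have hsome : ∀ k, bad κ (some k) ↔ k ∈ Q κ := by
        intro k
        constructor
        · rintro ⟨k', hk', h⟩
          rwa [Option.some.inj h]
        · exact fun hk => ⟨k, hk, rfl⟩
      simp only [hnone, hsome, iff_true, if_false, Finset.sum_const_zero, zero_add]
      refine Eq.trans ?_ ((Finset.sum_ite_mem Finset.univ (Q κ) fun k =>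
        outcomeProb π (keyAdversary C π B) S κ (some k)).trans (by rw [Finset.univ_inter]))
      refine Finset.sum_congr rfl fun k _ => ?_
      split_ifs
      · exact hpsum κ _
      · exact Finset.sum_const_zero
    change |∑ y, ∑ o, (if (bad κ o ↔ true = true) then p κ o y else 0)| ≤ _
    rw [h, abs_of_nonneg (Finset.sum_nonneg fun k _ =>
      outcomeProb_keyAdversary_nonneg B S κ (some k))]
  · change ∑ o, (if (bad κ o ↔ false = true) then p κ o (some x) else 0) ≤ ((2 : ℝ) ^ ℓ κ)⁻¹ *
      ∑ y, ∑ o, (if (bad κ o ↔ false = true) then p κ o y else 0)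
    rw [Finset.sum_comm, Finset.mul_sum]
    refine Finset.sum_le_sum fun o _ => ?_
    by_cases ho : bad κ o ↔ false = true
    · simp only [if_pos ho]
      rw [hpsum]
      cases o with
      | none =>
        rw [show p κ none (some x) = 0 from commitOutcome_none_some C κ _ _ x]
        exact mul_nonneg (by positivity) (outcomeProb_keyAdversary_nonneg B S κ none)
      | some k =>
        have hk : k ∉ Q κ := fun hk => by simpa using ho.1 ⟨k, hk, rfl⟩
        have hlaw : ∀ m₁ m₂ : Bits (ℓ κ), law (C.commit κ k m₁) = law (C.commit κ k m₂) := by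
          simpa [Q] using hk
        refine (commitOutcome_le C κ _ k (keyState_posSemidef C π B S κ _) x).trans ?_
        have hdef : hidingDefect C κ (QBob.drop (π.rounds κ) (B.strat κ)) k
            (keyState C π B S κ (some k)) x = 0 := by
          simp [hidingDefect, hlaw _ fun _ => false]
        rw [hdef, add_zero, keyState_trace]
    · simp only [if_neg ho, Finset.sum_const_zero, mul_zero, le_refl]

end Random

end CoinFlip

end

theorem theorem1 (ℓ : ℕ → ℕ) (hℓ : PolyBounded ℓ)
    (C : CommitmentScheme ℓ) (hC : C.IsMixed)
    (π : Protocol fun κ => κ)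
    (hA : π.EnforceableAgainstAlice) (hB : π.UncontrollableAgainstBob) :
    (forceRandom C π).EnforceableAgainstAlice ∧
    (forceRandom C π).StatisticallyRandomAgainstBob ∧
    (C.PerfectlyHiding → (forceRandom C π).RandomAgainstBob) :=
  ⟨forceRandom_enforceable hC hA, forceRandom_statisticallyRandom hC hB,
    forceRandom_random hC hB⟩
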